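/- Let $k$ be a field of characteristic different from $2$, let $R=k[y_1,y_2,y_3]/(y_1^3+y_1^2y_3-y_2^2y_3)$ with its standard grading (the homogeneous coordinate ring of the nodal cubic $Y=\operatorname{Proj}R$), and for $m\ge 1$ let $$\delta_m=\begin{pmatrix}0&y_1&y_2&0&y_3^m&-y_3^m\\ y_1&y_2&0&0&y_3^m&-y_3^m\\ y_3&0&-y_1-y_3&0&0&y_3^m\\ 0&0&0&0&y_1&y_2\\ 0&0&0&y_1&y_2&0\\ 0&0&0&y_3&0&-y_1-y_3\end{pmatrix}.$$ Regard $\delta_m$ as a homogeneous map $R(-2)^3\oplus R(-m-1)^3\to R(-1)^3\oplus R(-m)^3$ and its transpose $\delta_m^t$ as a homogeneous map $R(-m-1)^3\oplus R(-2)^3\to R(-m)^3\oplus R(-1)^3$, so that $\operatorname{Coker}\delta_m$ and $\operatorname{Coker}\delta_m^t$ are $\mathbb Z$-graded $R$-modules. A finitely generated graded $R$-module is called maximal Cohen--Macaulay (MCM) if it is nonzero and its depth with respect to $(y_1,y_2,y_3)$ equals $\dim R$, and locally free if its localization at every homogeneous prime ideal of $R$ not containing $(y_1,y_2,y_3)$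 is free (that is, if its sheafification on $Y$ is locally free). Then: 1. For every $m\ge1$, $\operatorname{Coker}\delta_m$ and $\operatorname{Coker}\delta_m^t$ are graded, indecomposable, non-locally free MCM $R$-modules of rank two with minimal number of generators equal to $6$. 2. Every graded, indecomposable, non-locally free MCM $R$-module of rank two with minimal number of generators equal to $6$ is isomorphic, as a graded module and up to a shift of the grading, to $\operatorname{Coker}\delta_m$ or $\operatorname{Coker}\delta_m^t$ for some $m\ge1$. 3. The modules $\operatorname{Coker}\delta_m$, $\operatorname{Coker}\delta_m^t$ ($m\ge1$) are pairwise non-isomorphic as graded modules, even up to shift, and none of them is isomorphic to a nontrivial shift of itself. In particular, the graded, indecomposable, rank two, non-locally free MCM $R$-modules that are minimally $6$-generated form, up to graded isomorphism and shift, a countably infinite set of classes. -/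

import Mathlib

universe u

namespace NodalCone

open MvPolynomial

section Ring

variable (k : Type u) [Field k]

/-- The polynomial ring `S = k[y₁, y₂, y₃]`; the variable `yᵢ` is `X (i - 1)`. -/
abbrev S : Type u := MvPolynomial (Fin 3) k

/-- The equation `f = y₁³ + y₁² y₃ - y₂² y₃` of the nodal cubic. -/
noncomputable def f : S k := X 0 ^ 3 + X 0 ^ 2 * X 2 - X 1 ^ 2 * X 2

/-- The coordinate ring `R = k[y₁, y₂, y₃] / (f)` of the affine cone over the nodal cubic. -/
abbrev R : Type u := S k ⧸ Ideal.span {f k}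

/-- The class of the variables in `R`: `y k 0 = y₁`, `y k 1 = y₂`, `y k 2 = y₃`. -/
noncomputable def y (i : Fin 3) : R k := Ideal.Quotient.mk _ (X i)

/-- The constant weight `1`: weighted degrees for it are total degrees, with values in `ℤ`. -/
def wt : Fin 3 → ℤ := fun _ => 1

/-- The degree `i` part `R_i` of `R`, for `i : ℤ` (it is `0` for `i < 0`): the classes of the
polynomials that are homogeneous of total degree `i`. -/
noncomputable def Rdeg (i : ℤ) : AddSubgroup (R k) :=
  (weightedHomogeneousSubmodule k wt i).toAddSubgroup.map
    (Ideal.Quotient.mk (Ideal.span {f k})).toAddMonoidHom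

/-- The irrelevant ideal `(y₁, y₂, y₃)` of `R`. -/
noncomputable def irrelevant : Ideal (R k) := Ideal.span (Set.range (y k))

end Ring

section Internal

variable {ι G : Type*} [DecidableEq ι] [AddCommGroup G]

/-- A family of subgroups with a compatible family of projections is a direct sum
decomposition. -/
theorem isInternal_of_proj (A : ι → AddSubgroup G) (p : ι → G →+ G)
    (h2 : ∀ i x, x ∈ A i → p i x = x) (h3 : ∀ i j x, i ≠ j → x ∈ A i → p j x = 0)
    (h4 : ∀ x, ∃ s : Finset ι, ∑ i ∈ s, p i x = x) (h1 : ∀ i x, p i x ∈ A i) :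
    DirectSum.IsInternal A := by
  classical
  constructor
  · rw [injective_iff_map_eq_zero]
    intro x hx
    have key : ∀ (j : ι) (c : DirectSum ι fun i => A i),
        p j (DirectSum.coeAddMonoidHom A c) = (c j : G) := by
      intro j c
      induction c using DirectSum.induction_on with
      | zero => simp
      | of i x =>
        rw [DirectSum.coeAddMonoidHom_of]
        by_cases hij : i = j
        · subst hij; rw [h2 i _ x.2, DirectSum.of_eq_same]
        · rw [h3 i j _ hij x.2, DirectSum.of_eq_of_ne _ _ _ (Ne.symm hij)]; rfl
      | add a b ha hb => rw [map_add, map_add, ha, hb]; rfl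
    ext j
    rw [← key j, hx]; simp
  · intro x
    obtain ⟨s, hs⟩ := h4 x
    refine ⟨∑ i ∈ s, DirectSum.of (fun i => A i) i ⟨p i x, h1 i x⟩, ?_⟩
    rw [map_sum]
    simpa using hs

end Internal

section Grading

variable (k : Type u) [Field k]

attribute [local instance] MvPolynomial.weightedGradedAlgebra

theorem f_homogeneous : IsWeightedHomogeneous (wt : Fin 3 → ℤ) (f k) 3 := by
  have h (i : Fin 3) : IsWeightedHomogeneous (wt : Fin 3 → ℤ) (X i : S k) 1 := by
    simpa [wt] using isWeightedHomogeneous_X k (wt : Fin 3 → ℤ) i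
  have h1 : IsWeightedHomogeneous (wt : Fin 3 → ℤ) (X 0 ^ 3 : S k) 3 := by
    simpa using (h 0).pow 3
  have h2 : IsWeightedHomogeneous (wt : Fin 3 → ℤ) (X 0 ^ 2 * X 2 : S k) 3 := by
    simpa using ((h 0).pow 2).mul (h 2)
  have h3 : IsWeightedHomogeneous (wt : Fin 3 → ℤ) (X 1 ^ 2 * X 2 : S k) 3 := by
    simpa using ((h 1).pow 2).mul (h 2)
  have h4 := (weightedHomogeneousSubmodule k (wt : Fin 3 → ℤ) 3).sub_mem
    ((weightedHomogeneousSubmodule k (wt : Fin 3 → ℤ) 3).add_mem h1 h2) h3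
  exact h4

theorem comp_mem {x : S k} (hx : x ∈ Ideal.span {f k}) (i : ℤ) :
    weightedHomogeneousComponent (wt : Fin 3 → ℤ) i x ∈ Ideal.span {f k} := by
  refine weightedHomogeneousComponent_mem_of_mem k wt (Ideal.homogeneous_span _ _ ?_) hx i
  rintro _ rfl
  exact ⟨3, f_homogeneous k⟩

/-- The projection of `R` onto its part of degree `i`. -/
noncomputable def Rproj (i : ℤ) : R k →+ R k :=
  QuotientAddGroup.map (Ideal.span {f k}).toAddSubgroup (Ideal.span {f k}).toAddSubgroup
    (weightedHomogeneousComponent (R := k) (wt : Fin 3 → ℤ) i).toAddMonoidHom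
    (fun _ hx => comp_mem k hx i)

theorem Rproj_mk (i : ℤ) (x : S k) :
    Rproj k i (Ideal.Quotient.mk _ x) =
      Ideal.Quotient.mk _ (weightedHomogeneousComponent (wt : Fin 3 → ℤ) i x) := rfl

theorem Rproj_mem (i : ℤ) (x : R k) : Rproj k i x ∈ Rdeg k i := by
  obtain ⟨x, rfl⟩ := Ideal.Quotient.mk_surjective x
  exact ⟨_, weightedHomogeneousComponent_mem _ x i, rfl⟩

theorem Rproj_of_mem {i : ℤ} {x : R k} (hx : x ∈ Rdeg k i) (j : ℤ) :
    Rproj k j x = if j = i then x else 0 := by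
  obtain ⟨x, hx, rfl⟩ := hx
  change Rproj k j (Ideal.Quotient.mk _ x) = if j = i then Ideal.Quotient.mk _ x else 0
  rw [Rproj_mk, weightedHomogeneousComponent_of_mem hx]
  split_ifs <;> simp

theorem Rproj_sum (x : R k) : ∃ s : Finset ℤ, (∀ i ∉ s, Rproj k i x = 0) ∧
    ∑ i ∈ s, Rproj k i x = x := by
  obtain ⟨x, rfl⟩ := Ideal.Quotient.mk_surjective x
  have hfin := weightedHomogeneousComponent_finsupp (w := (wt : Fin 3 → ℤ)) x
  refine ⟨hfin.toFinset, fun i hi => ?_, ?_⟩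
  · rw [Rproj_mk]
    have : weightedHomogeneousComponent (wt : Fin 3 → ℤ) i x = 0 := by
      by_contra h
      exact hi (hfin.mem_toFinset.2 h)
    rw [this, map_zero]
  · simp only [Rproj_mk]
    rw [← map_sum, ← finsum_eq_sum _ hfin, sum_weightedHomogeneousComponent]

theorem one_mem_Rdeg : (1 : R k) ∈ Rdeg k 0 :=
  ⟨1, isWeightedHomogeneous_one k _, rfl⟩

theorem mul_mem_Rdeg {i j : ℤ} {a b : R k} (ha : a ∈ Rdeg k i) (hb : b ∈ Rdeg k j) :
    a * b ∈ Rdeg k (i + j) := by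
  obtain ⟨a, ha, rfl⟩ := ha
  obtain ⟨b, hb, rfl⟩ := hb
  exact ⟨a * b, IsWeightedHomogeneous.mul ha hb,
    map_mul (Ideal.Quotient.mk (Ideal.span {f k})) a b⟩

theorem Rproj_mul {i : ℤ} {a : R k} (ha : a ∈ Rdeg k i) (j : ℤ) (b : R k) :
    Rproj k j (a * b) = a * Rproj k (j - i) b := by
  obtain ⟨s, hs0, hs⟩ := Rproj_sum k b
  conv_lhs => rw [← hs, Finset.mul_sum, map_sum]
  rw [Finset.sum_congr rfl fun l _ => Rproj_of_mem k (mul_mem_Rdeg k ha (Rproj_mem k l b)) j]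
  rw [Finset.sum_congr rfl (g := fun l => if l = j - i then a * Rproj k l b else 0)
    (fun l _ => by congr 1; exact propext ⟨fun h => by omega, fun h => by omega⟩)]
  rw [Finset.sum_ite_eq']
  split_ifs with h
  · rfl
  · rw [hs0 _ h, mul_zero]

theorem Rdeg_isInternal : DirectSum.IsInternal (Rdeg k) :=
  isInternal_of_proj _ (Rproj k) (fun i x hx => by simp [Rproj_of_mem k hx])
    (fun i j x hij hx => by rw [Rproj_of_mem k hx, if_neg (Ne.symm hij)])
    (fun x => (Rproj_sum k x).imp fun _ h => h.2) (Rproj_mem k)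

/-- `R` is a (`ℤ`-)graded ring. -/
noncomputable instance : GradedRing (Rdeg k) where
  one_mem := one_mem_Rdeg k
  mul_mem _ _ _ _ := mul_mem_Rdeg k
  toDecomposition := (Rdeg_isInternal k).chooseDecomposition

end Grading

section GradedModules

variable (k : Type u) [Field k]

/-- A `ℤ`-graded module over the graded ring `R`. -/
structure GrMod where
  /-- The underlying module. -/
  carrier : Type u
  [addCommGroup : AddCommGroup carrier]
  [module : Module (R k) carrier]
  /-- The homogeneous components. -/
  deg : ℤ → AddSubgroup carrier
  isInternal : DirectSum.IsInternal deg
  smul_mem : ∀ (i j : ℤ) (r : R k) (x : carrier),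
    r ∈ Rdeg k i → x ∈ deg j → r • x ∈ deg (i + j)

attribute [instance] GrMod.addCommGroup GrMod.module

variable {k}

namespace GrMod

/-- `M ≅ N(j)` as graded modules, where `N(j)_i = N_{i+j}`: an `R`-linear isomorphism that maps
`M_i` onto `N_{i+j}` for all `i`. -/
def IsoShift (M N : GrMod k) (j : ℤ) : Prop :=
  ∃ e : M.carrier ≃ₗ[R k] N.carrier, ∀ (i : ℤ) (x : M.carrier), x ∈ M.deg i ↔ e x ∈ N.deg (i + j)

/-- Isomorphism of graded modules up to a shift of the grading. -/
instance isoUpToShift : Setoid (GrMod k) where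
  r M N := ∃ j : ℤ, M.IsoShift N j
  iseqv :=
    { refl := fun M => ⟨0, LinearEquiv.refl _ _, fun i x => by simp⟩
      symm := by
        rintro M N ⟨j, e, he⟩
        refine ⟨-j, e.symm, fun i x => ?_⟩
        rw [he, LinearEquiv.apply_symm_apply, neg_add_cancel_right]
      trans := by
        rintro M N P ⟨j, e, he⟩ ⟨j', e', he'⟩
        refine ⟨j + j', e.trans e', fun i x => ?_⟩
        rw [he, he', LinearEquiv.trans_apply, add_assoc] }

/-- Graded submodules: those that contain the homogeneous components of their elements, that
is, those that are spanned by homogeneous elements. -/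
def IsGradedSubmodule (M : GrMod k) (N : Submodule (R k) M.carrier) : Prop :=
  ∃ T : Set M.carrier, (∀ x ∈ T, ∃ i, x ∈ M.deg i) ∧ N = Submodule.span (R k) T

/-- `M` is indecomposable: nonzero, and not the direct sum of two nonzero graded submodules. -/
def IsIndecomposable (M : GrMod k) : Prop :=
  Nontrivial M.carrier ∧ ∀ N P : Submodule (R k) M.carrier,
    M.IsGradedSubmodule N → M.IsGradedSubmodule P → IsCompl N P → N = ⊥ ∨ P = ⊥

/-- `M` is a (nonzero) maximal Cohen-Macaulay module: it is finitely generated and its depth with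
respect to the irrelevant ideal is the Krull dimension of `R`, that is, the irrelevant ideal
contains an `M`-regular sequence of length `dim R`. -/
def IsMCM (M : GrMod k) : Prop :=
  Module.Finite (R k) M.carrier ∧ ∃ rs : List (R k),
    (∀ r ∈ rs, r ∈ irrelevant k) ∧ (rs.length : WithBot ℕ∞) = ringKrullDim (R k) ∧
      RingTheory.Sequence.IsRegular M.carrier rs

/-- `M` is locally free on `Proj R`: its localization is free at every homogeneous prime ideal
that does not contain the irrelevant ideal. -/
def IsLocallyFree (M : GrMod k) : Prop :=
  ∀ (p : Ideal (R k)) [p.IsPrime], p.IsHomogeneous (Rdeg k) → ¬ irrelevant k ≤ p →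
    Module.Free (Localization.AtPrime p) (LocalizedModule p.primeCompl M.carrier)

/-- The rank of `M` over the domain `R`. -/
noncomputable def rank (M : GrMod k) : ℕ := Module.finrank (R k) M.carrier

/-- The minimal number of generators of `M` (meaningful for finitely generated `M`). -/
noncomputable def minGens (M : GrMod k) : ℕ := (⊤ : Submodule (R k) M.carrier).spanFinrank

/-- Graded, indecomposable, rank two, non-locally free maximal Cohen-Macaulay modules with
minimal number of generators `6`. -/
def IsSixGenerated (M : GrMod k) : Prop :=
  M.IsMCM ∧ M.IsIndecomposable ∧ M.rank = 2 ∧ ¬ M.IsLocallyFree ∧ M.minGens = 6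

end GrMod

end GradedModules

section Coker

variable {k : Type u} [Field k] {n : ℕ}

/-- The degree `i` part of the graded free module `⊕ᵣ R(-d r)`, whose `r`-th basis vector has
degree `d r`. -/
noncomputable def freeDeg (d : Fin n → ℤ) (i : ℤ) : AddSubgroup (Fin n → R k) :=
  AddSubgroup.pi Set.univ fun r => Rdeg k (i - d r)

theorem mem_freeDeg {d : Fin n → ℤ} {i : ℤ} {v : Fin n → R k} :
    v ∈ freeDeg d i ↔ ∀ r, v r ∈ Rdeg k (i - d r) := by
  simp [freeDeg, AddSubgroup.mem_pi]

/-- The matrix `A` defines a graded map `⊕ R(-c j) → ⊕ R(-d i)` of degree zero: the entry in row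
`i` and column `j` is homogeneous of degree `c j - d i`. -/
def IsGradedMatrix (A : Matrix (Fin n) (Fin n) (R k)) (d c : Fin n → ℤ) : Prop :=
  ∀ i j, A i j ∈ Rdeg k (c j - d i)

/-- The projection of `⊕ᵣ R(-d r)` onto its part of degree `i`. -/
noncomputable def freeProj (d : Fin n → ℤ) (i : ℤ) : (Fin n → R k) →+ (Fin n → R k) where
  toFun v r := Rproj k (i - d r) (v r)
  map_zero' := by ext; simp
  map_add' v w := by ext; simp

theorem freeProj_mulVec {A : Matrix (Fin n) (Fin n) (R k)} {d c : Fin n → ℤ}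
    (h : IsGradedMatrix A d c) (i : ℤ) (v : Fin n → R k) :
    freeProj d i (A.mulVec v) = A.mulVec (freeProj c i v) := by
  ext r
  simp only [freeProj, AddMonoidHom.coe_mk, ZeroHom.coe_mk, Matrix.mulVec, dotProduct, map_sum]
  refine Finset.sum_congr rfl fun j _ => ?_
  rw [Rproj_mul k (h r j)]
  rw [show i - d r - (c j - d r) = i - c j by ring]

/-- The degree `i` part of the cokernel of `A` with target `⊕ᵣ R(-d r)`. -/
noncomputable def cokerDeg (A : Matrix (Fin n) (Fin n) (R k)) (d : Fin n → ℤ) (i : ℤ) :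
    AddSubgroup ((Fin n → R k) ⧸ LinearMap.range A.mulVecLin) :=
  (freeDeg d i).map (LinearMap.range A.mulVecLin).mkQ.toAddMonoidHom

/-- The projection of the cokernel onto its part of degree `i`. -/
noncomputable def cokerProj (A : Matrix (Fin n) (Fin n) (R k)) (d c : Fin n → ℤ)
    (h : IsGradedMatrix A d c) (i : ℤ) :
    ((Fin n → R k) ⧸ LinearMap.range A.mulVecLin) →+
      ((Fin n → R k) ⧸ LinearMap.range A.mulVecLin) :=
  QuotientAddGroup.map (LinearMap.range A.mulVecLin).toAddSubgroup
    (LinearMap.range A.mulVecLin).toAddSubgroup (freeProj d i) (by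
      rintro _ ⟨v, rfl⟩
      exact ⟨freeProj c i v, (freeProj_mulVec h i v).symm⟩)

theorem cokerProj_mk (A : Matrix (Fin n) (Fin n) (R k)) (d c : Fin n → ℤ)
    (h : IsGradedMatrix A d c) (i : ℤ) (v : Fin n → R k) :
    cokerProj A d c h i (Submodule.Quotient.mk v) = Submodule.Quotient.mk (freeProj d i v) := rfl

theorem cokerDeg_isInternal (A : Matrix (Fin n) (Fin n) (R k)) (d c : Fin n → ℤ)
    (h : IsGradedMatrix A d c) : DirectSum.IsInternal (cokerDeg A d) := by
  refine isInternal_of_proj _ (cokerProj A d c h) ?_ ?_ ?_ ?_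
  · rintro i _ ⟨v, hv, rfl⟩
    refine congrArg Submodule.Quotient.mk ?_
    ext r
    exact (Rproj_of_mem k (mem_freeDeg.1 hv r) _).trans (if_pos rfl)
  · rintro i j _ hij ⟨v, hv, rfl⟩
    refine (congrArg Submodule.Quotient.mk (?_ : freeProj d j v = 0)).trans
      (Submodule.Quotient.mk_zero _)
    ext r
    exact (Rproj_of_mem k (mem_freeDeg.1 hv r) _).trans (if_neg (by omega))
  · intro x
    obtain ⟨v, rfl⟩ := Submodule.Quotient.mk_surjective _ x
    choose s hs0 hs using fun r => Rproj_sum k (v r)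
    refine ⟨Finset.univ.biUnion fun r => (s r).image fun a => a + d r, ?_⟩
    simp only [cokerProj_mk]
    refine (map_sum (LinearMap.range A.mulVecLin).mkQ (fun i => freeProj d i v) _).symm.trans
      (congrArg _ ?_)
    ext r
    rw [Finset.sum_apply]
    change ∑ i ∈ _, Rproj k (i - d r) (v r) = v r
    rw [← Finset.sum_subset (s₁ := (s r).image fun a => a + d r)
      (Finset.subset_biUnion_of_mem (fun r => (s r).image fun a => a + d r) (Finset.mem_univ r))]
    · rw [Finset.sum_image fun a _ b _ hab => by simpa using hab]
      simpa using hs r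
    · intro i _ hi
      refine hs0 r _ fun hmem => hi ?_
      exact Finset.mem_image.2 ⟨_, hmem, by ring⟩
  · intro i x
    obtain ⟨v, rfl⟩ := Submodule.Quotient.mk_surjective _ x
    exact ⟨freeProj d i v, mem_freeDeg.2 fun r => Rproj_mem k _ _, rfl⟩

/-- The cokernel of the graded map `⊕ R(-c j) → ⊕ R(-d i)` defined by the matrix `A`, with the
grading induced by that of `⊕ R(-d i)`. -/
noncomputable def coker (A : Matrix (Fin n) (Fin n) (R k)) (d c : Fin n → ℤ)
    (h : IsGradedMatrix A d c) : GrMod k where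
  carrier := (Fin n → R k) ⧸ LinearMap.range A.mulVecLin
  deg := cokerDeg A d
  isInternal := cokerDeg_isInternal A d c h
  smul_mem := by
    rintro i j r _ hr ⟨v, hv, rfl⟩
    refine ⟨r • v, mem_freeDeg.2 fun l => ?_, rfl⟩
    have := mul_mem_Rdeg k hr (mem_freeDeg.1 hv l)
    rwa [← add_sub_assoc] at this

end Coker

section Delta

variable (k : Type u) [Field k]

/-- The matrix `δ_m`. -/
noncomputable def delta (m : ℕ) : Matrix (Fin 6) (Fin 6) (R k) :=
  !![0, y k 0, y k 1, 0, y k 2 ^ m, -y k 2 ^ m;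
     y k 0, y k 1, 0, 0, y k 2 ^ m, -y k 2 ^ m;
     y k 2, 0, -y k 0 - y k 2, 0, 0, y k 2 ^ m;
     0, 0, 0, 0, y k 0, y k 1;
     0, 0, 0, y k 0, y k 1, 0;
     0, 0, 0, y k 2, 0, -y k 0 - y k 2]

/-- The degrees of the generators of the cokernel of `δ_m`. -/
def rowDeg (m : ℕ) : Fin 6 → ℤ := ![1, 1, 1, m, m, m]

/-- The degrees of the relations of the cokernel of `δ_m`. -/
def colDeg (m : ℕ) : Fin 6 → ℤ := ![2, 2, 2, m + 1, m + 1, m + 1]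

theorem y_mem (i : Fin 3) : y k i ∈ Rdeg k 1 :=
  ⟨X i, by simpa [wt] using isWeightedHomogeneous_X k (wt : Fin 3 → ℤ) i, rfl⟩

theorem y_pow_mem (i : Fin 3) (m : ℕ) : y k i ^ m ∈ Rdeg k m := by
  simpa using SetLike.pow_mem_graded m (y_mem k i)

theorem delta_graded (m : ℕ) : IsGradedMatrix (delta k m) (rowDeg m) (colDeg m) := by
  have e1 : (2 : ℤ) - 1 = 1 := rfl
  have e2 : (m : ℤ) + 1 - 1 = m := by ring
  have e3 : (m : ℤ) + 1 - m = 1 := by ring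
  have h (i : Fin 3) := y_mem k i
  have hm := y_pow_mem k 2 m
  have hn := neg_mem hm
  have hs : -y k 0 - y k 2 ∈ Rdeg k 1 := sub_mem (neg_mem (h 0)) (h 2)
  intro i j
  fin_cases i <;> fin_cases j <;>
    simp [delta, rowDeg, colDeg, e1, e2, e3, h, hm, hs, zero_mem]

/-- The transposed matrix is graded after exchanging and negating the degrees; the shift by `m + 2` is
a normalization. -/
theorem delta_transpose_graded (m : ℕ) : IsGradedMatrix (delta k m).transpose
    (fun i => m + 2 - colDeg m i) (fun j => m + 2 - rowDeg m j) := by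
  intro i j
  have h := delta_graded k m j i
  rw [Matrix.transpose_apply]
  convert h using 2
  ring

/-- `Coker δ_m`, with generators in degrees `1, 1, 1, m, m, m`. -/
noncomputable def cokerDelta (m : ℕ) : GrMod k :=
  coker (delta k m) (rowDeg m) (colDeg m) (delta_graded k m)

/-- `Coker δ_mᵗ`, with generators in degrees `m, m, m, 1, 1, 1`. -/
noncomputable def cokerDeltaT (m : ℕ) : GrMod k :=
  coker (delta k m).transpose (fun i => m + 2 - colDeg m i) (fun j => m + 2 - rowDeg m j)
    (delta_transpose_graded k m)

end Delta

end NodalCone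

/-! Write P = k[y₂, y₃]. The ring R is free of rank 3 over P, so an MCM module is a graded free
P-module with an action of y₁. Rank two means P-rank 6, and six generators over R mean that the
matrix of y₁ over P has no constant entries.

The normalization is y₁ = s(t² - s²), y₂ = t(t² - s²), y₃ = s³, and the node has the two preimages t
= ±s. Let L = ⊕ₙ H⁰(ℙ¹, O(3n+2)). It has the P-basis e = s², g = st, h = t² - s², whose relations
are recorded in `IsTriple`. Every module in question is an extension of two shifted copies of L.

To find these copies, let Z and T be the actions of y₁ on the fibres k⁶ at (y₂, y₃) = (0, 1) and (1,
0). A map L → M comes from a homogeneous element whose value at (0, 1) is killed by Z and whose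
value at (1, 0) is killed by T² (`exists_isTriple`). A map M → L comes from a functional that kills
im Z and im T² at the respective points (`exists_functional`, `exists_companions`). The equation
forces T³ = 0 with all Jordan blocks of size 3. A Jacobian argument shows that M is locally free
away from the node when 2 ≠ 0, and at the node it is free if dim ker Z ≤ 2. Hence a non-locally free
M has dim ker Z ≥ 3, and a dimension count (`exists_hasTriple_hasFunctional`) gives maps L → M and M
→ L in degrees D ≤ D'. The composite vanishes, as otherwise a copy of L splits off, and M is an
extension.

A change of basis reduces the extension to `NormalForm`, with a cocycle built from y₃^(j+1)(lam s +
mu t). The values of lam s + mu t at the two points over the node are lam ± mu. If neither vanishes,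
M is locally free; if both vanish, M decomposes. What remains is lam = ±mu, and after rescaling only
j and a sign survive. These are the cokernels of δ_{j+1} and of its transpose.

Conversely, in a normal form with (lam, mu) ≠ (0, 0) the only copies of L in the lowest degree are
scalar multiples of the given one (`exists_eq_smul_of_isTriple`). This yields indecomposability and
shows that the lowest degree, j and the ratio of lam and mu are invariants. For lam = ±mu ≠ 0 the
fibre at the node needs three generators, so the module is not locally free. -/

namespace NodalCone

open MvPolynomial

/-! ### The ring R as a free module of rank three over k[y₂, y₃]. -/

section BaseRing

variable (k : Type u) [Field k]

/-- The Noether normalization `k[y₂, y₃]` of `R`. -/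
abbrev P : Type u := MvPolynomial (Fin 2) k

/-- The inclusion of `P` into `R`. -/
noncomputable def toR : P k →ₐ[k] R k := aeval ![y k 1, y k 2]

noncomputable instance : Algebra (P k) (R k) := (toR k).toAlgebra

noncomputable instance : Module (P k) (R k) := Algebra.toModule
noncomputable instance : SMul (P k) (R k) := Algebra.toSMul
noncomputable instance : Module k (R k) := Algebra.toModule

theorem algebraMap_P_eq : algebraMap (P k) (R k) = (toR k : P k →+* R k) := rfl

@[simp] theorem algebraMap_X_zero : algebraMap (P k) (R k) (X 0) = y k 1 := by
  rw [algebraMap_P_eq]; simp [toR]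

@[simp] theorem algebraMap_X_one : algebraMap (P k) (R k) (X 1) = y k 2 := by
  rw [algebraMap_P_eq]; simp [toR]

instance : IsScalarTower k (P k) (R k) :=
  IsScalarTower.of_algebraMap_eq fun c => ((toR k).commutes c).symm

theorem algebraMap_C (c : k) : algebraMap (P k) (R k) (C c) = algebraMap k (R k) c :=
  (toR k).commutes c

theorem relation : y k 0 ^ 3 + y k 0 ^ 2 * y k 2 - y k 1 ^ 2 * y k 2 = 0 := by
  have : (Ideal.Quotient.mk (Ideal.span {f k})) (f k) = 0 :=
    Ideal.Quotient.eq_zero_iff_mem.2 (Ideal.mem_span_singleton_self _)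
  rw [f, map_sub, map_add, map_mul, map_mul, map_pow, map_pow, map_pow] at this
  exact this

/-- Homomorphisms out of `R`. -/
noncomputable def lift {A : Type*} [CommRing A] [Algebra k A] (a : Fin 3 → A)
    (h : a 0 ^ 3 + a 0 ^ 2 * a 2 - a 1 ^ 2 * a 2 = 0) : R k →ₐ[k] A :=
  Ideal.Quotient.liftₐ _ (aeval a) fun x hx => by
    obtain ⟨c, rfl⟩ := Ideal.mem_span_singleton.1 hx
    simp [f, h]

@[simp] theorem lift_y {A : Type*} [CommRing A] [Algebra k A] (a : Fin 3 → A)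
    (h : a 0 ^ 3 + a 0 ^ 2 * a 2 - a 1 ^ 2 * a 2 = 0) (i : Fin 3) : lift k a h (y k i) = a i :=
  aeval_X a i

variable {k} in
theorem R_induction {p : R k → Prop} (hC : ∀ c : k, p (algebraMap k (R k) c))
    (hadd : ∀ a b, p a → p b → p (a + b)) (hmul : ∀ a i, p a → p (a * y k i)) (r : R k) : p r := by
  obtain ⟨r, rfl⟩ := Ideal.Quotient.mk_surjective r
  induction r using MvPolynomial.induction_on with
  | C c => exact hC c
  | add a b ha hb => rw [map_add]; exact hadd _ _ ha hb
  | mul_X a i ha => rw [map_mul]; exact hmul _ _ ha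

theorem R_algHom_ext {A : Type*} [CommRing A] [Algebra k A] {φ ψ : R k →ₐ[k] A}
    (h : ∀ i, φ (y k i) = ψ (y k i)) : φ = ψ := by
  ext r
  induction r using R_induction with
  | hC c => simp
  | hadd a b ha hb => rw [map_add, map_add, ha, hb]
  | hmul a i ha => rw [map_mul, map_mul, ha, h]

open Polynomial in
/-- The equation of the cubic as a monic polynomial in `y₁` over `P`. -/
noncomputable def g : Polynomial (P k) :=
  Polynomial.X ^ 3 + Polynomial.C (X 1) * Polynomial.X ^ 2 - Polynomial.C (X 0 ^ 2 * X 1)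

theorem g_natDegree : (g k).natDegree = 3 := by
  unfold g; compute_degree!

theorem g_monic : (g k).Monic := by
  unfold g; monicity!

/-- `R` is obtained from `P` by adjoining a root of `g`. -/
noncomputable def equivAdjoinRoot : R k ≃ₐ[P k] AdjoinRoot (g k) := by
  let a : Fin 3 → AdjoinRoot (g k) :=
    ![AdjoinRoot.root (g k), AdjoinRoot.of (g k) (X 0), AdjoinRoot.of (g k) (X 1)]
  have ha : a 0 ^ 3 + a 0 ^ 2 * a 2 - a 1 ^ 2 * a 2 = 0 := by
    have h : ∀ {A : Type u} [CommRing A] (i : P k →+* A) (t : A),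
        (g k).eval₂ i t = t ^ 3 + i (X 1) * t ^ 2 - i (X 0 ^ 2 * X 1) := by
      intro A _ i t
      simp only [g, Polynomial.eval₂_add, Polynomial.eval₂_sub, Polynomial.eval₂_mul,
        Polynomial.eval₂_pow, Polynomial.eval₂_X, Polynomial.eval₂_C]
    replace h := (h _ _).symm.trans (AdjoinRoot.eval₂_root (g k))
    simp only [a, Matrix.cons_val]
    rw [map_mul, map_pow] at h
    linear_combination h
  let φ := lift k a ha
  have hφ : ∀ p : P k, φ (algebraMap (P k) (R k) p) = AdjoinRoot.of (g k) p := by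
    intro p
    have : (φ.comp (toR k)) = (Algebra.ofId (P k) (AdjoinRoot (g k))).restrictScalars k := by
      apply MvPolynomial.algHom_ext
      intro i
      fin_cases i
      · simp [toR, φ, a, Algebra.ofId_apply]
      · simp [toR, φ, a, Algebra.ofId_apply]
    exact DFunLike.congr_fun this p
  let φ' : R k →ₐ[P k] AdjoinRoot (g k) := { φ with commutes' := hφ }
  let ψ : AdjoinRoot (g k) →ₐ[P k] R k := AdjoinRoot.liftAlgHom (g k) (Algebra.ofId _ _) (y k 0) (by
    have := relation k
    simp only [g, Polynomial.eval₂_add, Polynomial.eval₂_sub, Polynomial.eval₂_mul,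
      Polynomial.eval₂_pow, Polynomial.eval₂_X, Polynomial.eval₂_C]
    simp
    linear_combination this)
  refine AlgEquiv.ofAlgHom φ' ψ ?_ ?_
  · ext
    change φ (ψ (AdjoinRoot.root (g k))) = AdjoinRoot.root (g k)
    simp [ψ, φ, a]
  · have : (ψ.restrictScalars k).comp φ = AlgHom.id k (R k) := by
      apply R_algHom_ext
      intro i
      fin_cases i
      · simp [ψ, φ, a]
      · simpa [φ, a] using ψ.commutes (X 0)
      · simpa [φ, a] using ψ.commutes (X 1)
    ext r
    exact DFunLike.congr_fun this r

instance : Module.Free (P k) (R k) :=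
  have := (g_monic k).free_adjoinRoot
  Module.Free.of_equiv (equivAdjoinRoot k).symm.toLinearEquiv

instance : Module.Finite (P k) (R k) :=
  have := (g_monic k).finite_adjoinRoot
  Module.Finite.equiv (equivAdjoinRoot k).symm.toLinearEquiv

theorem finrank_P_R : Module.finrank (P k) (R k) = 3 := by
  rw [(equivAdjoinRoot k).toLinearEquiv.finrank_eq, (AdjoinRoot.powerBasis' (g_monic k)).finrank]
  simp [g_natDegree]

/-- Eisenstein's criterion at the prime y₃, which divides the constant term y₂²y₃ exactly once. -/
theorem g_irreducible : Irreducible (g k) := by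
  have hp : Prime (X 1 : P k) := X_prime
  refine Polynomial.IsEisensteinAt.irreducible (𝓟 := Ideal.span {(X 1 : P k)}) ⟨?_, ?_, ?_⟩
    ((Ideal.span_singleton_prime hp.ne_zero).2 hp) (g_monic k).isPrimitive ?_
  · rw [(g_monic k).leadingCoeff]
    exact fun h => hp.not_isUnit (isUnit_of_dvd_one (Ideal.mem_span_singleton.1 h))
  · intro n hn
    rw [g_natDegree] at hn
    rw [Ideal.mem_span_singleton]
    interval_cases n <;> simp [g, Polynomial.coeff_C]
  · rw [Ideal.span_singleton_pow, Ideal.mem_span_singleton]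
    simp only [g, Polynomial.coeff_sub, Polynomial.coeff_add, Polynomial.coeff_C_zero]
    simp
    intro h
    rw [pow_two, mul_dvd_mul_iff_right hp.ne_zero] at h
    have := hp.dvd_of_dvd_pow h
    rw [X_dvd_X] at this
    simp at this
  · rw [g_natDegree]; norm_num

instance : IsDomain (R k) :=
  have : Fact (Irreducible (g k)) := ⟨g_irreducible k⟩
  have : IsDomain (AdjoinRoot (g k)) := AdjoinRoot.isDomain_of_prime (g_irreducible k).prime
  (equivAdjoinRoot k).toMulEquiv.isDomain _

instance : FaithfulSMul (P k) (R k) := inferInstance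

theorem f_ne_zero : f k ≠ 0 := by
  intro h
  have := congrArg (aeval ![(1 : k), 0, 0]) h
  simp [f] at this

/-- The projection of `R` onto `R / (y₁, y₂) = k[T]`. -/
noncomputable def toLine : R k →ₐ[k] Polynomial k := lift k ![0, 0, Polynomial.X] (by simp)

theorem toLine_surjective : Function.Surjective (toLine k) := by
  intro p
  exact ⟨Polynomial.aeval (y k 2) p, by rw [← Polynomial.aeval_algHom_apply]; simp [toLine]⟩

/-- The upper bound holds because R is a hypersurface in three variables, the lower one because R →
k[T] kills the nonzero element y₂ of a domain. -/
theorem ringKrullDim_R : ringKrullDim (R k) = 2 := by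
  have h1 : ringKrullDim (R k) + 1 ≤ ringKrullDim (S k) :=
    ringKrullDim_quotient_succ_le_of_nonZeroDivisor (mem_nonZeroDivisors_of_ne_zero (f_ne_zero k))
  have h2 : ringKrullDim (Polynomial k) + 1 ≤ ringKrullDim (R k) := by
    refine ringKrullDim_succ_le_of_surjective (toLine k).toRingHom (toLine_surjective k) (r := y k 1)
      (mem_nonZeroDivisors_of_ne_zero ?_) (by simp [toLine])
    rw [← algebraMap_X_zero, ne_eq, FaithfulSMul.algebraMap_eq_zero_iff]
    exact X_ne_zero 0
  rw [MvPolynomial.ringKrullDim_of_isNoetherianRing] at h1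
  rw [Polynomial.ringKrullDim_of_isNoetherianRing] at h2
  simp only [ringKrullDim_eq_zero_of_field] at h1 h2
  norm_num at h1 h2
  refine le_antisymm ?_ h2
  have h3 : ringKrullDim (R k) + 1 ≤ 2 + 1 := h1.trans (by norm_num)
  exact ENat.WithBot.add_le_add_one_right_iff.1 h3

end BaseRing

end NodalCone

namespace NodalCone

open MvPolynomial

/-! ### Modules over R viewed over P. -/

section Modules

variable {k : Type u} [Field k]
variable {Q Q' : Type*} [AddCommGroup Q] [Module (R k) Q] [Module (P k) Q]
  [IsScalarTower (P k) (R k) Q] [AddCommGroup Q'] [Module (R k) Q'] [Module (P k) Q']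
  [IsScalarTower (P k) (R k) Q']

theorem X_zero_smul (v : Q) : (X 0 : P k) • v = y k 1 • v := by
  rw [← algebraMap_X_zero, algebraMap_smul]

theorem X_one_smul (v : Q) : (X 1 : P k) • v = y k 2 • v := by
  rw [← algebraMap_X_one, algebraMap_smul]

theorem C_smul (c : k) (v : Q) : (C c : P k) • v = algebraMap k (R k) c • v := by
  rw [← algebraMap_C, algebraMap_smul]

omit [Module (P k) Q] [IsScalarTower (P k) (R k) Q] in
theorem relation_smul (v : Q) : y k 0 • y k 0 • y k 0 • v + y k 2 • y k 0 • y k 0 • v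
    = (y k 1 * y k 1 * y k 2) • v := by
  rw [smul_smul, smul_smul, smul_smul, smul_smul, ← add_smul]
  congr 1
  linear_combination relation k

/-- A `P`-linear map that commutes with `y₁` is `R`-linear. -/
noncomputable def linearOfP (φ : Q →ₗ[P k] Q') (h : ∀ v, φ (y k 0 • v) = y k 0 • φ v) : Q →ₗ[R k] Q' where
  toFun := φ
  map_add' := φ.map_add
  map_smul' r := by
    change ∀ v, φ (r • v) = r • φ v
    induction r using R_induction with
    | hC c => intro v; rw [← C_smul, map_smul, C_smul]
    | hadd a b ha hb => intro v; rw [add_smul, map_add, ha, hb, add_smul]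
    | hmul a i ha =>
      intro v
      rw [mul_smul, ha, mul_smul]
      congr 1
      fin_cases i
      · exact h v
      · simp [← X_zero_smul]
      · simp [← X_one_smul]

/-- A nonzero ideal of a domain that is integral over P contracts to a nonzero ideal of P. -/
theorem exists_P_smul_mem {r : R k} (hr : r ≠ 0) : ∃ p : P k, p ≠ 0 ∧ r ∣ algebraMap (P k) (R k) p := by
  have : Ideal.comap (algebraMap (P k) (R k)) (Ideal.span {r}) ≠ ⊥ :=
    Ideal.comap_ne_bot_of_integral_mem hr (Ideal.mem_span_singleton_self r)
      (Algebra.IsIntegral.isIntegral r)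
  obtain ⟨p, hp, h0⟩ := Submodule.exists_mem_ne_zero_of_ne_bot this
  exact ⟨p, h0, Ideal.mem_span_singleton.1 hp⟩

/-- A maximal R-independent family spans a free module, whose P-rank is three times its R-rank. The
quotient by it is torsion over R, hence over P by `exists_P_smul_mem`. -/
theorem finrank_P_eq [Module.Finite (R k) Q] :
    Module.finrank (P k) Q = 3 * Module.finrank (R k) Q := by
  obtain ⟨n, hn⟩ : ∃ n, n = Module.finrank (R k) Q := ⟨_, rfl⟩
  obtain ⟨v, hv⟩ := exists_linearIndependent_of_le_finrank hn.le
  rw [← hn]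
  have : Module.Finite (P k) Q := Module.Finite.trans (R k) Q
  let N : Submodule (R k) Q := Submodule.span (R k) (Set.range v)
  have hN : Module.finrank (R k) N = n := by
    rw [finrank_span_eq_card hv, Fintype.card_fin]
  have h1 := Submodule.finrank_quotient_add_finrank N
  have hNP : Module.finrank (P k) N = 3 * n := by
    let b := Module.Basis.span hv
    rw [(b.equivFun.restrictScalars (P k)).finrank_eq, Module.finrank_pi_fintype]
    simp [finrank_P_R, mul_comm]
  have h2 := Submodule.finrank_quotient_add_finrank (N.restrictScalars (P k))
  have h3 : Module.finrank (P k) (Q ⧸ N.restrictScalars (P k)) = 0 := by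
    rw [Module.finrank_eq_zero_iff]
    intro q
    obtain ⟨q, rfl⟩ := Submodule.Quotient.mk_surjective _ q
    have h0 : Module.finrank (R k) (Q ⧸ N) = 0 := by omega
    rw [Module.finrank_eq_zero_iff] at h0
    obtain ⟨r, hr, hq⟩ := h0 (Submodule.Quotient.mk q)
    obtain ⟨p, hp, s, hs⟩ := exists_P_smul_mem hr
    refine ⟨p, hp, ?_⟩
    rw [← Submodule.Quotient.mk_smul, Submodule.Quotient.mk_eq_zero] at hq ⊢
    rw [Submodule.restrictScalars_mem, ← algebraMap_smul (R k), hs, mul_comm, mul_smul]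
    exact N.smul_mem _ hq
  change _ + Module.finrank (P k) N = _ at h2
  omega

end Modules

/-! ### Homogeneous components of a graded module. -/

namespace GrMod

variable {k : Type u} [Field k] (M : GrMod k)

noncomputable instance : Module (P k) M.carrier := Module.compHom _ (algebraMap (P k) (R k))

noncomputable instance : Module k M.carrier := Module.compHom _ (algebraMap k (R k))

instance : IsScalarTower (P k) (R k) M.carrier :=
  ⟨fun p r v => by rw [Algebra.smul_def, mul_smul]; rfl⟩

instance : IsScalarTower k (R k) M.carrier :=
  ⟨fun p r v => (congrArg (· • v) (Algebra.smul_def p r)).trans (mul_smul _ _ _)⟩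

instance : IsScalarTower k (P k) M.carrier :=
  ⟨fun p r v => by
    rw [← algebraMap_smul (R k) p (r • v), ← algebraMap_smul (R k) (p • r),
      ← algebraMap_smul (R k) r, smul_smul, ← algebraMap_smul (P k) p r, smul_eq_mul, map_mul]
    congr 2
    exact (IsScalarTower.algebraMap_apply k (P k) (R k) p).symm⟩

/-- The decomposition of `M` into its homogeneous components. -/
noncomputable def decompose : M.carrier ≃+ DirectSum ℤ fun i => M.deg i :=
  (AddEquiv.ofBijective _ M.isInternal).symm

/-- The projection of `M` onto its part of degree `i`. -/
noncomputable def proj (i : ℤ) : M.carrier →+ M.carrier where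
  toFun v := M.decompose v i
  map_zero' := by simp
  map_add' := by simp

theorem proj_mem (i : ℤ) (v : M.carrier) : M.proj i v ∈ M.deg i := (M.decompose v i).2

variable {M}

theorem proj_of_mem {i : ℤ} {v : M.carrier} (hv : v ∈ M.deg i) (j : ℤ) :
    M.proj j v = if j = i then v else 0 := by
  have h : M.decompose v = DirectSum.of (fun i => M.deg i) i ⟨v, hv⟩ := by
    rw [decompose, AddEquiv.symm_apply_eq]
    exact (DirectSum.coeAddMonoidHom_of M.deg i ⟨v, hv⟩).symm
  change (M.decompose v j : M.carrier) = _
  rw [h]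
  split_ifs with hj
  · subst hj; rw [DirectSum.of_eq_same]
  · rw [DirectSum.of_eq_of_ne _ _ _ hj]; rfl

theorem proj_same {i : ℤ} {v : M.carrier} (hv : v ∈ M.deg i) : M.proj i v = v := by
  simp [proj_of_mem hv]

theorem proj_sum (v : M.carrier) : ∃ s : Finset ℤ, (∀ i ∉ s, M.proj i v = 0) ∧
    ∑ i ∈ s, M.proj i v = v := by
  classical
  refine ⟨(M.decompose v).support, fun i hi => ?_, ?_⟩
  · rw [DFinsupp.notMem_support_iff] at hi
    change (M.decompose v i : M.carrier) = 0
    rw [hi]; rfl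
  · have h : DirectSum.coeAddMonoidHom M.deg (M.decompose v) = v :=
      (AddEquiv.ofBijective _ M.isInternal).apply_symm_apply v
    conv_rhs => rw [← h]
    rw [DirectSum.coeAddMonoidHom_eq_dfinsuppSum]
    rfl

theorem ext_proj {v w : M.carrier} (h : ∀ i, M.proj i v = M.proj i w) : v = w := by
  rw [← sub_eq_zero]
  obtain ⟨s, -, hs⟩ := proj_sum (v - w)
  rw [← hs]
  exact Finset.sum_eq_zero fun i _ => by rw [map_sub, h, sub_self]

theorem proj_smul {i : ℤ} {r : R k} (hr : r ∈ Rdeg k i) (j : ℤ) (v : M.carrier) :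
    M.proj j (r • v) = r • M.proj (j - i) v := by
  obtain ⟨s, hs0, hs⟩ := proj_sum v
  conv_lhs => rw [← hs, Finset.smul_sum, map_sum]
  rw [Finset.sum_congr rfl fun l _ => proj_of_mem (M.smul_mem _ _ _ _ hr (M.proj_mem l v)) j]
  rw [Finset.sum_congr rfl (g := fun l => if l = j - i then r • M.proj l v else 0)
    (fun l _ => by congr 1; exact propext ⟨fun h => by omega, fun h => by omega⟩)]
  rw [Finset.sum_ite_eq']
  split_ifs with h
  · rfl
  · rw [hs0 _ h, smul_zero]

theorem proj_y_smul (i : Fin 3) (j : ℤ) (v : M.carrier) :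
    M.proj j (y k i • v) = y k i • M.proj (j - 1) v := proj_smul (y_mem k i) j v

theorem algebraMap_mem_Rdeg (c : k) : algebraMap k (R k) c ∈ Rdeg k 0 :=
  ⟨C c, isWeightedHomogeneous_C _ _, rfl⟩

theorem proj_algebraMap_smul (c : k) (j : ℤ) (v : M.carrier) :
    M.proj j (algebraMap k (R k) c • v) = algebraMap k (R k) c • M.proj j v := by
  rw [proj_smul (algebraMap_mem_Rdeg c), sub_zero]

theorem proj_k_smul (c : k) (j : ℤ) (v : M.carrier) : M.proj j (c • v) = c • M.proj j v :=
  proj_algebraMap_smul c j v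

theorem y_smul_mem (i : Fin 3) {j : ℤ} {v : M.carrier} (hv : v ∈ M.deg j) :
    y k i • v ∈ M.deg (j + 1) := by
  rw [add_comm]; exact M.smul_mem _ _ _ _ (y_mem k i) hv

theorem k_smul_mem (c : k) {j : ℤ} {v : M.carrier} (hv : v ∈ M.deg j) : c • v ∈ M.deg j := by
  have := M.smul_mem _ _ _ _ (algebraMap_mem_Rdeg c) hv
  rwa [zero_add] at this

/-- The homogeneous component as a `k`-subspace. -/
def degSub (M : GrMod k) (i : ℤ) : Submodule k M.carrier :=
  { M.deg i with smul_mem' := fun c _ hv => k_smul_mem c hv }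

theorem y_pow_smul_mem (i : Fin 3) (n : ℕ) {j : ℤ} {v : M.carrier} (hv : v ∈ M.deg j) :
    y k i ^ n • v ∈ M.deg (j + n) := by
  rw [add_comm]; exact M.smul_mem _ _ _ _ (y_pow_mem k i n) hv

end GrMod

end NodalCone

namespace NodalCone

open MvPolynomial

/-! ### Regular pairs. -/

section Koszul

variable {A Q : Type*} [CommRing A] [AddCommGroup Q] [Module A Q]

/-- `r, s` is a (weakly) regular sequence of length two on `Q`. -/
def IsRegularPair (Q : Type*) [AddCommGroup Q] [Module A Q] (r s : A) : Prop :=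
  (∀ v : Q, r • v = 0 → v = 0) ∧ ∀ v w : Q, s • v = r • w → ∃ u, v = r • u

theorem IsRegularPair.pow_right {r s : A} (h : IsRegularPair Q r s) (n : ℕ) :
    IsRegularPair Q r (s ^ n) := by
  refine ⟨h.1, ?_⟩
  induction n with
  | zero => intro v w hv; exact ⟨w, by simpa using hv⟩
  | succ n ih =>
    intro v w hv
    rw [pow_succ, mul_smul] at hv
    obtain ⟨u, hu⟩ := ih _ _ hv
    exact h.2 _ _ hu

theorem IsRegularPair.pow_left {r s : A} (h : IsRegularPair Q r s) (n : ℕ) :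
    IsRegularPair Q (r ^ n) s := by
  induction n with
  | zero => exact ⟨by simp, fun v w _ => ⟨v, by simp⟩⟩
  | succ n ih =>
    refine ⟨fun v hv => ?_, fun v w hv => ?_⟩
    · rw [pow_succ, mul_smul] at hv
      exact h.1 _ (ih.1 _ hv)
    · rw [pow_succ', mul_smul] at hv
      obtain ⟨u, rfl⟩ := h.2 _ _ hv
      have : s • u = r ^ n • w := by
        rw [← sub_eq_zero]
        apply h.1
        rw [smul_sub, sub_eq_zero, ← hv, smul_comm]
      obtain ⟨t, rfl⟩ := ih.2 _ _ this
      exact ⟨t, by rw [pow_succ', mul_smul]⟩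

/-- Koszul exactness passes from a regular pair to every pair p, q whose ideal contains it. With r =
αp + βq and s = γp + δq, the element c sought must satisfy r c = αa + βb. It exists because s(αa +
βb) = r(γa + δb), the difference being a multiple of qa - pb. -/
theorem IsRegularPair.exists_common {r s p q : A} (h : IsRegularPair Q r s)
    (hr : r ∈ Ideal.span {p, q}) (hs : s ∈ Ideal.span {p, q}) {a b : Q} (hab : q • a = p • b) :
    ∃ c, p • c = a ∧ q • c = b := by
  obtain ⟨α, β, rfl⟩ := Ideal.mem_span_pair.1 hr
  obtain ⟨γ, δ, rfl⟩ := Ideal.mem_span_pair.1 hs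
  have key : (γ * p + δ * q) • (α • a + β • b) = (α * p + β * q) • (γ • a + δ • b) := by
    linear_combination (norm := module) (δ * α - β * γ) • hab
  obtain ⟨c, hc⟩ := h.2 _ _ key
  refine ⟨c, ?_, ?_⟩
  · rw [← sub_eq_zero]
    apply h.1
    linear_combination (norm := module) (-β) • hab - p • hc
  · rw [← sub_eq_zero]
    apply h.1
    linear_combination (norm := module) α • hab - q • hc

theorem isRegularPair_of_isWeaklyRegular {r s : A}
    (h : RingTheory.Sequence.IsWeaklyRegular Q [r, s]) : IsRegularPair Q r s := by
  rw [RingTheory.Sequence.isWeaklyRegular_cons_iff,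
    RingTheory.Sequence.isWeaklyRegular_cons_iff] at h
  obtain ⟨h1, h2, -⟩ := h
  refine ⟨fun v hv => h1 (by simpa using hv), fun v w hv => ?_⟩
  have : (Submodule.Quotient.mk v : QuotSMulTop r Q) = 0 := by
    apply h2
    change s • _ = s • _
    rw [smul_zero, ← Submodule.Quotient.mk_smul, Submodule.Quotient.mk_eq_zero, hv]
    exact Submodule.smul_mem_pointwise_smul _ _ _ trivial
  rw [Submodule.Quotient.mk_eq_zero] at this
  obtain ⟨u, -, hu⟩ := this
  exact ⟨u, hu.symm⟩

end Koszul

/-! ### Divisibility in k[y₂, y₃]. -/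

section PolyLemmas

variable {k : Type u} [Field k]

theorem P_decomp (p : P k) : ∃ q r : P k, p = C (constantCoeff p) + X 0 * q + X 1 * r := by
  induction p using MvPolynomial.induction_on with
  | C c => exact ⟨0, 0, by simp⟩
  | add a b ha hb =>
    obtain ⟨q, r, h⟩ := ha
    obtain ⟨q', r', h'⟩ := hb
    exact ⟨q + q', r + r', by rw [map_add, C_add]; linear_combination h + h'⟩
  | mul_X a i ha =>
    fin_cases i
    · exact ⟨a, 0, by simp; ring⟩
    · exact ⟨0, a, by simp; ring⟩

theorem P_decomp_X_one (p : P k) :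
    ∃ q : P k, p = Polynomial.aeval (X 0) (aeval ![Polynomial.X, (0 : Polynomial k)] p) + X 1 * q := by
  induction p using MvPolynomial.induction_on with
  | C c => exact ⟨0, by simp [MvPolynomial.algebraMap_eq]⟩
  | add a b ha hb =>
    obtain ⟨q, h⟩ := ha
    obtain ⟨q', h'⟩ := hb
    exact ⟨q + q', by rw [map_add, map_add]; linear_combination h + h'⟩
  | mul_X a i ha =>
    obtain ⟨q, h⟩ := ha
    fin_cases i
    · exact ⟨X 0 * q, by simp; linear_combination X 0 * h⟩
    · exact ⟨a, by simp; ring⟩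

/-- Modulo y₃ the polynomial p is an element of k[y₂] divisible by all powers of y₂, hence zero. -/
theorem X_one_dvd_of_forall_pow {p : P k} (h : ∀ n : ℕ, ∃ r, (X 1 : P k) ∣ p - X 0 ^ n * r) :
    (X 1 : P k) ∣ p := by
  obtain ⟨q, hq⟩ := P_decomp_X_one p
  have h0 : aeval ![Polynomial.X, (0 : Polynomial k)] p = 0 := by
    by_contra hne
    obtain ⟨r, s, hs⟩ := h ((aeval ![Polynomial.X, (0 : Polynomial k)] p).natDegree + 1)
    have := congrArg (aeval ![Polynomial.X, (0 : Polynomial k)]) hs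
    simp only [map_sub, map_mul, map_pow, aeval_X, Matrix.cons_val, zero_mul, sub_eq_zero] at this
    have hd := Polynomial.natDegree_le_of_dvd (Dvd.intro _ this.symm) hne
    rw [Polynomial.natDegree_X_pow] at hd
    omega
  rw [h0] at hq
  exact ⟨q, by simpa using hq⟩

end PolyLemmas

/-! ### The graded Nakayama lemma and freeness of MCM modules over P. -/

namespace GrMod

variable {k : Type u} [Field k] {M : GrMod k} {ι : Type*}

/-- The part of degree `D` of the `P`-span of homogeneous elements `b i` of degree `d i`. -/
noncomputable def gspan (b : ι → M.carrier) (d : ι → ℤ) (D : ℤ) : Submodule k M.carrier :=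
  Submodule.span k {w | ∃ i, ∃ m n : ℕ, m + n + d i = D ∧ w = y k 1 ^ m • y k 2 ^ n • b i}

theorem y_one_smul_mem_gspan {b : ι → M.carrier} {d : ι → ℤ} {D : ℤ} {v : M.carrier}
    (hv : v ∈ gspan b d D) : y k 1 • v ∈ gspan b d (D + 1) := by
  induction hv using Submodule.span_induction with
  | mem v hv =>
    obtain ⟨i, m, n, h, rfl⟩ := hv
    exact Submodule.subset_span ⟨i, m + 1, n, by push_cast; omega, by rw [pow_succ', mul_smul]⟩
  | zero => rw [smul_zero]; exact zero_mem _
  | add a b _ _ ha hb => rw [smul_add]; exact add_mem ha hb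
  | smul c v _ hv => rw [smul_comm]; exact Submodule.smul_mem _ _ hv

theorem y_two_smul_mem_gspan {b : ι → M.carrier} {d : ι → ℤ} {D : ℤ} {v : M.carrier}
    (hv : v ∈ gspan b d D) : y k 2 • v ∈ gspan b d (D + 1) := by
  induction hv using Submodule.span_induction with
  | mem v hv =>
    obtain ⟨i, m, n, h, rfl⟩ := hv
    exact Submodule.subset_span ⟨i, m, n + 1, by push_cast; omega,
      by rw [pow_succ', smul_comm, mul_smul]⟩
  | zero => rw [smul_zero]; exact zero_mem _
  | add a b _ _ ha hb => rw [smul_add]; exact add_mem ha hb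
  | smul c v _ hv => rw [smul_comm]; exact Submodule.smul_mem _ _ hv

theorem proj_mem_gspan {b : ι → M.carrier} {d : ι → ℤ} (hb : ∀ i, b i ∈ M.deg (d i))
    {v : M.carrier} (hv : v ∈ Submodule.span (P k) (Set.range b)) (D : ℤ) :
    M.proj D v ∈ gspan b d D := by
  induction hv using Submodule.span_induction generalizing D with
  | mem v hv =>
    obtain ⟨i, rfl⟩ := hv
    rw [proj_of_mem (hb i)]
    split_ifs with h
    · exact Submodule.subset_span ⟨i, 0, 0, by simp [h], by simp⟩
    · exact zero_mem _
  | zero => rw [map_zero]; exact zero_mem _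
  | add a b _ _ ha hb => rw [map_add]; exact add_mem (ha D) (hb D)
  | smul p v _ hv =>
    induction p using MvPolynomial.induction_on generalizing D with
    | C c =>
      rw [C_smul, proj_algebraMap_smul]
      exact Submodule.smul_mem _ c (hv D)
    | add a b ha hb => rw [add_smul, map_add]; exact add_mem (ha D) (hb D)
    | mul_X a i ha =>
      rw [mul_comm, mul_smul]
      fin_cases i
      · change M.proj D ((X 0 : P k) • a • v) ∈ _
        rw [X_zero_smul, proj_y_smul]
        simpa using y_one_smul_mem_gspan (ha (D - 1))
      · change M.proj D ((X 1 : P k) • a • v) ∈ _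
        rw [X_one_smul, proj_y_smul]
        simpa using y_two_smul_mem_gspan (ha (D - 1))

theorem mem_gspan {b : ι → M.carrier} {d : ι → ℤ} (hb : ∀ i, b i ∈ M.deg (d i))
    (hs : Submodule.span (P k) (Set.range b) = ⊤) {v : M.carrier} {D : ℤ} (hv : v ∈ M.deg D) :
    v ∈ gspan b d D := by
  rw [← proj_same hv]
  exact proj_mem_gspan hb (hs ▸ trivial) D

theorem gspan_le_degSub {b : ι → M.carrier} {d : ι → ℤ} (hb : ∀ i, b i ∈ M.deg (d i)) (D : ℤ) :
    gspan b d D ≤ M.degSub D := by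
  refine Submodule.span_le.2 ?_
  rintro _ ⟨i, m, n, h, rfl⟩
  have := y_pow_smul_mem 1 m (y_pow_smul_mem 2 n (hb i))
  rwa [show d i + n + m = D by omega] at this

theorem exists_of_mem_gspan [Fintype ι] [DecidableEq ι] {b : ι → M.carrier} {d : ι → ℤ} {D : ℤ}
    {v : M.carrier} (hv : v ∈ gspan b d D) : ∃ c : ι → k, (∀ i, c i ≠ 0 → d i = D) ∧
      ∃ w ∈ gspan b d (D - 1), ∃ w' ∈ gspan b d (D - 1),
        v = ∑ i, c i • b i + y k 1 • w + y k 2 • w' := by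
  induction hv using Submodule.span_induction with
  | mem v hv =>
    obtain ⟨i, m, n, h, rfl⟩ := hv
    rcases m with _ | m
    · rcases n with _ | n
      · refine ⟨Pi.single i 1, fun j hj => ?_, 0, zero_mem _, 0, zero_mem _, ?_⟩
        · rcases eq_or_ne j i with rfl | hij
          · simpa using h
          · simp [hij] at hj
        · simp [Pi.single_apply, ite_smul]
      · refine ⟨0, by simp, 0, zero_mem _, y k 2 ^ n • b i, Submodule.subset_span
          ⟨i, 0, n, by push_cast at h ⊢; omega, by simp⟩, ?_⟩
        simp [pow_succ', mul_smul]
    · refine ⟨0, by simp, y k 1 ^ m • y k 2 ^ n • b i, Submodule.subset_span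
          ⟨i, m, n, by push_cast at h ⊢; omega, by simp⟩, 0, zero_mem _, ?_⟩
      simp [pow_succ', mul_smul]
  | zero => exact ⟨0, by simp, 0, zero_mem _, 0, zero_mem _, by simp⟩
  | add a b _ _ ha hb =>
    obtain ⟨c, hc, w, hw, w', hw', rfl⟩ := ha
    obtain ⟨e, he, u, hu, u', hu', rfl⟩ := hb
    refine ⟨c + e, fun i hi => ?_, w + u, add_mem hw hu, w' + u', add_mem hw' hu', ?_⟩
    · by_contra hd
      exact hi (by simp [not_imp_comm.1 (hc i) hd, not_imp_comm.1 (he i) hd])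
    · simp only [Pi.add_apply, add_smul, Finset.sum_add_distrib, smul_add]
      abel
  | smul a v _ hv =>
    obtain ⟨c, hc, w, hw, w', hw', rfl⟩ := hv
    refine ⟨a • c, fun i hi => hc i fun h => hi (by simp [h]), a • w, Submodule.smul_mem _ _ hw,
      a • w', Submodule.smul_mem _ _ hw', ?_⟩
    simp only [smul_add, Finset.smul_sum, Pi.smul_apply, smul_assoc, smul_comm a (y k _)]

theorem gspan_le_span_compl {b : ι → M.carrier} {d : ι → ℤ} {D : ℤ} {i : ι} (h : D < d i) :
    gspan b d D ≤ (Submodule.span (P k) (b '' {i}ᶜ)).restrictScalars k := by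
  refine Submodule.span_le.2 ?_
  rintro _ ⟨j, m, n, hj, rfl⟩
  have hij : j ≠ i := by rintro rfl; omega
  have : y k 1 ^ m • y k 2 ^ n • b j = (X 0 ^ m * X 1 ^ n : P k) • b j := by
    rw [← algebraMap_smul (R k) (X 0 ^ m * X 1 ^ n : P k), map_mul, map_pow, map_pow,
      algebraMap_X_zero, algebraMap_X_one, mul_smul]
  rw [this]
  exact Submodule.smul_mem (Submodule.span (P k) (b '' {i}ᶜ)) _
    (Submodule.subset_span ⟨j, hij, rfl⟩)

theorem gspan_eq_bot {b : ι → M.carrier} {d : ι → ℤ} {D : ℤ} (h : ∀ i, D < d i) :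
    gspan b d D = ⊥ := by
  rw [gspan, Submodule.span_eq_bot]
  rintro _ ⟨i, m, n, hi, -⟩
  have := h i
  omega

theorem span_le_of_subset_R (s : Set M.carrier) :
    Submodule.span (P k) s ≤ (Submodule.span (R k) s).restrictScalars (P k) :=
  Submodule.span_le.2 Submodule.subset_span

/-- A homogeneous generator that occurs in an element of `(y₁, y₂, y₃) M` with a nonzero constant
coefficient is redundant over `R`. -/
theorem mem_span_compl_R [Fintype ι] {b : ι → M.carrier} {d : ι → ℤ}
    (hb : ∀ i, b i ∈ M.deg (d i)) (hs : Submodule.span (P k) (Set.range b) = ⊤) {c : ι → k} {i : ι}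
    (hi : c i ≠ 0) {u w w' : M.carrier}
    (h : ∑ j, c j • b j = y k 0 • u + y k 1 • w + y k 2 • w') :
    b i ∈ Submodule.span (R k) (b '' {i}ᶜ) := by
  classical
  have h1 := congrArg (M.proj (d i)) h
  rw [map_add, map_add, proj_y_smul, proj_y_smul, proj_y_smul, map_sum] at h1
  set N := Submodule.span (R k) (b '' {i}ᶜ)
  -- For degree reasons an element of degree d i - 1 does not involve b i. In the part of degree d i
  -- of the relation, b i therefore occurs only with its constant coefficient c i, and can be solved
  -- for.
  have hN : ∀ v : M.carrier, M.proj (d i - 1) v ∈ N := fun v =>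
    span_le_of_subset_R _ (gspan_le_span_compl (show d i - 1 < d i by omega)
      (proj_mem_gspan hb (hs ▸ trivial : v ∈ _) (d i - 1)))
  have h2 : ∑ j, M.proj (d i) (c j • b j) ∈ N := by
    rw [h1]
    exact add_mem (add_mem (N.smul_mem _ (hN _)) (N.smul_mem _ (hN _))) (N.smul_mem _ (hN _))
  rw [← Finset.add_sum_erase _ _ (Finset.mem_univ i), proj_k_smul, proj_same (hb i)] at h2
  have h3 : ∑ j ∈ Finset.univ.erase i, M.proj (d i) (c j • b j) ∈ N := by
    refine sum_mem fun j hj => ?_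
    rw [proj_k_smul, proj_of_mem (hb j)]
    split_ifs
    · exact N.smul_mem (algebraMap k (R k) (c j))
        (Submodule.subset_span ⟨j, Finset.ne_of_mem_erase hj, rfl⟩)
    · rw [smul_zero]; exact zero_mem _
  have h4 := N.smul_mem (algebraMap k (R k) (c i)⁻¹) ((N.add_mem_iff_left h3).1 h2)
  rwa [algebraMap_smul, smul_smul, inv_mul_cancel₀ hi, one_smul] at h4

theorem mem_span_compl_P [Fintype ι] {b : ι → M.carrier} {d : ι → ℤ}
    (hb : ∀ i, b i ∈ M.deg (d i)) (hs : Submodule.span (P k) (Set.range b) = ⊤) {c : ι → k} {i : ι}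
    (hi : c i ≠ 0) {w w' : M.carrier} (h : ∑ j, c j • b j = y k 1 • w + y k 2 • w') :
    b i ∈ Submodule.span (P k) (b '' {i}ᶜ) := by
  classical
  have h1 := congrArg (M.proj (d i)) h
  rw [map_add, proj_y_smul, proj_y_smul, map_sum, ← X_zero_smul, ← X_one_smul] at h1
  set N := Submodule.span (P k) (b '' {i}ᶜ)
  have hN : ∀ v : M.carrier, M.proj (d i - 1) v ∈ N := fun v =>
    gspan_le_span_compl (show d i - 1 < d i by omega)
      (proj_mem_gspan hb (hs ▸ trivial : v ∈ _) (d i - 1))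
  have h2 : ∑ j, M.proj (d i) (c j • b j) ∈ N := by
    rw [h1]
    exact add_mem (N.smul_mem _ (hN _)) (N.smul_mem _ (hN _))
  rw [← Finset.add_sum_erase _ _ (Finset.mem_univ i), proj_k_smul, proj_same (hb i)] at h2
  have h3 : ∑ j ∈ Finset.univ.erase i, M.proj (d i) (c j • b j) ∈ N := by
    refine sum_mem fun j hj => ?_
    rw [proj_k_smul, proj_of_mem (hb j)]
    split_ifs
    · rw [← algebraMap_smul (P k)]
      exact N.smul_mem _ (Submodule.subset_span ⟨j, Finset.ne_of_mem_erase hj, rfl⟩)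
    · rw [smul_zero]; exact zero_mem _
  have h4 := N.smul_mem (algebraMap k (P k) (c i)⁻¹) ((N.add_mem_iff_left h3).1 h2)
  rwa [algebraMap_smul, smul_smul, inv_mul_cancel₀ hi, one_smul] at h4

theorem exists_homogeneous_generators [Module.Finite (R k) M.carrier] :
    ∃ (n : ℕ) (b : Fin n → M.carrier) (d : Fin n → ℤ), (∀ i, b i ∈ M.deg (d i)) ∧
      Submodule.span (P k) (Set.range b) = ⊤ := by
  classical
  have : Module.Finite (P k) M.carrier := Module.Finite.trans (R k) M.carrier
  obtain ⟨s, hs⟩ := this.fg_top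
  choose t _ ht using fun v : M.carrier => proj_sum v
  let T : Finset M.carrier := s.biUnion fun v => (t v).image fun i => M.proj i v
  have hT : ∀ v ∈ T, ∃ i, v ∈ M.deg i := by
    intro v hv
    simp only [T, Finset.mem_biUnion, Finset.mem_image] at hv
    obtain ⟨w, -, i, -, rfl⟩ := hv
    exact ⟨i, M.proj_mem i w⟩
  have hdeg := fun i => hT _ (T.equivFin.symm i).2
  choose d hd using hdeg
  refine ⟨T.card, fun i => T.equivFin.symm i, d, hd, ?_⟩
  rw [eq_top_iff, ← hs, Submodule.span_le]
  intro v hv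
  rw [← ht v]
  refine sum_mem fun i hi => Submodule.subset_span ⟨T.equivFin ⟨M.proj i v, ?_⟩, by simp⟩
  exact Finset.mem_biUnion.2 ⟨v, hv, Finset.mem_image_of_mem _ hi⟩

theorem exists_bound [Module.Finite (R k) M.carrier] :
    ∃ D₀ : ℤ, ∀ D < D₀, ∀ v ∈ M.deg D, v = 0 := by
  obtain ⟨n, b, d, hb, hs⟩ := exists_homogeneous_generators (M := M)
  obtain ⟨D₀, hD⟩ := (Set.finite_range d).bddBelow
  refine ⟨D₀, fun D h v hv => ?_⟩
  have := mem_gspan hb hs hv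
  rwa [gspan_eq_bot fun i => h.trans_le (hD ⟨i, rfl⟩), Submodule.mem_bot] at this

/-- Minimal homogeneous generators over `P`. -/
theorem exists_minimal_generators [Module.Finite (R k) M.carrier] :
    ∃ (n : ℕ) (b : Fin n → M.carrier) (d : Fin n → ℤ), (∀ i, b i ∈ M.deg (d i)) ∧
      Submodule.span (P k) (Set.range b) = ⊤ ∧
      ∀ (c : Fin n → k) (w w' : M.carrier), ∑ j, c j • b j = y k 1 • w + y k 2 • w' → c = 0 := by
  classical
  have hex := exists_homogeneous_generators (M := M)
  obtain ⟨b, d, hb, hs⟩ := Nat.find_spec hex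
  refine ⟨_, b, d, hb, hs, fun c w w' h => ?_⟩
  by_contra hc
  obtain ⟨i, hi⟩ := Function.ne_iff.1 hc
  have hmem := mem_span_compl_P hb hs hi h
  generalize hn : Nat.find hex = n at b d c i hi
  rcases n with _ | n
  · exact i.elim0
  -- The number of generators is the least possible, but the redundant generator b i can be dropped.
  · refine Nat.find_min hex (m := n) (by omega) ⟨b ∘ i.succAbove, d ∘ i.succAbove, fun j => hb _, ?_⟩
    rw [Set.range_comp, Fin.range_succAbove, eq_top_iff, ← hs, Submodule.span_le]
    rintro _ ⟨j, rfl⟩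
    by_cases hj : j = i
    · rw [hj]; exact hmem
    · exact Submodule.subset_span ⟨j, hj, rfl⟩

/-- By minimality the coefficients of a relation modulo y₃ have no constant term. As y₂ is regular
modulo y₃, a factor y₂ can be cancelled, and the argument repeats: modulo y₃ the coefficients are
divisible by all powers of y₂, hence vanish. For a genuine relation a factor y₃ can then be
cancelled, so its coefficients are divisible by all powers of y₃. -/
theorem linearIndependent_of_regular {n : ℕ} {b : Fin n → M.carrier}
    (hreg : IsRegularPair M.carrier (y k 2) (y k 1))
    (hmin : ∀ (c : Fin n → k) (w w' : M.carrier),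
      ∑ j, c j • b j = y k 1 • w + y k 2 • w' → c = 0) : LinearIndependent (P k) b := by
  have h1 : ∀ (p : Fin n → P k) (w : M.carrier), ∑ j, p j • b j = y k 2 • w →
      ∀ j, constantCoeff (p j) = 0 := by
    intro p w h
    choose q r hqr using fun j => P_decomp (p j)
    refine fun j => congrFun (hmin (fun j => constantCoeff (p j)) (-∑ j, q j • b j)
      (w - ∑ j, r j • b j) ?_) j
    have : ∑ j, p j • b j = ∑ j, constantCoeff (p j) • b j + y k 1 • ∑ j, q j • b j
        + y k 2 • ∑ j, r j • b j := by
      simp only [Finset.smul_sum, ← Finset.sum_add_distrib]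
      refine Finset.sum_congr rfl fun j _ => ?_
      conv_lhs => rw [hqr j]
      rw [add_smul, add_smul, mul_smul, mul_smul, X_zero_smul, X_one_smul, C_smul, algebraMap_smul]
    rw [this] at h
    rw [smul_neg, smul_sub, ← h]
    abel
  have h2 : ∀ (N : ℕ) (p : Fin n → P k) (w : M.carrier), ∑ j, p j • b j = y k 2 • w →
      ∃ r : Fin n → P k, ∀ j, (X 1 : P k) ∣ p j - X 0 ^ N * r j := by
    intro N
    induction N with
    | zero => exact fun p w _ => ⟨p, by simp⟩
    | succ N ih =>
      intro p w h
      choose q r hqr using fun j => P_decomp (p j)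
      have hr : ∑ j, q j • b j ∈ {v : M.carrier | ∃ u, v = y k 2 • u} := by
        refine hreg.2 _ (w - ∑ j, r j • b j) ?_
        rw [smul_sub, ← h, Finset.smul_sum, Finset.smul_sum, ← Finset.sum_sub_distrib]
        refine Finset.sum_congr rfl fun j _ => ?_
        conv_rhs => rw [hqr j]
        rw [h1 p w h, C_0, zero_add, add_smul, mul_smul, mul_smul, X_zero_smul, X_one_smul,
          add_sub_cancel_right]
      obtain ⟨u, hu⟩ := hr
      obtain ⟨s, hs⟩ := ih q u hu
      refine ⟨s, fun j => ?_⟩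
      have : p j - X 0 ^ (N + 1) * s j = X 0 * (q j - X 0 ^ N * s j) + X 1 * r j := by
        conv_lhs => rw [hqr j]
        rw [h1 p w h, C_0]
        ring
      rw [this]
      exact dvd_add (Dvd.dvd.mul_left (hs j) _) (dvd_mul_right _ _)
  have h3 : ∀ (N : ℕ) (p : Fin n → P k), ∑ j, p j • b j = 0 → ∀ j, (X 1 : P k) ^ N ∣ p j := by
    intro N
    induction N with
    | zero => simp
    | succ N ih =>
      intro p h j
      have hdvd : ∀ j, (X 1 : P k) ∣ p j := fun j => X_one_dvd_of_forall_pow fun N => by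
        obtain ⟨r, hr⟩ := h2 N p 0 (by rw [h, smul_zero])
        exact ⟨r j, hr j⟩
      choose q hq using hdvd
      have : ∑ j, q j • b j = 0 := by
        apply hreg.1
        rw [← h, Finset.smul_sum]
        refine Finset.sum_congr rfl fun j _ => ?_
        rw [hq j, mul_smul, X_one_smul]
      rw [hq j, pow_succ']
      exact mul_dvd_mul_left _ (ih q this j)
  rw [Fintype.linearIndependent_iff]
  intro p hp j
  by_contra hne
  exact FiniteMultiplicity.not_iff_forall.2 (fun N => h3 N p hp j)
    (FiniteMultiplicity.of_not_isUnit (X_prime (R := k) (i := (1 : Fin 2))).not_isUnit hne)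

theorem irrelevant_le_radical :
    irrelevant k ≤ (Ideal.span {y k 1, y k 2}).radical := by
  refine Ideal.span_le.2 ?_
  rintro _ ⟨i, rfl⟩
  fin_cases i
  · refine ⟨3, Ideal.mem_span_pair.2 ⟨0, y k 1 ^ 2 - y k 0 ^ 2, ?_⟩⟩
    change _ = y k 0 ^ 3
    linear_combination -relation k
  · exact Ideal.le_radical (Ideal.subset_span (by simp))
  · exact Ideal.le_radical (Ideal.subset_span (by simp))

/-- The regular sequence r, s given by the depth is arbitrary, but powers of r and s lie in (y₂,
y₃), so `IsRegularPair.exists_common` gives Koszul exactness for y₂, y₃. If y₃v = 0, this yields v =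
y₂c with y₃c = 0. For homogeneous v the element c can be taken of smaller degree, and the degrees
are bounded below, so v = 0. -/
theorem isRegularPair_of_isMCM (hM : M.IsMCM) : IsRegularPair M.carrier (y k 2) (y k 1) := by
  obtain ⟨hfin, rs, hirr, hlen, hreg⟩ := hM
  rw [ringKrullDim_R] at hlen
  obtain ⟨r, s, rfl⟩ := List.length_eq_two.1 (by exact_mod_cast hlen : rs.length = 2)
  have hpair := isRegularPair_of_isWeaklyRegular hreg.1
  obtain ⟨m, hm⟩ := irrelevant_le_radical (hirr r (by simp))
  obtain ⟨n, hn⟩ := irrelevant_le_radical (hirr s (by simp))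
  have key : ∀ {a b : M.carrier}, y k 2 • a = y k 1 • b → ∃ c, y k 1 • c = a ∧ y k 2 • c = b :=
    fun h => ((hpair.pow_left m).pow_right n).exists_common hm hn h
  refine ⟨fun v hv => ?_, fun v w hv => ?_⟩
  · obtain ⟨D₀, hD⟩ := exists_bound (M := M)
    have hz : ∀ (n : ℕ) (D : ℤ) (v : M.carrier), D < D₀ + n → v ∈ M.deg D → y k 2 • v = 0 →
        v = 0 := by
      intro n
      induction n with
      | zero => exact fun D v h hv _ => hD D (by simpa using h) v hv
      | succ n ih =>
        intro D v h hv hz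
        obtain ⟨c, hc, hc'⟩ := key (a := v) (b := 0) (by rw [hz, smul_zero])
        have hp := congrArg (M.proj D) hc
        rw [proj_y_smul, proj_same hv] at hp
        have hp' := congrArg (M.proj D) hc'
        rw [proj_y_smul, map_zero] at hp'
        rw [← hp, ih (D - 1) _ (by push_cast at h; omega) (M.proj_mem _ _) hp', smul_zero]
    refine ext_proj fun i => ?_
    rw [map_zero]
    refine hz (i - D₀ + 1).toNat i _ (by omega) (M.proj_mem _ _) ?_
    have := congrArg (M.proj (i + 1)) hv
    rwa [proj_y_smul, map_zero, add_sub_cancel_right] at this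
  · obtain ⟨c, -, hc⟩ := key hv.symm
    exact ⟨c, hc.symm⟩

end GrMod

end NodalCone

/-! ### Local freeness away from the node and at the node. -/

namespace NodalCone

open MvPolynomial TensorProduct

/-- Multiplication by s factors through a free module and becomes invertible at p, so the
localization is a direct summand of a free module. Finite projective modules over a local ring are
free. -/
theorem free_localizedModule_of_retract {A M F : Type*} [CommRing A] [AddCommGroup M] [Module A M]
    [Module.Finite A M] [AddCommGroup F] [Module A F] [Module.Free A F] (p : Ideal A) [p.IsPrime]
    {s : A} (hs : s ∉ p) (σ : M →ₗ[A] F) (π : F →ₗ[A] M) (h : ∀ v, π (σ v) = s • v) :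
    Module.Free (Localization.AtPrime p) (LocalizedModule p.primeCompl M) := by
  have hF : Module.Free (Localization.AtPrime p) (LocalizedModule p.primeCompl F) :=
    Module.free_of_isLocalizedModule p.primeCompl (LocalizedModule.mkLinearMap p.primeCompl F)
  have hfin : Module.Finite (Localization.AtPrime p) (LocalizedModule p.primeCompl M) :=
    Module.Finite.of_isLocalizedModule p.primeCompl (LocalizedModule.mkLinearMap p.primeCompl M)
  have hu : IsUnit (algebraMap A (Localization.AtPrime p) s) :=
    IsLocalization.map_units _ (⟨s, hs⟩ : p.primeCompl)
  obtain ⟨t, ht⟩ := hu.exists_left_inv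
  have hproj : Module.Projective (Localization.AtPrime p) (LocalizedModule p.primeCompl M) := by
    refine Module.Projective.of_split (LocalizedModule.map p.primeCompl σ)
      (t • LocalizedModule.map p.primeCompl π) ?_
    ext v
    induction v using LocalizedModule.induction_on with
    | h v r =>
      simp only [LinearMap.comp_apply, LinearMap.smul_apply, LocalizedModule.map_mk, h,
        LinearMap.id_apply]
      rw [← LocalizedModule.smul'_mk, ← algebraMap_smul (Localization.AtPrime p) s, smul_smul, ht,
        one_smul]
  exact Module.free_of_flat_of_isLocalRing

section Derivation

variable {k : Type u} [Field k] {Q : Type*} [AddCommGroup Q] [Module (R k) Q] [Module (P k) Q]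
  [IsScalarTower (P k) (R k) Q] {ι : Type*} [Fintype ι]

/-- The connection along `P` that is flat with respect to a basis. -/
noncomputable def connection (b : Module.Basis ι (P k) Q) (D : Derivation k (P k) (P k)) (v : Q) :
    Q := ∑ i, D (b.repr v i) • b i

omit [Module (R k) Q] [IsScalarTower (P k) (R k) Q] in
theorem connection_add (b : Module.Basis ι (P k) Q) (D : Derivation k (P k) (P k)) (v w : Q) :
    connection b D (v + w) = connection b D v + connection b D w := by
  simp [connection, add_smul, Finset.sum_add_distrib]

omit [Module (R k) Q] [IsScalarTower (P k) (R k) Q] in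
theorem connection_smul (b : Module.Basis ι (P k) Q) (D : Derivation k (P k) (P k)) (p : P k)
    (v : Q) : connection b D (p • v) = p • connection b D v + D p • v := by
  conv_rhs => rw [← b.sum_repr v]
  simp only [connection, map_smul, Finsupp.smul_apply, smul_eq_mul, Derivation.leibniz, add_smul,
    Finset.sum_add_distrib, mul_smul, Finset.smul_sum, b.sum_repr]
  congr 1
  conv_rhs => rw [← b.sum_repr v, Finset.smul_sum]
  exact Finset.sum_congr rfl fun i _ => smul_comm (b.repr v i) (D p) (b i)

/-- The commutator of a connection with the multiplication by `y₁`. -/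
noncomputable def commutator (b : Module.Basis ι (P k) Q) (D : Derivation k (P k) (P k)) :
    Q →ₗ[P k] Q where
  toFun v := connection b D (y k 0 • v) - y k 0 • connection b D v
  map_add' v w := by
    rw [smul_add, connection_add, connection_add, smul_add]
    abel
  map_smul' p v := by
    rw [smul_comm, connection_smul, connection_smul, smul_add, RingHom.id_apply, smul_sub,
      smul_comm (y k 0) p, smul_comm (y k 0) (D p)]
    abel

/-- The Leibniz rule for the connection ∇, applied to both sides of y₁³v + y₃y₁²v = y₂²y₃v. The left
side of the identity is ([∇, y₁³] + y₃[∇, y₁²])v, expanded in terms of [∇, y₁]. -/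
theorem commutator_identity (b : Module.Basis ι (P k) Q) (D : Derivation k (P k) (P k)) (v : Q) :
    y k 0 • y k 0 • commutator b D v + y k 0 • commutator b D (y k 0 • v)
      + commutator b D (y k 0 • y k 0 • v)
      + y k 2 • (y k 0 • commutator b D v + commutator b D (y k 0 • v))
      = D (X 0 ^ 2 * X 1) • v - D (X 1) • y k 0 • y k 0 • v := by
  have h : y k 0 • y k 0 • y k 0 • v + (X 1 : P k) • y k 0 • y k 0 • v
      = (X 0 ^ 2 * X 1 : P k) • v := by
    rw [X_one_smul, relation_smul, ← algebraMap_smul (R k) (X 0 ^ 2 * X 1 : P k)]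
    simp [pow_two]
  have h1 := congrArg (connection b D) h
  rw [connection_add, connection_smul, connection_smul, X_one_smul,
    ← algebraMap_smul (R k) (X 0 ^ 2 * X 1 : P k)] at h1
  simp only [map_mul, map_pow, algebraMap_X_one, algebraMap_X_zero] at h1
  have h2 := relation_smul (k := k) (connection b D v)
  simp only [commutator, LinearMap.coe_mk, AddHom.coe_mk]
  have h3 : ∀ (r : R k) (a b : Q), r • (a - b) = r • a - r • b := fun r a b => smul_sub r a b
  generalize connection b D (y k 0 • v) = a1 at *
  generalize connection b D (y k 0 • y k 0 • v) = a2 at *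
  generalize connection b D (y k 0 • y k 0 • y k 0 • v) = a3 at *
  generalize connection b D v = a0 at *
  generalize D (X 0 ^ 2 * X 1) = d1 at *
  have h4 : D (X 1) • y k 0 • y k 0 • v
    = (y k 1 ^ 2 * y k 2) • a0 + d1 • v - a3 - y k 2 • a2 := by rw [← h1]; abel
  rw [h4]
  linear_combination (norm := module) (-1 : R k) • h2

noncomputable instance : DistribMulAction (P k) (R k) := Module.toDistribMulAction

omit [Module (R k) Q] [IsScalarTower (P k) (R k) Q] in
theorem algebraMap_mul_tmul (p : P k) (r : R k) (v : Q) :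
    (algebraMap (P k) (R k) p * r) ⊗ₜ[P k] v = r ⊗ₜ[P k] (p • v) := by
  rw [← Algebra.smul_def]
  exact TensorProduct.smul_tmul p r v

/-- The `R`-linear map `M → R ⊗ M` given by the difference quotient of the equation of `R`. -/
noncomputable def toBaseChange : Q →ₗ[R k] R k ⊗[P k] Q :=
  linearOfP (k := k)
    (TensorProduct.mk (P k) (R k) Q (y k 0 ^ 2 + y k 2 * y k 0) +
      TensorProduct.mk (P k) (R k) Q (y k 0 + y k 2) ∘ₗ
        ((LinearMap.lsmul (R k) Q (y k 0)).restrictScalars (P k)) +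
      TensorProduct.mk (P k) (R k) Q 1 ∘ₗ
        ((LinearMap.lsmul (R k) Q (y k 0 * y k 0)).restrictScalars (P k)))
    (by
      intro v
      simp only [LinearMap.add_apply, LinearMap.comp_apply, TensorProduct.mk_apply,
        LinearMap.restrictScalars_apply, LinearMap.lsmul_apply, smul_add, smul_tmul', smul_eq_mul]
      have h1 : (1 : R k) ⊗ₜ[P k] ((y k 0 * y k 0) • y k 0 • v)
          = (y k 1 ^ 2 * y k 2) ⊗ₜ v - y k 2 ⊗ₜ[P k] (y k 0 • y k 0 • v) := by
        have e1 : (y k 1 ^ 2 * y k 2) ⊗ₜ[P k] v = (1 : R k) ⊗ₜ[P k] ((X 0 ^ 2 * X 1 : P k) • v) := by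
          rw [← algebraMap_mul_tmul]; simp
        have e2 : y k 2 ⊗ₜ[P k] (y k 0 • y k 0 • v)
            = (1 : R k) ⊗ₜ[P k] ((X 1 : P k) • y k 0 • y k 0 • v) := by
          rw [← algebraMap_mul_tmul]; simp
        rw [e1, e2, ← tmul_sub]
        congr 1
        rw [X_one_smul, eq_sub_iff_add_eq, mul_smul, relation_smul,
          ← algebraMap_smul (R k) (X 0 ^ 2 * X 1 : P k)]
        simp [pow_two]
      have h2 : (y k 1 ^ 2 * y k 2) ⊗ₜ[P k] v
          = (y k 0 * (y k 0 ^ 2 + y k 2 * y k 0)) ⊗ₜ[P k] v := by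
        congr 1
        linear_combination -relation k
      rw [h1, h2]
      have h3 : (y k 0 * (y k 0 + y k 2)) ⊗ₜ[P k] (y k 0 • v)
          = (y k 0 ^ 2 + y k 2 * y k 0) ⊗ₜ[P k] (y k 0 • v) := by
        congr 1; ring
      rw [h3, smul_smul, mul_one, add_tmul (y k 0) (y k 2)]
      abel)

theorem toBaseChange_apply (v : Q) : toBaseChange (k := k) v =
    (y k 0 ^ 2 + y k 2 * y k 0) ⊗ₜ[P k] v + (y k 0 + y k 2) ⊗ₜ[P k] (y k 0 • v)
      + 1 ⊗ₜ[P k] ((y k 0 * y k 0) • v) := rfl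

/-- `toBaseChange` followed by r ⊗ v ↦ r [∇, y₁]v is the left side of `commutator_identity`. So
multiplication by the derivative of the equation along D, up to sign, factors through the free
module R ⊗ Q. -/
theorem free_of_derivation [Module.Finite (R k) Q] (b : Module.Basis ι (P k) Q)
    (D : Derivation k (P k) (P k)) (p : Ideal (R k)) [p.IsPrime]
    (h : algebraMap (P k) (R k) (D (X 0 ^ 2 * X 1))
      - algebraMap (P k) (R k) (D (X 1)) * y k 0 ^ 2 ∉ p) :
    Module.Free (Localization.AtPrime p) (LocalizedModule p.primeCompl Q) := by
  have : Module.Free (P k) Q := Module.Free.of_basis b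
  refine free_localizedModule_of_retract p h (toBaseChange (k := k) (Q := Q))
    (LinearMap.liftBaseChange (R k) (commutator b D)) fun v => ?_
  rw [toBaseChange_apply, map_add, map_add, LinearMap.liftBaseChange_tmul,
    LinearMap.liftBaseChange_tmul, LinearMap.liftBaseChange_tmul, sub_smul, mul_smul _ (y k 0 ^ 2),
    algebraMap_smul, algebraMap_smul, pow_two (y k 0), mul_smul (y k 0) (y k 0) v,
    ← commutator_identity b D]
  module

/-- A module that is free over `P` is locally free away from the node. -/
theorem free_away_from_node [Module.Finite (R k) Q] (hk : (2 : k) ≠ 0)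
    (b : Module.Basis ι (P k) Q) (p : Ideal (R k)) [p.IsPrime]
    (h : ¬ (y k 0 ∈ p ∧ y k 1 ∈ p)) :
    Module.Free (Localization.AtPrime p) (LocalizedModule p.primeCompl Q) := by
  by_contra hfree
  -- The derivations ∂/∂y₃ and ∂/∂y₂ put y₂² - y₁² and 2y₂y₃ into p. Since 2 is invertible, these
  -- and the equation of R force y₁, y₂ ∈ p.
  have h1 := not_imp_comm.1 (free_of_derivation b (pderiv 1) p) hfree
  have h2 := not_imp_comm.1 (free_of_derivation b (pderiv 0) p) hfree
  have e1 : pderiv (R := k) (1 : Fin 2) (X 0) = 0 := pderiv_X_of_ne (by decide)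
  have e2 : pderiv (R := k) (0 : Fin 2) (X 1) = 0 := pderiv_X_of_ne (by decide)
  have e3 : pderiv (R := k) (0 : Fin 2) (X 0) = 1 := pderiv_X_self _
  have e4 : pderiv (R := k) (1 : Fin 2) (X 1) = 1 := pderiv_X_self _
  simp only [Derivation.leibniz, Derivation.leibniz_pow, e1, e2, e3, e4] at h1 h2
  simp at h1 h2
  have h3 : y k 1 * y k 2 ∈ p := by
    have := p.mul_mem_left (algebraMap k (R k) (2 : k)⁻¹) h2
    have e : algebraMap k (R k) (2 : k)⁻¹ * 2 = 1 := by
      rw [← map_ofNat (algebraMap k (R k)) 2, ← map_mul, inv_mul_cancel₀ hk, map_one]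
    rw [map_ofNat] at this
    convert this using 1
    linear_combination (-y k 1 * y k 2) * e
  have hrel := relation k
  have key : y k 0 ∈ p ∧ y k 1 ∈ p := by
    rcases ‹p.IsPrime›.mem_or_mem h3 with hy | hz
    · refine ⟨‹p.IsPrime›.mem_of_pow_mem 2 ?_, hy⟩
      have := p.sub_mem (p.mul_mem_left (y k 1) hy) h1
      convert this using 1
      ring
    · have hx : y k 0 ∈ p := by
        refine ‹p.IsPrime›.mem_of_pow_mem 3 ?_
        have := p.mul_mem_left (y k 1 ^ 2 - y k 0 ^ 2) hz
        convert this using 1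
        linear_combination hrel
      refine ⟨hx, ‹p.IsPrime›.mem_of_pow_mem 2 ?_⟩
      have := p.add_mem (p.mul_mem_left (y k 0) hx) h1
      convert this using 1
      ring
  exact h key

omit [Module (P k) Q] [IsScalarTower (P k) (R k) Q] in
-- Let V be the span of v. The Cayley–Hamilton theorem for y₃^N on Q/V gives a monic polynomial in
-- y₃^N with lower coefficients in (y₁, y₂) that annihilates Q/V; its value s is not in p. So sQ ⊆
-- V, the submodule V has rank two and two generators, hence is free, and multiplication by s on Q
-- factors through it.
theorem free_at_node [Module.Finite (R k) Q] [Module.IsTorsionFree (R k) Q]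
    (hrank : Module.finrank (R k) Q = 2) (v : Fin 2 → Q) (N : ℕ)
    (hv : ∀ w : Q, y k 2 ^ N • w ∈ Submodule.span (R k) (Set.range v) ⊔
      Ideal.span {y k 0, y k 1} • (⊤ : Submodule (R k) Q))
    (p : Ideal (R k)) [p.IsPrime] (h0 : y k 0 ∈ p) (h1 : y k 1 ∈ p) (h2 : y k 2 ∉ p) :
    Module.Free (Localization.AtPrime p) (LocalizedModule p.primeCompl Q) := by
  set V := Submodule.span (R k) (Set.range v) with hV
  set I : Ideal (R k) := Ideal.span {y k 0, y k 1}
  have hIp : I ≤ p := Ideal.span_le.2 (by rintro _ (rfl | rfl) <;> assumption)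
  set n := y k 2 ^ N
  obtain ⟨q, hq, -, hcoeff, haeval⟩ :=
    LinearMap.exists_monic_and_natDegree_eq_and_coeff_mem_pow_and_aeval_eq_zero
      (R k) (algebraMap (R k) (Module.End (R k) (Q ⧸ V)) n) I (by
      rintro _ ⟨w, rfl⟩
      obtain ⟨w, rfl⟩ := Submodule.Quotient.mk_surjective _ w
      obtain ⟨a, ha, b, hb, hab⟩ := Submodule.mem_sup.1 (hv w)
      rw [Module.algebraMap_end_apply, ← Submodule.Quotient.mk_smul, ← hab,
        Submodule.Quotient.mk_add, (Submodule.Quotient.mk_eq_zero V).2 ha, zero_add]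
      have := Submodule.mem_map_of_mem (f := V.mkQ) hb
      rw [Submodule.map_smul''] at this
      exact Submodule.smul_mono le_rfl le_top this)
  rw [Polynomial.aeval_algebraMap_apply] at haeval
  set s := Polynomial.aeval n q
  have hs : s ∉ p := by
    intro hs
    simp only [s, Polynomial.aeval_eq_sum_range, Finset.sum_range_succ, hq.coeff_natDegree,
      one_smul] at hs
    have h3 : ∑ i ∈ Finset.range q.natDegree, q.coeff i • n ^ i ∈ p := by
      refine sum_mem fun i hi => p.mul_mem_right _ (hIp ?_)
      rw [Finset.mem_range] at hi
      exact Ideal.pow_le_self (by omega) (hcoeff i)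
    exact h2 (‹p.IsPrime›.mem_of_pow_mem _ (‹p.IsPrime›.mem_of_pow_mem _ ((p.add_mem_iff_right h3).1 hs)))
  have hs0 : s ≠ 0 := fun h => hs (h ▸ p.zero_mem)
  have hsV : ∀ w : Q, s • w ∈ V := fun w => by
    have := LinearMap.congr_fun haeval (Submodule.Quotient.mk w)
    rwa [Module.algebraMap_end_apply, ← Submodule.Quotient.mk_smul, LinearMap.zero_apply,
      Submodule.Quotient.mk_eq_zero] at this
  let φ : (Fin 2 → R k) →ₗ[R k] Q := Fintype.linearCombination (R k) v
  have hφV : LinearMap.range φ = V := Fintype.range_linearCombination (R k) v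
  have hrange : 2 ≤ Module.finrank (R k) (LinearMap.range φ) := by
    rw [hφV, ← hrank]
    exact LinearMap.finrank_le_finrank_of_injective
      (f := (LinearMap.lsmul (R k) Q s).codRestrict V hsV)
      fun a b hab => smul_right_injective Q hs0 (congrArg Subtype.val hab)
  have hker : Module.finrank (R k) (LinearMap.ker φ) = 0 := by
    have := Submodule.finrank_quotient_add_finrank (LinearMap.ker φ)
    rw [φ.quotKerEquivRange.finrank_eq, Module.finrank_fin_fun] at this
    omega
  have hinj : Function.Injective φ := by
    rw [← LinearMap.ker_eq_bot]
    exact Submodule.finrank_eq_zero.1 hker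
  let e := LinearEquiv.ofInjective φ hinj
  refine free_localizedModule_of_retract p hs (e.symm.toLinearMap ∘ₗ
    (LinearMap.lsmul (R k) Q s).codRestrict (LinearMap.range φ) (fun w => hφV ▸ hsV w)) φ fun w => ?_
  exact congrArg Subtype.val (e.apply_symm_apply _)

end Derivation

end NodalCone

namespace NodalCone

open MvPolynomial

/-! ### Maps from and to the module L over the normalization; modules with a basis over P. -/

section Algebra

variable {k : Type u} [Field k]

theorem P_X_ne_zero (i : Fin 2) : (X i : P k) ≠ 0 := X_ne_zero i

theorem X_one_not_dvd_X_zero : ¬ (X 1 : P k) ∣ X 0 := by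
  rw [X_dvd_X]; simp

theorem X_one_dvd_of_dvd_mul {p : P k} (h : (X 1 : P k) ∣ X 0 * p) : (X 1 : P k) ∣ p :=
  (X_prime.dvd_or_dvd h).resolve_left X_one_not_dvd_X_zero

theorem exists_linearMap_div {A Q : Type*} [CommRing A] [IsDomain A] [AddCommGroup Q] [Module A Q]
    {a : A} (ha : a ≠ 0) (φ : Q →ₗ[A] A) (h : ∀ v, a ∣ φ v) :
    ∃ ψ : Q →ₗ[A] A, ∀ v, φ v = a * ψ v := by
  choose ψ hψ using h
  refine ⟨⟨⟨ψ, fun v w => mul_left_cancel₀ ha ?_⟩, fun r v => mul_left_cancel₀ ha ?_⟩, hψ⟩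
  · rw [← hψ, mul_add, ← hψ, ← hψ, map_add]
  · rw [← hψ, map_smul, hψ, RingHom.id_apply, smul_eq_mul, smul_eq_mul, mul_left_comm]

theorem isWeaklyRegular_of_isRegularPair {A Q : Type*} [CommRing A] [AddCommGroup Q] [Module A Q]
    {r s : A} (h : IsRegularPair Q r s) : RingTheory.Sequence.IsWeaklyRegular Q [r, s] := by
  rw [RingTheory.Sequence.isWeaklyRegular_cons_iff, RingTheory.Sequence.isWeaklyRegular_cons_iff]
  refine ⟨?_, ?_, RingTheory.Sequence.IsWeaklyRegular.nil _ _⟩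
  · intro v w hvw
    rw [← sub_eq_zero]
    apply h.1
    rw [smul_sub, sub_eq_zero]
    exact hvw
  · intro v w hvw
    rw [← sub_eq_zero]
    obtain ⟨t, ht⟩ := Submodule.Quotient.mk_surjective _ (v - w)
    have h0 : s • (v - w) = 0 := by rw [smul_sub, sub_eq_zero]; exact hvw
    rw [← ht, ← Submodule.Quotient.mk_smul, Submodule.Quotient.mk_eq_zero] at h0
    obtain ⟨u, -, hu⟩ := h0
    obtain ⟨u', rfl⟩ := h.2 t u hu.symm
    rw [← ht, Submodule.Quotient.mk_eq_zero]
    exact Submodule.smul_mem_pointwise_smul _ _ _ trivial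

end Algebra

section Free

variable {k : Type u} [Field k] {Q : Type*} [AddCommGroup Q] [Module (R k) Q] [Module (P k) Q]
  [IsScalarTower (P k) (R k) Q] {ι : Type*} [Fintype ι]

variable (k) in
/-- `e, g, h` satisfy the relations of the generators of the module over the normalization of `R`
that has no cohomology after a twist. -/
structure IsTriple (e g h : Q) : Prop where
  rel_e : y k 0 • e = y k 2 • h
  rel_g : y k 0 • g = y k 1 • e
  rel_h : y k 0 • h = y k 1 • g - y k 2 • h

/-- The remaining components of the homomorphism to the module over the normalization that is
determined by a functional. -/
theorem exists_companions (γ : Q →ₗ[P k] P k) (h1 : ∀ v, (X 0 : P k) ∣ γ (y k 0 • v))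
    (h2 : ∀ v, (X 1 : P k) ∣ γ (y k 0 • y k 0 • v)) : ∃ η θ : Q →ₗ[P k] P k,
      (∀ v, γ (y k 0 • v) = X 0 * η v) ∧ (∀ v, η (y k 0 • v) = X 1 * θ v) ∧
      ∀ v, θ (y k 0 • v) + X 1 * θ v = X 0 * γ v := by
  let x : Q →ₗ[P k] Q := (LinearMap.lsmul (R k) Q (y k 0)).restrictScalars _
  -- The formulas are forced by R-linearity of v ↦ (θ v + η v)e + (γ v)g + (η v)h. The last relation
  -- is the equation of R after cancelling y₂y₃.
  obtain ⟨η, hη⟩ := exists_linearMap_div (P_X_ne_zero 0) (γ ∘ₗ x) h1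
  replace hη : ∀ v, γ (y k 0 • v) = X 0 * η v := hη
  obtain ⟨θ, hθ⟩ := exists_linearMap_div (P_X_ne_zero 1) (η ∘ₗ x) fun v =>
    X_one_dvd_of_dvd_mul ((h2 v).trans (dvd_of_eq (hη _)))
  replace hθ : ∀ v, η (y k 0 • v) = X 1 * θ v := hθ
  refine ⟨η, θ, hη, hθ, fun v => ?_⟩
  have hrel := congrArg γ (relation_smul (k := k) v)
  have e1 : (y k 1 * y k 1 * y k 2) • v = (X 0 * X 0 * X 1 : P k) • v := by
    rw [mul_smul, mul_smul, mul_smul, mul_smul, X_zero_smul, X_zero_smul, X_one_smul]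
  rw [e1, ← X_one_smul, map_add, map_smul γ (X 1), map_smul γ (X 0 * X 0 * X 1),
    hη (y k 0 • y k 0 • v), hη (y k 0 • v), hθ (y k 0 • v), hθ v, smul_eq_mul,
    smul_eq_mul] at hrel
  refine mul_left_cancel₀ (mul_ne_zero (P_X_ne_zero 0) (P_X_ne_zero 1)) ?_
  linear_combination hrel

omit [Fintype ι] [Module (R k) Q] [IsScalarTower (P k) (R k) Q] in
theorem smul_P_right_injective (b : Module.Basis ι (P k) Q) {p : P k} (hp : p ≠ 0) {v w : Q}
    (h : p • v = p • w) : v = w := by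
  refine b.repr.injective (Finsupp.ext fun i => mul_left_cancel₀ hp ?_)
  simpa using DFunLike.congr_fun (congrArg b.repr h) i

omit [Fintype ι] in
theorem y_one_smul_cancel (b : Module.Basis ι (P k) Q) {v w : Q}
    (h : y k 1 • v = y k 1 • w) : v = w :=
  smul_P_right_injective b (P_X_ne_zero 0) (by rwa [X_zero_smul, X_zero_smul])

omit [Fintype ι] in
theorem y_two_smul_cancel (b : Module.Basis ι (P k) Q) {v w : Q}
    (h : y k 2 • v = y k 2 • w) : v = w :=
  smul_P_right_injective b (P_X_ne_zero 1) (by rwa [X_one_smul, X_one_smul])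

theorem isRegularPair_of_basis (b : Module.Basis ι (P k) Q) :
    IsRegularPair Q (y k 2) (y k 1) := by
  refine ⟨fun v hv => y_two_smul_cancel b (by rw [hv, smul_zero]), fun v w hvw => ?_⟩
  have h : ∀ i, (X 1 : P k) ∣ b.repr v i := fun i => by
    refine X_one_dvd_of_dvd_mul ⟨b.repr w i, ?_⟩
    have := DFunLike.congr_fun (congrArg b.repr (show (X 0 : P k) • v = (X 1 : P k) • w by
      rwa [X_zero_smul, X_one_smul])) i
    simpa using this
  choose q hq using h
  refine ⟨∑ i, q i • b i, ?_⟩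
  rw [Finset.smul_sum]
  conv_lhs => rw [← b.sum_repr v]
  refine Finset.sum_congr rfl fun i _ => ?_
  rw [hq, mul_smul, X_one_smul]

omit [Fintype ι] in
theorem isTorsionFree_of_basis (b : Module.Basis ι (P k) Q) : Module.IsTorsionFree (R k) Q := by
  refine Module.isTorsionFree_iff_smul_eq_zero.2 fun r v h => ?_
  by_contra! hne
  obtain ⟨p, hp, s, hs⟩ := exists_P_smul_mem hne.1
  refine hne.2 (smul_P_right_injective b hp ?_)
  rw [smul_zero, ← algebraMap_smul (R k) p, hs, mul_comm, mul_smul, h, smul_zero]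

theorem finite_of_basis (b : Module.Basis ι (P k) Q) : Module.Finite (R k) Q :=
  have := Module.Finite.of_basis b
  Module.Finite.of_restrictScalars_finite (P k) (R k) Q

theorem finrank_R_of_basis (b : Module.Basis (Fin 6) (P k) Q) : Module.finrank (R k) Q = 2 := by
  have := finite_of_basis b
  have h := finrank_P_eq (k := k) (Q := Q)
  rw [Module.finrank_eq_card_basis b, Fintype.card_fin] at h
  omega

/-- The augmentation of `R`. -/
noncomputable def augmentation (k : Type u) [Field k] : R k →ₐ[k] k := lift k 0 (by simp)

theorem augmentation_y (i : Fin 3) : augmentation k (y k i) = 0 := by simp [augmentation]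

/-- The constant coefficients of the coordinates. -/
noncomputable def constCoord (b : Module.Basis ι (P k) Q) : Q →+ (ι → k) where
  toFun v i := constantCoeff (b.repr v i)
  map_zero' := by ext; simp
  map_add' v w := by ext; simp

omit [Fintype ι] [IsScalarTower (P k) (R k) Q] [Module (R k) Q] in
theorem constCoord_P_smul (b : Module.Basis ι (P k) Q) (p : P k) (v : Q) :
    constCoord b (p • v) = constantCoeff p • constCoord b v := by
  ext i; simp [constCoord]

theorem constCoord_y_zero_smul (b : Module.Basis ι (P k) Q)
    (h : ∀ i, constCoord b (y k 0 • b i) = 0) (v : Q) : constCoord b (y k 0 • v) = 0 := by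
  conv_lhs => rw [← b.sum_repr v, Finset.smul_sum, map_sum]
  refine Finset.sum_eq_zero fun i _ => ?_
  rw [smul_comm, constCoord_P_smul, h, smul_zero]

theorem constCoord_smul (b : Module.Basis ι (P k) Q)
    (h : ∀ i, constCoord b (y k 0 • b i) = 0) (r : R k) (v : Q) :
    constCoord b (r • v) = augmentation k r • constCoord b v := by
  induction r using R_induction generalizing v with
  | hC c => rw [← C_smul, constCoord_P_smul, AlgHom.commutes]; simp
  | hadd r s hr hs => rw [add_smul, map_add, hr, hs, map_add, add_smul]
  | hmul r i hr =>
    rw [mul_smul, hr, map_mul, augmentation_y, mul_zero, zero_smul]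
    fin_cases i
    · simp [constCoord_y_zero_smul b h]
    · simp [← X_zero_smul, constCoord_P_smul]
    · simp [← X_one_smul, constCoord_P_smul]

/-- As y₁ contributes no constants, the constant coefficients of the coordinates form a surjection
onto k^ι that is semilinear for the augmentation of R. It maps generators over R to a spanning set
of k^ι. -/
theorem spanFinrank_of_basis (b : Module.Basis ι (P k) Q)
    (h : ∀ i, constCoord b (y k 0 • b i) = 0) :
    (⊤ : Submodule (R k) Q).spanFinrank = Fintype.card ι := by
  classical
  have hfin := finite_of_basis b
  apply le_antisymm
  · have hs : Submodule.span (R k) (Set.range b) = ⊤ := by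
      rw [eq_top_iff]
      intro v _
      rw [← b.sum_repr v]
      refine sum_mem fun i _ => ?_
      rw [← algebraMap_smul (R k)]
      exact Submodule.smul_mem _ _ (Submodule.subset_span ⟨i, rfl⟩)
    rw [← hs]
    refine (Submodule.spanFinrank_span_le_ncard_of_finite (Set.finite_range b)).trans ?_
    rw [Set.ncard_eq_toFinset_card', Set.toFinset_range]
    exact Finset.card_image_le
  · obtain ⟨s, hs, hspan⟩ := hfin.fg_top.exists_span_finset_card_eq_spanFinrank
    rw [← hs]
    have htop : Submodule.span k ((s.image (constCoord b) : Finset (ι → k)) : Set (ι → k)) = ⊤ := by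
      rw [eq_top_iff]
      intro c _
      have : ∀ v : Q, constCoord b v ∈
          Submodule.span k ((s.image (constCoord b) : Finset (ι → k)) : Set (ι → k)) := by
        intro v
        have hv : v ∈ Submodule.span (R k) (s : Set Q) := hspan ▸ trivial
        induction hv using Submodule.span_induction with
        | mem v hv => exact Submodule.subset_span (Finset.mem_image_of_mem _ hv)
        | zero => rw [map_zero]; exact zero_mem _
        | add v w _ _ hv hw => rw [map_add]; exact add_mem hv hw
        | smul r v _ hv => rw [constCoord_smul b h]; exact Submodule.smul_mem _ _ hv
      convert this (∑ i, (C (c i) : P k) • b i)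
      ext i
      change _ = constantCoeff (b.repr _ i)
      rw [b.repr_sum_self]
      simp
    have := finrank_span_finset_le_card (R := k) (s.image (constCoord b))
    rw [Set.finrank, htop, finrank_top, Module.finrank_fintype_fun_eq_card] at this
    exact this.trans Finset.card_image_le

end Free

namespace GrMod

variable {k : Type u} [Field k] {M M' : GrMod k}

theorem isMCM_of_basis {ι : Type*} [Fintype ι] [Nonempty ι] (b : Module.Basis ι (P k) M.carrier)
    (h : ∀ i, constCoord b (y k 0 • b i) = 0) : M.IsMCM := by
  refine ⟨finite_of_basis b, [y k 2, y k 1], ?_, ?_,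
    isWeaklyRegular_of_isRegularPair (isRegularPair_of_basis b), ?_⟩
  · intro r hr
    simp only [List.mem_cons, List.not_mem_nil, or_false] at hr
    rcases hr with rfl | rfl
    · exact Ideal.subset_span ⟨2, rfl⟩
    · exact Ideal.subset_span ⟨1, rfl⟩
  · rw [ringKrullDim_R]; rfl
  · intro htop
    obtain ⟨i⟩ := ‹Nonempty ι›
    have hmem : b i ∈ Ideal.ofList [y k 2, y k 1] • (⊤ : Submodule (R k) M.carrier) := htop ▸ trivial
    have : constCoord b (b i) = 0 := by
      refine Submodule.smul_induction_on hmem (fun r hr v _ => ?_) fun v w hv hw => by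
        rw [map_add, hv, hw, add_zero]
      rw [constCoord_smul b h]
      have hr0 : r ∈ RingHom.ker (augmentation k) := by
        refine (Ideal.span_le (I := RingHom.ker (augmentation k))).2 ?_ hr
        intro s hs
        simp only [List.mem_cons, List.not_mem_nil, or_false, Set.mem_ofPred_eq] at hs
        rcases hs with rfl | rfl <;> exact augmentation_y _
      rw [(RingHom.mem_ker).1 hr0, zero_smul]
    have := congrFun this i
    simp [constCoord] at this

theorem map_proj {φ : M.carrier →+ M'.carrier} {s : ℤ}
    (hφ : ∀ i, ∀ v ∈ M.deg i, φ v ∈ M'.deg (i + s)) (i : ℤ) (v : M.carrier) :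
    M'.proj (i + s) (φ v) = φ (M.proj i v) := by
  obtain ⟨t, ht0, ht⟩ := proj_sum v
  conv_lhs => rw [← ht, map_sum, map_sum]
  rw [Finset.sum_congr rfl fun l _ => proj_of_mem (hφ l _ (M.proj_mem l v)) (i + s)]
  simp only [add_left_inj, Finset.sum_ite_eq]
  split_ifs with h
  · rfl
  · rw [ht0 _ h, map_zero]

theorem isGradedSubmodule_of_proj {N : Submodule (R k) M.carrier}
    (h : ∀ v ∈ N, ∀ i, M.proj i v ∈ N) : M.IsGradedSubmodule N := by
  refine ⟨{v | v ∈ N ∧ ∃ i, v ∈ M.deg i}, fun v hv => hv.2, le_antisymm (fun v hv => ?_)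
    (Submodule.span_le.2 fun v hv => hv.1)⟩
  obtain ⟨t, -, ht⟩ := proj_sum v
  rw [← ht]
  exact sum_mem fun i _ => Submodule.subset_span ⟨h v hv i, i, M.proj_mem i v⟩

theorem proj_mem_of_isGradedSubmodule {N : Submodule (R k) M.carrier} (hN : M.IsGradedSubmodule N)
    {v : M.carrier} (hv : v ∈ N) (i : ℤ) : M.proj i v ∈ N := by
  obtain ⟨T, hT, rfl⟩ := hN
  induction hv using Submodule.span_induction generalizing i with
  | mem v hv =>
    obtain ⟨l, hl⟩ := hT v hv
    rw [proj_of_mem hl]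
    split_ifs
    · exact Submodule.subset_span hv
    · exact zero_mem _
  | zero => rw [map_zero]; exact zero_mem _
  | add v w _ _ hv hw => rw [map_add]; exact add_mem (hv i) (hw i)
  | smul r v _ hv =>
    induction r using R_induction generalizing i with
    | hC c => rw [proj_algebraMap_smul]; exact Submodule.smul_mem _ _ (hv i)
    | hadd a b ha hb => rw [add_smul, map_add]; exact add_mem (ha i) (hb i)
    | hmul a l ha =>
      rw [mul_comm, mul_smul, proj_y_smul]
      exact Submodule.smul_mem _ _ (ha _)

theorem mem_deg_of_y_smul_mem {l : Fin 3} (hl : ∀ v w : M.carrier, y k l • v = y k l • w → v = w)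
    {v : M.carrier} {i : ℤ} (h : y k l • v ∈ M.deg (i + 1)) : v ∈ M.deg i := by
  have := proj_same h
  rw [proj_y_smul, add_sub_cancel_right] at this
  rw [← hl _ _ this]
  exact M.proj_mem i v

/-- A graded homomorphism onto a copy of the module over the normalization splits. -/
theorem not_isIndecomposable_of_functional (b : Module.Basis (Fin 6) (P k) M.carrier)
    {e g h : M.carrier} (ht : IsTriple k e g h) (γ : M.carrier →ₗ[P k] P k)
    (h1 : ∀ v, (X 0 : P k) ∣ γ (y k 0 • v)) (h2 : ∀ v, (X 1 : P k) ∣ γ (y k 0 • y k 0 • v))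
    (hdeg : ∀ i, ∀ v ∈ M.deg i, γ v • g ∈ M.deg i) (hg : γ g = 1) (he : γ e = 0) (hh : γ h = 0) :
    ¬ M.IsIndecomposable := by
  obtain ⟨η, θ, hη, hθ, hθx⟩ := exists_companions γ h1 h2
  -- The composite M → L → M given by γ with its companions and by the triple. The hypotheses on γ
  -- e, γ g, γ h make it the identity on the triple, hence idempotent.
  let ρP : M.carrier →ₗ[P k] M.carrier :=
    (θ + η).smulRight e + γ.smulRight g + η.smulRight h
  have hρP : ∀ v, ρP v = (θ v + η v) • e + γ v • g + η v • h := fun v => rfl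
  let ρ : M.carrier →ₗ[R k] M.carrier := linearOfP ρP fun v => by
    rw [hρP, hρP, hη, hθ, smul_add, smul_add, smul_comm (y k 0) _ e, smul_comm (y k 0) _ g,
      smul_comm (y k 0) _ h, ht.rel_e, ht.rel_g, ht.rel_h, ← X_zero_smul, ← X_zero_smul,
      ← X_one_smul, hθx]
    module
  have hρ : ∀ v, ρ v = (θ v + η v) • e + γ v • g + η v • h := fun v => rfl
  have hρg : ρ g = g := by
    have e1 : η g = 0 := by
      refine mul_left_cancel₀ (P_X_ne_zero 0) ?_
      rw [← hη, ht.rel_g, ← X_zero_smul, map_smul, he, smul_zero, mul_zero]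
    have e2 : η e = 0 := by
      refine mul_left_cancel₀ (P_X_ne_zero 0) ?_
      rw [← hη, ht.rel_e, ← X_one_smul, map_smul, hh, smul_zero, mul_zero]
    have e3 : θ g = 0 := by
      refine mul_left_cancel₀ (P_X_ne_zero 1) ?_
      rw [← hθ, ht.rel_g, ← X_zero_smul, map_smul, e2, smul_zero, mul_zero]
    rw [hρ, e1, e3, hg]; simp
  have hρe : ρ e = e := y_one_smul_cancel b (by rw [← map_smul, ← ht.rel_g, map_smul, hρg])
  have hρh : ρ h = h := y_two_smul_cancel b (by rw [← map_smul, ← ht.rel_e, map_smul, hρe])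
  have hidem : ∀ v, ρ (ρ v) = ρ v := fun v => by
    have hP : ∀ (p : P k) (w : M.carrier), ρ (p • w) = p • ρ w := fun p w => ρP.map_smul p w
    conv_lhs => rw [hρ v, map_add, map_add, hP, hP, hP, hρg, hρe, hρh]
    rw [hρ]
  have c1 := fun v w => y_one_smul_cancel (k := k) b (v := v) (w := w)
  have c2 := fun v w => y_two_smul_cancel (k := k) b (v := v) (w := w)
  -- The relations y₁g = y₂e and y₁e = y₃h force e, g, h to have the same degree, and likewise γ, η,
  -- θ. So ρ preserves degrees and its image and kernel are graded.
  have de : ∀ (i : ℤ) (p : P k), p • g ∈ M.deg i → p • e ∈ M.deg i := fun i p hp => by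
    refine mem_deg_of_y_smul_mem c1 ?_
    rw [smul_comm, ← ht.rel_g, smul_comm]
    exact y_smul_mem 0 hp
  have dh : ∀ (i : ℤ) (p : P k), p • g ∈ M.deg i → p • h ∈ M.deg i := fun i p hp => by
    refine mem_deg_of_y_smul_mem c2 ?_
    rw [smul_comm, ← ht.rel_e, smul_comm]
    exact y_smul_mem 0 (de i p hp)
  have dη : ∀ i, ∀ v ∈ M.deg i, η v • g ∈ M.deg i := fun i v hv => by
    refine mem_deg_of_y_smul_mem c1 ?_
    rw [← X_zero_smul, smul_smul, ← hη]
    exact hdeg _ _ (y_smul_mem 0 hv)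
  have dθ : ∀ i, ∀ v ∈ M.deg i, θ v • g ∈ M.deg i := fun i v hv => by
    refine mem_deg_of_y_smul_mem c2 ?_
    rw [← X_one_smul, smul_smul, ← hθ]
    exact dη _ _ (y_smul_mem 0 hv)
  have dρ : ∀ i, ∀ v ∈ M.deg i, ρ v ∈ M.deg (i + 0) := fun i v hv => by
    rw [add_zero, hρ, add_smul]
    exact add_mem (add_mem (add_mem (de i _ (dθ i v hv)) (de i _ (dη i v hv))) (hdeg i v hv))
      (dh i _ (dη i v hv))
  have hproj : ∀ i v, M.proj i (ρ v) = ρ (M.proj i v) := fun i v => by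
    simpa using map_proj (φ := ρ.toAddMonoidHom) dρ i v
  have hcompl : IsCompl (LinearMap.range ρ) (LinearMap.ker ρ) :=
    LinearMap.IsIdempotentElem.isCompl (LinearMap.ext hidem)
  have hA : M.IsGradedSubmodule (LinearMap.range ρ) := isGradedSubmodule_of_proj <| by
    rintro _ ⟨v, rfl⟩ i
    exact ⟨M.proj i v, (hproj i v).symm⟩
  have hB : M.IsGradedSubmodule (LinearMap.ker ρ) := isGradedSubmodule_of_proj <| by
    intro v hv i
    rw [LinearMap.mem_ker, ← hproj, LinearMap.mem_ker.1 hv, map_zero]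
  intro hind
  rcases hind.2 _ _ hA hB hcompl with hbot | hbot
  · have : g = 0 := by
      rw [← hρg, ← Submodule.mem_bot (R k), ← hbot]
      exact ⟨g, rfl⟩
    rw [this, map_zero] at hg
    exact zero_ne_one hg
  · have hid : ∀ v, ρ v = v := fun v => by
      have : ρ v - v ∈ LinearMap.ker ρ := by rw [LinearMap.mem_ker, map_sub, hidem, sub_self]
      rwa [hbot, Submodule.mem_bot, sub_eq_zero] at this
    -- If the kernel of ρ were zero, M would be generated over P by three elements, against its
    -- P-rank 6.
    have hspan : ⊤ ≤ Submodule.span (P k) (Set.range ![e, g, h]) := fun v _ => by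
      rw [← hid v, hρ]
      have hm : ∀ i, (![e, g, h] : Fin 3 → M.carrier) i ∈
          Submodule.span (P k) (Set.range ![e, g, h]) := fun i => Submodule.subset_span ⟨i, rfl⟩
      exact add_mem (add_mem (Submodule.smul_mem _ _ (hm 0)) (Submodule.smul_mem _ _ (hm 1)))
        (Submodule.smul_mem _ _ (hm 2))
    have hcard := finrank_range_le_card (R := P k) ![e, g, h]
    rw [Set.finrank, top_le_iff.1 hspan, finrank_top, Module.finrank_eq_card_basis b] at hcard
    simp at hcard

end GrMod

end NodalCone

/-! ### Normal forms: their endomorphisms, isomorphisms and invariants. -/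

namespace NodalCone

open MvPolynomial

namespace GrMod

variable {k : Type u} [Field k] {M M' : GrMod k}

section HomogeneousBasis

variable {ι : Type*} (b : Module.Basis ι (P k) M.carrier) {d : ι → ℤ}

theorem repr_monomial (m n : ℕ) (i l : ι) :
    b.repr (y k 1 ^ m • y k 2 ^ n • b i) l = X 0 ^ m * X 1 ^ n * b.repr (b i) l := by
  have : y k 1 ^ m • y k 2 ^ n • b i = (X 0 ^ m * X 1 ^ n : P k) • b i := by
    rw [← algebraMap_smul (R k) (X 0 ^ m * X 1 ^ n : P k), map_mul, map_pow, map_pow,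
      algebraMap_X_zero, algebraMap_X_one, mul_smul]
  rw [this, map_smul, Finsupp.smul_apply, smul_eq_mul]

theorem repr_k_smul (c : k) (v : M.carrier) (i : ι) :
    b.repr (c • v) i = C c * b.repr v i := by
  rw [← algebraMap_smul (P k) c v, map_smul, Finsupp.smul_apply, smul_eq_mul]
  rfl

theorem repr_eq_zero (hb : ∀ i, b i ∈ M.deg (d i)) {D : ℤ} {v : M.carrier} (hv : v ∈ M.deg D)
    {i : ι} (hi : D < d i) : b.repr v i = 0 := by
  replace hv := mem_gspan hb b.span_eq hv
  induction hv using Submodule.span_induction with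
  | mem v hv =>
    obtain ⟨l, m, n, h, rfl⟩ := hv
    have hl : l ≠ i := by rintro rfl; omega
    rw [repr_monomial, b.repr_self, Finsupp.single_eq_of_ne (Ne.symm hl), mul_zero]
  | zero => simp
  | add v w _ _ hv hw => simp [hv, hw]
  | smul c v _ hv => rw [repr_k_smul, hv, mul_zero]

theorem repr_eq_C (hb : ∀ i, b i ∈ M.deg (d i)) {D : ℤ} {v : M.carrier} (hv : v ∈ M.deg D)
    {i : ι} (hi : D = d i) : ∃ c : k, b.repr v i = C c := by
  replace hv := mem_gspan hb b.span_eq hv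
  induction hv using Submodule.span_induction with
  | mem v hv =>
    obtain ⟨l, m, n, h, rfl⟩ := hv
    rw [repr_monomial, b.repr_self]
    by_cases hl : i = l
    · subst hl
      obtain ⟨rfl, rfl⟩ : m = 0 ∧ n = 0 := by omega
      exact ⟨1, by simp⟩
    · exact ⟨0, by rw [Finsupp.single_eq_of_ne hl]; simp⟩
  | zero => exact ⟨0, by simp⟩
  | add v w _ _ hv hw =>
    obtain ⟨a, ha⟩ := hv
    obtain ⟨c, hc⟩ := hw
    exact ⟨a + c, by simp [ha, hc]⟩
  | smul c v _ hv =>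
    obtain ⟨a, ha⟩ := hv
    exact ⟨c * a, by rw [repr_k_smul, ha, C_mul]⟩

theorem map_mem_deg (hb : ∀ i, b i ∈ M.deg (d i)) {s : ℤ} (φ : M.carrier →ₗ[R k] M'.carrier)
    (hφ : ∀ i, φ (b i) ∈ M'.deg (d i + s)) {D : ℤ} {v : M.carrier} (hv : v ∈ M.deg D) :
    φ v ∈ M'.deg (D + s) := by
  replace hv := mem_gspan hb b.span_eq hv
  induction hv using Submodule.span_induction with
  | mem v hv =>
    obtain ⟨l, m, n, h, rfl⟩ := hv
    rw [map_smul, map_smul]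
    have := y_pow_smul_mem 1 m (y_pow_smul_mem 2 n (hφ l))
    rwa [show d l + s + n + m = D + s by omega] at this
  | zero => rw [map_zero]; exact zero_mem _
  | add v w _ _ hv hw => rw [map_add]; exact add_mem hv hw
  | smul c v _ hv =>
    rw [← algebraMap_smul (R k) c v, map_smul, algebraMap_smul]
    exact k_smul_mem c hv

theorem map_P_smul (φ : M.carrier →ₗ[R k] M'.carrier) (p : P k) (v : M.carrier) :
    φ (p • v) = p • φ v := by
  rw [← algebraMap_smul (R k) p v, map_smul, algebraMap_smul]

theorem map_k_smul (φ : M.carrier →ₗ[R k] M'.carrier) (c : k) (v : M.carrier) :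
    φ (c • v) = c • φ v := by
  rw [← algebraMap_smul (R k) c v, map_smul, algebraMap_smul]

theorem repr_y_one_smul (v : M.carrier) (i : ι) : b.repr (y k 1 • v) i = X 0 * b.repr v i := by
  rw [← X_zero_smul, map_smul, Finsupp.smul_apply, smul_eq_mul]

theorem repr_y_two_smul (v : M.carrier) (i : ι) : b.repr (y k 2 • v) i = X 1 * b.repr v i := by
  rw [← X_one_smul, map_smul, Finsupp.smul_apply, smul_eq_mul]

end HomogeneousBasis

theorem _root_.NodalCone.IsTriple.map {e g h : M.carrier} (ht : IsTriple k e g h)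
    (φ : M.carrier →ₗ[R k] M'.carrier) : IsTriple k (φ e) (φ g) (φ h) :=
  ⟨by rw [← map_smul, ht.rel_e, map_smul], by rw [← map_smul, ht.rel_g, map_smul],
    by rw [← map_smul, ht.rel_h, map_sub, map_smul, map_smul]⟩

/-- The degrees of the generators of a module in normal form. -/
def nfDeg (d : ℤ) (j : ℕ) : Fin 6 → ℤ := ![d, d, d, d + j, d + j, d + j]

theorem nfDeg_add_sub (d d' : ℤ) (j : ℕ) (i : Fin 6) :
    nfDeg d j i + (d' - d) = nfDeg d' j i := by
  fin_cases i <;> simp [nfDeg] <;> ring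

/-- A presentation of `M` as an extension of two copies of the module over the normalization. -/
structure NormalForm (M : GrMod k) (d : ℤ) (j : ℕ) (lam mu : k) where
  /-- A basis over `P`. -/
  b : Module.Basis (Fin 6) (P k) M.carrier
  mem : ∀ i, b i ∈ M.deg (nfDeg d j i)
  triple : IsTriple k (b 0) (b 1) (b 2)
  rel_three : y k 0 • b 3 = y k 2 • b 5
  -- In L one has b 0 = s², b 1 = st and b 2 + b 0 = t², so the correction terms are s(lam s + mu t)
  -- here and -t(lam s + mu t) in the next relation, both times y₃^(j+1). The exponent j + 1 is
  -- forced by the degrees.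
  rel_four : y k 0 • b 4 = y k 1 • b 3 + y k 2 ^ (j + 1) • (lam • b 0 + mu • b 1)
  rel_five : y k 0 • b 5 = y k 1 • b 4 - y k 2 • b 5
    - y k 2 ^ (j + 1) • (lam • b 1 + mu • (b 2 + b 0))

namespace NormalForm

variable {d d' : ℤ} {j j' : ℕ} {lam mu lam' mu' : k} (B : NormalForm M d j lam mu)

include B

/-- The matrix of the multiplication by `y₁`. -/
theorem repr_smul (v : M.carrier) (i : Fin 6) : B.b.repr (y k 0 • v) i =
    (![X 0 * B.b.repr v 1 + X 1 ^ (j + 1) * (C lam * B.b.repr v 4 - C mu * B.b.repr v 5),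
      X 0 * B.b.repr v 2 + X 1 ^ (j + 1) * (C mu * B.b.repr v 4 - C lam * B.b.repr v 5),
      X 1 * (B.b.repr v 0 - B.b.repr v 2) - X 1 ^ (j + 1) * (C mu * B.b.repr v 5),
      X 0 * B.b.repr v 4, X 0 * B.b.repr v 5, X 1 * (B.b.repr v 3 - B.b.repr v 5)] :
        Fin 6 → P k) i := by
  set p := B.b.repr v with hp
  have hv : v = ∑ i, p i • B.b i := (B.b.sum_repr v).symm
  have key : y k 0 • v = ∑ i, (![X 0 * p 1 + X 1 ^ (j + 1) * (C lam * p 4 - C mu * p 5),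
      X 0 * p 2 + X 1 ^ (j + 1) * (C mu * p 4 - C lam * p 5),
      X 1 * (p 0 - p 2) - X 1 ^ (j + 1) * (C mu * p 5),
      X 0 * p 4, X 0 * p 5, X 1 * (p 3 - p 5)] : Fin 6 → P k) i • B.b i := by
    conv_lhs => rw [hv, Finset.smul_sum]
    have hz : ∀ w : M.carrier, y k 2 ^ (j + 1) • w = (X 1 ^ (j + 1) : P k) • w := fun w => by
      rw [← algebraMap_smul (R k) (X 1 ^ (j + 1) : P k), map_pow, algebraMap_X_one]
    have hc : ∀ (c : k) (w : M.carrier), c • w = (C c : P k) • w := fun c w =>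
      (algebraMap_smul (P k) c w).symm
    simp only [smul_comm (y k 0), Fin.sum_univ_six, Matrix.cons_val, B.triple.rel_e,
      B.triple.rel_g, B.triple.rel_h, B.rel_three, B.rel_four, B.rel_five, hz, hc, ← X_zero_smul,
      ← X_one_smul]
    module
  rw [key, B.b.repr_sum_self]

theorem constCoord_smul_eq_zero (i : Fin 6) : constCoord B.b (y k 0 • B.b i) = 0 := by
  ext l
  change constantCoeff (B.b.repr _ l) = 0
  rw [B.repr_smul]
  fin_cases l <;> simp

theorem isMCM : M.IsMCM := isMCM_of_basis B.b B.constCoord_smul_eq_zero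

theorem rank_eq : M.rank = 2 := finrank_R_of_basis B.b

theorem minGens_eq : M.minGens = 6 := by
  rw [minGens, spanFinrank_of_basis B.b B.constCoord_smul_eq_zero, Fintype.card_fin]

/-- The coordinates 3, 4, 5 of g are constants. Coordinate 5 times y₂ is a multiple of y₃ and so
vanishes; then coordinate 3 times y₃ is a multiple of y₂ and vanishes too. Coordinates 0 and 1 of
the first relation at (0, 1) give the last two equations. The parameters a, c are zero for triples,
and nonzero values occur for the images of b 3, b 4, b 5 under an isomorphism. -/
theorem coords_of_triple {e g h : M.carrier} {a c : k} (hg : g ∈ M.deg (d + j))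
    (h1 : y k 0 • g = y k 1 • e + y k 2 ^ (j + 1) • (a • B.b 0 + c • B.b 1))
    (h2 : y k 0 • e = y k 2 • h) : B.b.repr g 3 = 0 ∧ B.b.repr g 5 = 0 ∧
      ∃ t : k, B.b.repr g 4 = C t ∧ lam * t = a ∧ mu * t = c := by
  obtain ⟨c3, h3⟩ := repr_eq_C B.b B.mem hg (i := 3) rfl
  obtain ⟨c4, h4⟩ := repr_eq_C B.b B.mem hg (i := 4) rfl
  obtain ⟨c5, h5⟩ := repr_eq_C B.b B.mem hg (i := 5) rfl
  have hz : ∀ w : M.carrier, y k 2 ^ (j + 1) • w = (X 1 ^ (j + 1) : P k) • w := fun w => by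
    rw [← algebraMap_smul (R k) (X 1 ^ (j + 1) : P k), map_pow, algebraMap_X_one]
  have e1 : ∀ i, B.b.repr (y k 0 • g) i = X 0 * B.b.repr e i
      + X 1 ^ (j + 1) * (C a * B.b.repr (B.b 0) i + C c * B.b.repr (B.b 1) i) := fun i => by
    rw [h1, hz, map_add, Finsupp.add_apply, repr_y_one_smul, map_smul, Finsupp.smul_apply,
      map_add, Finsupp.add_apply, repr_k_smul, repr_k_smul, smul_eq_mul]
  have e2 : ∀ i, B.b.repr (y k 0 • e) i = X 1 * B.b.repr h i := fun i => by
    rw [h2, repr_y_two_smul]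
  have a4 := e1 4
  have b3 := e2 3
  rw [B.repr_smul] at a4 b3
  simp at a4 b3
  have c50 : c5 = 0 := by
    rw [← a4, h5] at b3
    simpa using congrArg (eval ![1, 0]) b3
  subst c50
  have a5 := e1 5
  rw [B.repr_smul] at a5
  simp [h3, h5] at a5
  have c30 : c3 = 0 := by simpa using congrArg (eval ![0, 1]) a5
  subst c30
  refine ⟨by rw [h3, C_0], by rw [h5, C_0], c4, h4, ?_, ?_⟩
  · have a0 := e1 0
    rw [B.repr_smul] at a0
    simp [h4, h5] at a0
    simpa using congrArg (eval ![0, 1]) a0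
  · have a1 := e1 1
    rw [B.repr_smul] at a1
    simp [h4, h5] at a1
    simpa using congrArg (eval ![0, 1]) a1

theorem coords_of_isTriple (hne : lam ≠ 0 ∨ mu ≠ 0) {e g h : M.carrier} (ht : IsTriple k e g h)
    (hg : g ∈ M.deg (d + j)) : B.b.repr g 3 = 0 ∧ B.b.repr g 4 = 0 ∧ B.b.repr g 5 = 0 := by
  obtain ⟨h3, h5, t, h4, h1, h2⟩ := B.coords_of_triple (a := 0) (c := 0) (e := e) (h := h) hg
    (by simpa using ht.rel_g) ht.rel_e
  refine ⟨h3, ?_, h5⟩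
  rw [h4]
  rcases hne with h | h <;> simp_all

/-- The map from L to the second copy vanishes by degree if j > 0 and by `coords_of_isTriple` if j =
0. Inside the first copy the relations leave only multiples of b 1 for g, and e, h follow by
cancelling y₂ and y₃. -/
theorem exists_eq_smul_of_isTriple (hne : lam ≠ 0 ∨ mu ≠ 0) {e g h : M.carrier}
    (ht : IsTriple k e g h) (hg : g ∈ M.deg d) :
    ∃ c : k, e = c • B.b 0 ∧ g = c • B.b 1 ∧ h = c • B.b 2 := by
  have hhigh : B.b.repr g 3 = 0 ∧ B.b.repr g 4 = 0 ∧ B.b.repr g 5 = 0 := by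
    rcases Nat.eq_zero_or_pos j with rfl | hj
    · exact B.coords_of_isTriple hne ht (by simpa using hg)
    · have h1 : ∀ i, d < nfDeg d j i → B.b.repr g i = 0 := fun i => repr_eq_zero B.b B.mem hg
      exact ⟨h1 3 (by simp [nfDeg, hj]), h1 4 (by simp [nfDeg, hj]), h1 5 (by simp [nfDeg, hj])⟩
  obtain ⟨h3, h4, h5⟩ := hhigh
  obtain ⟨c0, h0⟩ := repr_eq_C B.b B.mem hg (i := 0) rfl
  obtain ⟨c1, h1⟩ := repr_eq_C B.b B.mem hg (i := 1) rfl
  obtain ⟨c2, h2⟩ := repr_eq_C B.b B.mem hg (i := 2) rfl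
  have e1 : ∀ i, B.b.repr (y k 0 • g) i = X 0 * B.b.repr e i := fun i => by
    rw [ht.rel_g, repr_y_one_smul]
  have e2 : ∀ i, B.b.repr (y k 0 • e) i = X 1 * B.b.repr h i := fun i => by
    rw [ht.rel_e, repr_y_two_smul]
  have a1 := e1 1
  have a2 := e1 2
  have a3 := e1 3
  have a4 := e1 4
  have a5 := e1 5
  have b0 := e2 0
  rw [B.repr_smul] at a1 a2 a3 a4 a5 b0
  simp [h0, h1, h2, h3, h4, h5] at a1 a2 a3 a4 a5 b0
  have hc : c0 - c2 = 0 := by simpa using congrArg (eval ![0, 1]) a2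
  have hc2 : c2 = 0 := by
    rw [a4, a5, ← a1] at b0
    simpa using congrArg (eval ![1, 0]) b0
  subst hc2
  rw [sub_zero] at hc
  subst hc
  have hg' : g = c1 • B.b 1 := by
    refine B.b.repr.injective (Finsupp.ext fun i => ?_)
    rw [repr_k_smul, B.b.repr_self]
    fin_cases i <;> simp [h0, h1, h2, h3, h4, h5]
  have he' : e = c1 • B.b 0 := y_one_smul_cancel B.b (by
    rw [← ht.rel_g, hg', smul_comm, B.triple.rel_g, smul_comm])
  exact ⟨c1, he', hg', y_two_smul_cancel B.b (by
    rw [← ht.rel_e, he', smul_comm, B.triple.rel_e, smul_comm])⟩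

/-- Since π kills the first copy of L, it maps b 3, b 4, b 5 to a triple. By `coords_of_isTriple`
the element π (b 4) lies in the first copy, so π (b 4) = π (π (b 4)) = 0, and the rest follows from
the relations. -/
theorem endomorphism_eq_zero (hne : lam ≠ 0 ∨ mu ≠ 0) (π : M.carrier →ₗ[R k] M.carrier)
    (hdeg : ∀ i, ∀ v ∈ M.deg i, π v ∈ M.deg i) (hidem : ∀ v, π (π v) = π v)
    (h1 : π (B.b 1) = 0) : π = 0 := by
  have t := B.triple.map π
  have h0 : π (B.b 0) = 0 := y_one_smul_cancel B.b (by rw [← t.rel_g, h1, smul_zero, smul_zero])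
  have h2 : π (B.b 2) = 0 := y_two_smul_cancel B.b (by rw [← t.rel_e, h0, smul_zero, smul_zero])
  have t' : IsTriple k (π (B.b 3)) (π (B.b 4)) (π (B.b 5)) := by
    refine ⟨?_, ?_, ?_⟩
    · rw [← map_smul, B.rel_three, map_smul]
    · rw [← map_smul, B.rel_four, map_add, map_smul, map_smul, map_add, map_k_smul, map_k_smul,
        h0, h1]
      simp
    · rw [← map_smul, B.rel_five, map_sub, map_sub, map_smul, map_smul, map_smul, map_add,
        map_k_smul, map_k_smul, map_add, h0, h1, h2]
      simp
  obtain ⟨c3, c4, c5⟩ := B.coords_of_isTriple hne t' (hdeg _ _ (B.mem 4))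
  have h4 : π (B.b 4) = 0 := by
    rw [← hidem, ← B.b.sum_repr (π (B.b 4)), map_sum]
    simp [Fin.sum_univ_six, h0, h1, h2, c3, c4, c5]
  have h3 : π (B.b 3) = 0 := y_one_smul_cancel B.b (by rw [← t'.rel_g, h4, smul_zero, smul_zero])
  have h5 : π (B.b 5) = 0 := y_two_smul_cancel B.b (by rw [← t'.rel_e, h3, smul_zero, smul_zero])
  ext v
  rw [← B.b.sum_repr v, map_sum]
  simp [Fin.sum_univ_six, h0, h1, h2, h3, h4, h5]

/-- The projection π onto a graded summand maps b 1 to c b 1 with c² = c. So π or 1 - π kills b 1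
and vanishes by `endomorphism_eq_zero`. -/
theorem isIndecomposable (hne : lam ≠ 0 ∨ mu ≠ 0) : M.IsIndecomposable := by
  refine ⟨⟨B.b 0, 0, B.b.ne_zero 0⟩, fun N N' hN hN' hc => ?_⟩
  let π : M.carrier →ₗ[R k] M.carrier := N.subtype ∘ₗ N.projectionOnto N' hc
  have hπN : ∀ v ∈ N, π v = v := fun v hv =>
    congrArg Subtype.val (Submodule.projectionOnto_apply_left hc ⟨v, hv⟩)
  have hπN' : ∀ v ∈ N', π v = 0 := fun v hv =>
    congrArg Subtype.val (Submodule.projectionOnto_apply_right hc ⟨v, hv⟩)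
  have hmem : ∀ v, π v ∈ N := fun v => (N.projectionOnto N' hc v).2
  have hmem' : ∀ v, v - π v ∈ N' := fun v => by
    obtain ⟨a, ha, a', ha', rfl⟩ := Submodule.mem_sup.1
      (hc.sup_eq_top ▸ trivial : v ∈ N ⊔ N')
    rw [map_add, hπN a ha, hπN' a' ha']
    simpa using ha'
  have hidem : ∀ v, π (π v) = π v := fun v => hπN _ (hmem v)
  have hdeg : ∀ i, ∀ v ∈ M.deg i, π v ∈ M.deg i := fun i v hv => by
    have h1 : π v = M.proj i (π v) := by
      have h2 : π (M.proj i (π v) + M.proj i (v - π v)) = M.proj i (π v) := by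
        rw [map_add, hπN _ (proj_mem_of_isGradedSubmodule hN (hmem v) i),
          hπN' _ (proj_mem_of_isGradedSubmodule hN' (hmem' v) i), add_zero]
      rw [← map_add, add_sub_cancel, proj_same hv] at h2
      exact h2
    rw [h1]
    exact M.proj_mem _ _
  obtain ⟨c, -, hc1, -⟩ := B.exists_eq_smul_of_isTriple hne (B.triple.map π) (hdeg _ _ (B.mem 1))
  have hcc : c * c = c := by
    have h2 := hidem (B.b 1)
    rw [hc1, map_k_smul, hc1] at h2
    have h3 := congrArg (fun v => B.b.repr v 1) h2
    simp only [repr_k_smul, B.b.repr_self, Finsupp.single_eq_same, mul_one, ← C_mul] at h3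
    exact C_injective _ _ h3
  have hc01 : c = 0 ∨ c = 1 := by
    rcases eq_or_ne c 0 with h | h
    · exact Or.inl h
    · exact Or.inr (mul_left_cancel₀ h (by rw [hcc, mul_one]))
  rcases hc01 with rfl | rfl
  · left
    have := B.endomorphism_eq_zero hne π hdeg hidem (by rw [hc1, zero_smul])
    rw [eq_bot_iff]
    intro v hv
    rw [← hπN v hv, this]
    exact zero_mem _
  · right
    have := B.endomorphism_eq_zero hne (LinearMap.id - π) (fun i v hv => sub_mem hv (hdeg i v hv))
      (fun v => by simp [hidem]) (by simp [hc1])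
    rw [eq_bot_iff]
    intro v hv
    have h2 := LinearMap.congr_fun this v
    rw [LinearMap.sub_apply, hπN' v hv] at h2
    simpa using h2

/-- Two modules with the same normal form are isomorphic up to a shift. -/
theorem isoShift (B' : NormalForm M' d' j lam mu) : M.IsoShift M' (d' - d) := by
  let e := B.b.equiv B'.b (Equiv.refl _)
  have he : ∀ i, e (B.b i) = B'.b i := fun i => by simp [e]
  have hx : ∀ v, e (y k 0 • v) = y k 0 • e v := fun v => by
    refine B'.b.repr.injective (Finsupp.ext fun i => ?_)
    have h1 : ∀ v i, B'.b.repr (e v) i = B.b.repr v i := fun v i => by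
      simp [e, Module.Basis.equiv]
    rw [h1, B'.repr_smul, B.repr_smul]
    simp only [h1]
  let φ : M.carrier →ₗ[R k] M'.carrier := linearOfP e.toLinearMap hx
  let ψ : M'.carrier →ₗ[R k] M.carrier := linearOfP e.symm.toLinearMap fun v => by
    change e.symm _ = y k 0 • e.symm v
    rw [LinearEquiv.symm_apply_eq, hx, LinearEquiv.apply_symm_apply]
  let E : M.carrier ≃ₗ[R k] M'.carrier := LinearEquiv.ofLinearMap φ ψ
    (LinearMap.ext fun v => e.apply_symm_apply v) (LinearMap.ext fun v => e.symm_apply_apply v)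
  refine ⟨E, fun i v => ⟨fun hv => ?_, fun hv => ?_⟩⟩
  · refine map_mem_deg B.b B.mem E.toLinearMap (fun l => ?_) hv
    change e (B.b l) ∈ _
    rw [he]
    rw [nfDeg_add_sub]
    exact B'.mem l
  · have := map_mem_deg B'.b B'.mem (s := d - d') E.symm.toLinearMap (fun l => ?_) hv
    · convert this using 1
      · ring_nf
      · exact (E.symm_apply_apply v).symm
    · change e.symm (B'.b l) ∈ _
      rw [← he, LinearEquiv.symm_apply_apply]
      rw [nfDeg_add_sub]
      exact B.mem l

/-- The second copy of the module over the normalization can be rescaled. -/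
theorem scale {t : k} (ht : t ≠ 0) : Nonempty (NormalForm M d j (t * lam) (t * mu)) := by
  have hu : IsUnit (C t : P k) := (IsUnit.mk0 t ht).map C
  let w : Fin 6 → P k := ![1, 1, 1, C t, C t, C t]
  have hw : ∀ i, IsUnit (w i) := fun i => by fin_cases i <;> simp [w, hu]
  have hC : ∀ v : M.carrier, (C t : P k) • v = t • v := fun v => algebraMap_smul (P k) t v
  refine ⟨⟨B.b.isUnitSMul hw, fun i => ?_, ⟨?_, ?_, ?_⟩, ?_, ?_, ?_⟩⟩
  · rw [Module.Basis.isUnitSMul_apply]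
    have := B.mem i
    fin_cases i
    · simpa [w] using this
    · simpa [w] using this
    · simpa [w] using this
    · simpa [w, hC] using k_smul_mem t this
    · simpa [w, hC] using k_smul_mem t this
    · simpa [w, hC] using k_smul_mem t this
  · simpa [Module.Basis.isUnitSMul_apply, w] using B.triple.rel_e
  · simpa [Module.Basis.isUnitSMul_apply, w] using B.triple.rel_g
  · simpa [Module.Basis.isUnitSMul_apply, w] using B.triple.rel_h
  · simp [Module.Basis.isUnitSMul_apply, w, hC, smul_comm _ t, B.rel_three]
  · simp [Module.Basis.isUnitSMul_apply, w, hC, smul_comm _ t, B.rel_four, mul_smul]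
  · simp [Module.Basis.isUnitSMul_apply, w, hC, smul_comm _ t, B.rel_five, mul_smul, smul_sub]

theorem le_of_mem_deg {v : M.carrier} {D : ℤ} (hv : v ∈ M.deg D) (h0 : v ≠ 0) : d ≤ D := by
  by_contra! hD
  refine h0 (B.b.repr.injective (Finsupp.ext fun i => ?_))
  rw [map_zero, Finsupp.zero_apply]
  refine repr_eq_zero B.b B.mem hv (hD.trans_le ?_)
  fin_cases i <;> simp [nfDeg]

omit B in
-- If j < j', all basis vectors of M are mapped to degrees below d' + j', where the third coordinate
-- is zero, so the image misses b 3 of M'.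
theorem le_of_equiv (B : NormalForm M d j lam mu) (B' : NormalForm M' d' j' lam' mu')
    (e : M.carrier ≃ₗ[R k] M'.carrier)
    (he : ∀ i, ∀ v ∈ M.deg i, e v ∈ M'.deg (i + (d' - d))) : j' ≤ j := by
  by_contra! hj
  have h : ∀ v, B'.b.repr (e v) 3 = 0 := fun v => by
    rw [← B.b.sum_repr v, map_sum, map_sum, Finsupp.finsetSum_apply]
    refine Finset.sum_eq_zero fun i _ => ?_
    have h1 : e (B.b.repr v i • B.b i) = B.b.repr v i • e (B.b i) :=
      map_P_smul e.toLinearMap _ _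
    rw [h1, map_smul, Finsupp.smul_apply, repr_eq_zero B'.b B'.mem (he _ _ (B.mem i)), smul_zero]
    fin_cases i <;> simp [nfDeg] <;> omega
  have := h (e.symm (B'.b 3))
  rw [LinearEquiv.apply_symm_apply, B'.b.repr_self] at this
  simp at this

/-- The invariants of a normal form. -/
theorem eq_of_isoShift (hne : lam' ≠ 0 ∨ mu' ≠ 0) (B' : NormalForm M' d' j' lam' mu') {s : ℤ}
    (h : M.IsoShift M' s) : d + s = d' ∧ j = j' ∧ lam' * mu = mu' * lam := by
  obtain ⟨e, he⟩ := h
  have he' : ∀ i, ∀ v ∈ M'.deg i, e.symm v ∈ M.deg (i - s) := fun i v hv => by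
    rw [he, LinearEquiv.apply_symm_apply, sub_add_cancel]
    exact hv
  have h1 := B'.le_of_mem_deg ((he _ _).1 (B.mem 0)) (by simpa using B.b.ne_zero 0)
  have h2 := B.le_of_mem_deg (he' _ _ (B'.mem 0)) (by simpa using B'.b.ne_zero 0)
  have hs : s = d' - d := by simp [nfDeg] at h1 h2; omega
  subst hs
  have hj := B.le_of_equiv B' e fun i v hv => (he i v).1 hv
  have hj' := B'.le_of_equiv B e.symm fun i v hv => by
    have := he' i v hv
    rwa [show i - (d' - d) = i + (d - d') by ring] at this
  obtain rfl : j = j' := by omega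
  refine ⟨by ring, rfl, ?_⟩
  obtain ⟨c, h0, h1, -⟩ := B'.exists_eq_smul_of_isTriple hne (B.triple.map e.toLinearMap) (by
    have := (he _ _).1 (B.mem 1)
    rw [nfDeg_add_sub] at this
    exact this)
  have hc : c ≠ 0 := by
    rintro rfl
    rw [zero_smul] at h1
    exact B.b.ne_zero 1 (e.map_eq_zero_iff.1 h1)
  -- The first copy of L is scaled by c, so e maps the extension class of M to c times (lam, mu). By
  -- `coords_of_triple` this is also t times (lam', mu'), whence the two pairs are proportional.
  obtain ⟨-, -, t, -, ht1, ht2⟩ := B'.coords_of_triple (a := lam * c) (c := mu * c)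
    (e := e (B.b 3)) (g := e (B.b 4)) (h := e (B.b 5)) (by
      have := (he _ _).1 (B.mem 4)
      rw [nfDeg_add_sub] at this
      exact this) (by
      have hk : ∀ (c : k) v, e (c • v) = c • e v := fun c v => map_k_smul e.toLinearMap c v
      rw [← map_smul, B.rel_four, map_add, map_smul, map_smul, map_add, hk, hk]
      change _ = _ + _ • ((lam * c) • B'.b 0 + (mu * c) • B'.b 1)
      rw [mul_smul, mul_smul, ← h0, ← h1]
      rfl) (by rw [← map_smul, B.rel_three, map_smul])
  refine mul_right_cancel₀ hc ?_
  linear_combination mu' * ht1 - lam' * ht2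

end NormalForm

end GrMod

end NodalCone

/-! ### Failure of local freeness at the node. -/

namespace NodalCone

open MvPolynomial

/-- The denominators of a basis of the localization are cleared; its length is the rank of Q because
A is a domain. -/
theorem exists_generators_of_free_localizedModule {A Q : Type*} [CommRing A] [IsDomain A]
    [AddCommGroup Q] [Module A Q] [Module.Finite A Q] (p : Ideal A) [p.IsPrime]
    [Module.Free (Localization.AtPrime p) (LocalizedModule p.primeCompl Q)] :
    ∃ v : Fin (Module.finrank A Q) → Q,
      ∀ w, ∃ u ∉ p, u • w ∈ Submodule.span A (Set.range v) := by
  have hr : Module.finrank (Localization.AtPrime p) (LocalizedModule p.primeCompl Q)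
      = Module.finrank A Q := by
    rw [IsLocalization.finrank_eq (Localization.AtPrime p) p.primeCompl p.primeCompl_le_nonZeroDivisors,
      IsLocalizedModule.finrank_eq p.primeCompl (LocalizedModule.mkLinearMap p.primeCompl Q)
        p.primeCompl_le_nonZeroDivisors]
  let B := Module.finBasisOfFinrankEq _ _ hr
  let φ := LocalizedModule.mkLinearMap p.primeCompl Q
  choose vs hvs using fun i => IsLocalizedModule.surj p.primeCompl φ (B i)
  refine ⟨fun i => (vs i).1, fun w => ?_⟩
  set N := Submodule.span A (Set.range fun i => (vs i).1)
  have key : ∀ x ∈ Submodule.span (Localization.AtPrime p) (Set.range B),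
      ∃ u : p.primeCompl, u • x ∈ N.map φ := by
    intro x hx
    induction hx using Submodule.span_induction with
    | mem x hx =>
      obtain ⟨i, rfl⟩ := hx
      exact ⟨(vs i).2, hvs i ▸ Submodule.mem_map_of_mem (Submodule.subset_span ⟨i, rfl⟩)⟩
    | zero => exact ⟨1, by simp⟩
    | add x x' _ _ h h' =>
      obtain ⟨u, hu⟩ := h
      obtain ⟨u', hu'⟩ := h'
      refine ⟨u * u', ?_⟩
      rw [smul_add]
      refine add_mem ?_ ?_
      · rw [mul_comm, mul_smul]
        exact (N.map φ).smul_mem (u' : A) hu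
      · rw [mul_smul]
        exact (N.map φ).smul_mem (u : A) hu'
    | smul a x _ h =>
      obtain ⟨u, hu⟩ := h
      obtain ⟨⟨r, t⟩, hrt⟩ := IsLocalization.surj p.primeCompl a
      refine ⟨u * t, ?_⟩
      have : (u * t) • a • x = r • u • x := by
        have h1 : (t : A) • a • x = r • x := by
          rw [← algebraMap_smul (Localization.AtPrime p) (t : A), smul_smul, mul_comm, hrt,
            algebraMap_smul]
        change ((u * t : p.primeCompl) : A) • a • x = r • (u : A) • x
        rw [Submonoid.coe_mul, mul_smul, h1, smul_comm]
      rw [this]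
      exact (N.map φ).smul_mem _ hu
  obtain ⟨u, n, hn, hu⟩ := key (φ w) (by rw [B.span_eq]; trivial)
  change φ n = (u : A) • φ w at hu
  rw [← map_smul] at hu
  obtain ⟨c, hc⟩ := (IsLocalizedModule.eq_iff_exists p.primeCompl φ).1 hu
  refine ⟨c * u, (c * u).2, ?_⟩
  change (c : A) • n = (c : A) • (u : A) • w at hc
  rw [mul_smul, ← hc]
  exact N.smul_mem _ hn

section Line

variable {k : Type u} [Field k]

theorem ker_toLine : RingHom.ker (toLine k) = Ideal.span {y k 0, y k 1} := by
  have key : ∀ r : R k, r - Polynomial.aeval (y k 2) (toLine k r) ∈ Ideal.span {y k 0, y k 1} := by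
    intro r
    induction r using R_induction with
    | hC c => simp
    | hadd a b ha hb =>
      rw [map_add, map_add, add_sub_add_comm]
      exact add_mem ha hb
    | hmul a i ha =>
      rw [map_mul, map_mul]
      fin_cases i
      · simp only [toLine, Fin.zero_eta, lift_y, Matrix.cons_val_zero, map_zero, mul_zero, sub_zero]
        exact Ideal.mul_mem_left _ _ (Ideal.subset_span (by simp))
      · simp only [toLine, Fin.mk_one, lift_y, Matrix.cons_val_one, Matrix.cons_val_zero, map_zero,
          mul_zero, sub_zero]
        exact Ideal.mul_mem_left _ _ (Ideal.subset_span (by simp))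
      · have : toLine k (y k 2) = Polynomial.X := by simp [toLine]
        change a * y k 2 - _ * Polynomial.aeval _ (toLine k (y k 2)) ∈ _
        rw [this, Polynomial.aeval_X, ← sub_mul]
        exact Ideal.mul_mem_right _ _ ha
  refine le_antisymm (fun r hr => ?_) (Ideal.span_le.2 ?_)
  · have := key r
    rwa [RingHom.mem_ker.1 hr, map_zero, sub_zero] at this
  · rintro _ (rfl | rfl) <;> simp [toLine, RingHom.mem_ker]

theorem not_irrelevant_le_ker_toLine : ¬ irrelevant k ≤ RingHom.ker (toLine k) := fun h => by
  have := h (Ideal.subset_span ⟨2, rfl⟩)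
  simp [toLine, RingHom.mem_ker] at this

theorem ker_toLine_isHomogeneous : (RingHom.ker (toLine k)).IsHomogeneous (Rdeg k) := by
  rw [ker_toLine]
  refine Ideal.homogeneous_span _ _ ?_
  rintro _ (rfl | rfl)
  · exact ⟨1, y_mem k 0⟩
  · exact ⟨1, y_mem k 1⟩

/-- The restriction of `P → R` to the line `y₁ = y₂ = 0`. -/
noncomputable def restrictLine (k : Type u) [Field k] : P k →ₐ[k] Polynomial k :=
  aeval ![0, Polynomial.X]

end Line

namespace GrMod.NormalForm

variable {k : Type u} [Field k] {M M' : GrMod k}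
variable {d : ℤ} {j : ℕ} {lam s : k}

/-- The node is the prime (y₁, y₂). Restriction to the line y₁ = y₂ = 0 gives a semilinear map Ψ to
k[T]³ whose image contains the unit vectors. Freeness at the node would give two elements that
generate all of M up to factors that do not vanish on this line, too few for rank three. -/
theorem not_isLocallyFree (B : NormalForm M d j lam (s * lam)) (hs : s * s = 1) :
    ¬ M.IsLocallyFree := by
  intro hLF
  have hp : (RingHom.ker (toLine k)).IsPrime := RingHom.ker_isPrime _
  have := hLF _ ker_toLine_isHomogeneous not_irrelevant_le_ker_toLine
  have : Module.Finite (R k) M.carrier := finite_of_basis B.b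
  obtain ⟨v, hv⟩ := exists_generators_of_free_localizedModule (Q := M.carrier)
    (RingHom.ker (toLine k))
  -- Ψ must kill y₁M. At y₂ = 0 coordinates 0 and 1 of y₁w are y₃^(j+1) times lam w₄ - mu w₅ and mu
  -- w₄ - lam w₅. For mu = s lam and s² = 1 the second is s times the first. Coordinates 3 and 4 of
  -- y₁w are multiples of y₂.
  let Ψ : M.carrier → Fin 3 → Polynomial k := fun w =>
    ![restrictLine k (B.b.repr w 1 - C s * B.b.repr w 0), restrictLine k (B.b.repr w 3),
      restrictLine k (B.b.repr w 4)]
  have hadd : ∀ w w', Ψ (w + w') = Ψ w + Ψ w' := fun w w' => by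
    ext1 l
    fin_cases l <;> simp [Ψ] ; ring
  have hΨ : ∀ (r : R k) w, Ψ (r • w) = toLine k r • Ψ w := by
    intro r
    induction r using R_induction with
    | hC c =>
      intro w
      change Ψ (c • w) = _
      ext1 l
      fin_cases l <;> simp [Ψ, repr_k_smul, restrictLine] <;> ring
    | hadd a b ha hb => intro w; rw [add_smul, hadd, ha, hb, map_add, add_smul]
    | hmul a i ha =>
      intro w
      rw [mul_smul, ha, map_mul, mul_smul]
      congr 1
      fin_cases i
      · ext1 l
        fin_cases l
        · simp [Ψ, B.repr_smul, restrictLine, toLine]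
          have hC : Polynomial.C s * Polynomial.C s = 1 := by rw [← Polynomial.C_mul, hs, map_one]
          linear_combination (Polynomial.X ^ (j + 1) * Polynomial.C lam *
            aeval ![0, Polynomial.X] (B.b.repr w 5)) * hC
        · simp [Ψ, B.repr_smul, restrictLine, toLine]
        · simp [Ψ, B.repr_smul, restrictLine, toLine]
      · ext1 l
        fin_cases l <;> simp [Ψ, repr_y_one_smul, restrictLine, toLine]
      · ext1 l
        fin_cases l <;> simp [Ψ, repr_y_two_smul, restrictLine, toLine] <;> ring
  set N := Submodule.span (Polynomial k) (Set.range fun i => Ψ (v i))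
  have hN : ∀ w ∈ Submodule.span (R k) (Set.range v), Ψ w ∈ N := fun w hw => by
    induction hw using Submodule.span_induction with
    | mem w hw =>
      obtain ⟨i, rfl⟩ := hw
      exact Submodule.subset_span ⟨i, rfl⟩
    | zero =>
      have := hΨ 0 0
      rw [smul_zero, map_zero, zero_smul] at this
      rw [this]
      exact zero_mem _
    | add w w' _ _ h h' => rw [hadd]; exact add_mem h h'
    | smul r w _ h => rw [hΨ]; exact N.smul_mem _ h
  have hw : ∀ l, Ψ (B.b (![1, 3, 4] l)) = Pi.single l 1 := fun l => by
    ext1 l'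
    fin_cases l <;> fin_cases l' <;> simp [Ψ]
  choose c hc0 hc using fun l => hv (B.b (![1, 3, 4] l))
  have hcN : ∀ l, toLine k (c l) • (Pi.single l 1 : Fin 3 → Polynomial k) ∈ N := fun l => by
    rw [← hw, ← hΨ]
    exact hN _ (hc l)
  have hli : LinearIndependent (Polynomial k)
      fun l => (⟨toLine k (c l) • Pi.single l 1, hcN l⟩ : N) := by
    refine LinearIndependent.of_comp N.subtype ?_
    rw [Fintype.linearIndependent_iff]
    intro a ha l
    have := congrFun ha l
    simp only [Function.comp_apply, Submodule.subtype_apply, Finset.sum_apply, Pi.smul_apply,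
      smul_eq_mul, Pi.zero_apply] at this
    rw [Finset.sum_eq_single l (fun l' _ h => by rw [Pi.single_eq_of_ne h.symm]; simp)
      (by simp), Pi.single_eq_same, mul_one] at this
    exact (mul_eq_zero.1 this).resolve_right (hc0 l)
  have h1 := hli.fintype_card_le_finrank
  have h2 : Module.finrank (Polynomial k) N ≤ Module.finrank (R k) M.carrier := by
    have := finrank_range_le_card (R := Polynomial k) fun i => Ψ (v i)
    rwa [Fintype.card_fin] at this
  have h3 : Module.finrank (R k) M.carrier = 2 := B.rank_eq
  rw [Fintype.card_fin] at h1
  omega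

theorem isSixGenerated (B : NormalForm M d j lam (s * lam)) (hs : s * s = 1) (hlam : lam ≠ 0) :
    M.IsSixGenerated :=
  ⟨B.isMCM, B.isIndecomposable (Or.inl hlam), B.rank_eq, B.not_isLocallyFree hs, B.minGens_eq⟩

end GrMod.NormalForm

/-! ### Cokernels by generators and relations. -/

section Cokernels

namespace GrMod

variable {k : Type u} [Field k] {M : GrMod k} {d : ℤ} {j : ℕ} {lam mu : k}

/-- Generators of `M` that satisfy the relations of the normal form are a basis over `P`. -/
theorem exists_normalForm (hr : 2 ≤ M.rank) (v : Fin 6 → M.carrier)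
    (hspan : ⊤ ≤ Submodule.span (R k) (Set.range v)) (mem : ∀ i, v i ∈ M.deg (nfDeg d j i))
    (triple : IsTriple k (v 0) (v 1) (v 2)) (rel_three : y k 0 • v 3 = y k 2 • v 5)
    (rel_four : y k 0 • v 4 = y k 1 • v 3 + y k 2 ^ (j + 1) • (lam • v 0 + mu • v 1))
    (rel_five : y k 0 • v 5 = y k 1 • v 4 - y k 2 • v 5
      - y k 2 ^ (j + 1) • (lam • v 1 + mu • (v 2 + v 0))) :
    ∃ B : NormalForm M d j lam mu, ∀ i, B.b i = v i := by
  have : Module.Finite (R k) M.carrier :=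
    ⟨⟨(Set.finite_range v).toFinset, by simpa using top_le_iff.1 hspan⟩⟩
  set N := Submodule.span (P k) (Set.range v)
  have hv : ∀ i, v i ∈ N := fun i => Submodule.subset_span ⟨i, rfl⟩
  have h1 : ∀ w ∈ N, y k 1 • w ∈ N := fun w hw => by
    rw [← X_zero_smul]; exact N.smul_mem _ hw
  have h2 : ∀ w ∈ N, y k 2 • w ∈ N := fun w hw => by
    rw [← X_one_smul]; exact N.smul_mem _ hw
  have h2' : ∀ w ∈ N, y k 2 ^ (j + 1) • w ∈ N := fun w hw => by
    rw [← algebraMap_X_one, ← map_pow, algebraMap_smul]; exact N.smul_mem _ hw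
  have hk : ∀ (c : k), ∀ w ∈ N, c • w ∈ N := fun c w hw => by
    rw [← algebraMap_smul (P k) c w]; exact N.smul_mem _ hw
  -- The relations make the P-span of v stable under y₁, so it is all of M. Six generators of a
  -- module of P-rank at least 6 are a basis.
  have h0 : ∀ w ∈ N, y k 0 • w ∈ N := fun w hw => by
    induction hw using Submodule.span_induction with
    | mem w hw =>
      obtain ⟨i, rfl⟩ := hw
      fin_cases i
      · exact triple.rel_e ▸ h2 _ (hv 2)
      · exact triple.rel_g ▸ h1 _ (hv 0)
      · exact triple.rel_h ▸ sub_mem (h1 _ (hv 1)) (h2 _ (hv 2))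
      · exact rel_three ▸ h2 _ (hv 5)
      · exact rel_four ▸ add_mem (h1 _ (hv 3)) (h2' _ (add_mem (hk _ _ (hv 0)) (hk _ _ (hv 1))))
      · exact rel_five ▸ sub_mem (sub_mem (h1 _ (hv 4)) (h2 _ (hv 5)))
          (h2' _ (add_mem (hk _ _ (hv 1)) (hk _ _ (add_mem (hv 2) (hv 0)))))
    | zero => rw [smul_zero]; exact zero_mem _
    | add w w' _ _ h h' => rw [smul_add]; exact add_mem h h'
    | smul p w _ h => rw [smul_comm]; exact N.smul_mem _ h
  have htop : ⊤ ≤ N := by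
    rintro w -
    have hw := hspan (Submodule.mem_top (x := w))
    induction hw using Submodule.span_induction with
    | mem w hw => exact Submodule.subset_span hw
    | zero => exact zero_mem _
    | add w w' _ _ h h' => exact add_mem h h'
    | smul r w _ h =>
      revert w
      induction r using R_induction with
      | hC c => exact fun w _ h => hk c w h
      | hadd a b ha hb => exact fun w hw h => by rw [add_smul]; exact add_mem (ha w hw h) (hb w hw h)
      | hmul a i ha =>
        intro w hw h
        rw [mul_smul]
        refine ha _ (Submodule.smul_mem _ _ hw) ?_
        fin_cases i
        · exact h0 w h
        · exact h1 w h
        · exact h2 w h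
  have hli : LinearIndependent (P k) v := linearIndependent_of_top_le_span_of_card_le_finrank htop (by
    rw [finrank_P_eq, Fintype.card_fin]
    change 6 ≤ 3 * M.rank
    omega)
  have hb : ∀ i, Module.Basis.mk hli htop i = v i := Module.Basis.mk_apply hli htop
  exact ⟨⟨Module.Basis.mk hli htop, by simpa only [hb] using mem, by simpa only [hb] using triple,
    by simpa only [hb] using rel_three, by simpa only [hb] using rel_four,
    by simpa only [hb] using rel_five⟩, hb⟩

end GrMod

variable {k : Type u} [Field k] {n : ℕ} (A : Matrix (Fin n) (Fin n) (R k)) (d c : Fin n → ℤ)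
  (hA : IsGradedMatrix A d c)

/-- The generators of a cokernel. -/
noncomputable def cokerGen (i : Fin n) : (coker A d c hA).carrier :=
  Submodule.Quotient.mk (Pi.single i 1)

theorem cokerGen_mem (i : Fin n) : cokerGen A d c hA i ∈ (coker A d c hA).deg (d i) := by
  refine ⟨Pi.single i 1, mem_freeDeg.2 fun r => ?_, rfl⟩
  by_cases h : r = i
  · subst h
    rw [Pi.single_eq_same, sub_self]
    exact one_mem_Rdeg k
  · rw [Pi.single_eq_of_ne h]
    exact zero_mem _

theorem mk_eq_sum_cokerGen (v : Fin n → R k) :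
    (Submodule.Quotient.mk v : (coker A d c hA).carrier) = ∑ i, v i • cokerGen A d c hA i := by
  conv_lhs => rw [pi_eq_sum_univ' v]
  exact map_sum (LinearMap.range A.mulVecLin).mkQ _ _

theorem coker_relation (l : Fin n) : ∑ i, A i l • cokerGen A d c hA i = 0 := by
  rw [← mk_eq_sum_cokerGen A d c hA fun i => A i l]
  refine (Submodule.Quotient.mk_eq_zero _).2 ⟨Pi.single l 1, ?_⟩
  exact Matrix.mulVec_single_one A l

theorem span_cokerGen : ⊤ ≤ Submodule.span (R k) (Set.range (cokerGen A d c hA)) := by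
  intro w _
  obtain ⟨v, rfl⟩ := Submodule.Quotient.mk_surjective _ w
  rw [mk_eq_sum_cokerGen A d c hA]
  exact Submodule.sum_mem _ fun i _ => Submodule.smul_mem _ _ (Submodule.subset_span ⟨i, rfl⟩)

theorem exists_coker_functional (a : Fin n → R k) (ha : ∀ l, ∑ i, a i * A i l = 0) :
    ∃ φ : (coker A d c hA).carrier →ₗ[R k] R k, ∀ i, φ (cokerGen A d c hA i) = a i := by
  refine ⟨(LinearMap.range A.mulVecLin).liftQ (Fintype.linearCombination (R k) a) ?_, fun i => ?_⟩
  · rintro _ ⟨v, rfl⟩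
    rw [LinearMap.mem_ker, Fintype.linearCombination_apply]
    simp only [Matrix.mulVecLin_apply, Matrix.mulVec, dotProduct, smul_eq_mul, Finset.sum_mul]
    rw [Finset.sum_comm]
    refine Finset.sum_eq_zero fun l _ => ?_
    have := congrArg (v l * ·) (ha l)
    simp only [mul_zero, Finset.mul_sum] at this
    rw [← this]
    exact Finset.sum_congr rfl fun i _ => by ring
  · refine (Submodule.liftQ_apply _ _ _).trans ?_
    simp [Fintype.linearCombination_apply_single]

end Cokernels

end NodalCone

/-! ### The normal forms of the cokernels of δ_m and of its transpose. -/

namespace NodalCone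

open MvPolynomial

section Cokernels

variable (k : Type u) [Field k]

theorem y_ne_zero_two : y k 2 ≠ 0 := by
  rw [← algebraMap_X_one, ne_eq, FaithfulSMul.algebraMap_eq_zero_iff]
  exact P_X_ne_zero 1

theorem y_ne_zero_zero : y k 0 ≠ 0 := fun h => by
  have h1 := relation k
  rw [h, ← algebraMap_X_one, ← algebraMap_X_zero] at h1
  have h2 : algebraMap (P k) (R k) (X 0 ^ 2 * X 1) = 0 := by
    rw [map_mul, map_pow]
    linear_combination -h1
  rw [FaithfulSMul.algebraMap_eq_zero_iff] at h2
  simp at h2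

theorem two_le_rank_of_functionals {k : Type u} [Field k] {M : GrMod k} (hf : Module.Finite (R k) M.carrier)
    (φ ψ : M.carrier →ₗ[R k] R k) {v w : M.carrier} (h1 : φ v ≠ 0) (h2 : φ w = 0) (h3 : ψ w ≠ 0) :
    2 ≤ M.rank := by
  have hli : LinearIndependent (R k) ![v, w] := by
    rw [LinearIndependent.pair_iff]
    intro s t h
    have hs : s = 0 := by
      have := congrArg φ h
      rw [map_add, map_smul, map_smul, h2, smul_zero, add_zero, map_zero] at this
      exact (mul_eq_zero.1 this).resolve_right h1
    have h' : t • w = 0 := by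
      rw [hs] at h
      linear_combination (norm := module) h
    have := congrArg ψ h'
    rw [map_smul, map_zero] at this
    exact ⟨hs, (mul_eq_zero.1 this).resolve_right h3⟩
  have := hli.fintype_card_le_finrank
  rwa [Fintype.card_fin] at this

theorem coker_finite {k : Type u} [Field k] {n : ℕ} (A : Matrix (Fin n) (Fin n) (R k)) (d c : Fin n → ℤ)
    (hA : IsGradedMatrix A d c) : Module.Finite (R k) (coker A d c hA).carrier :=
  inferInstanceAs (Module.Finite (R k) ((Fin n → R k) ⧸ LinearMap.range A.mulVecLin))

theorem exists_coker_generators {k : Type u} [Field k] {n : ℕ} (A : Matrix (Fin n) (Fin n) (R k))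
    (d c : Fin n → ℤ) (hA : IsGradedMatrix A d c) : ∃ f : Fin n → (coker A d c hA).carrier,
      (∀ i, f i ∈ (coker A d c hA).deg (d i)) ∧ ⊤ ≤ Submodule.span (R k) (Set.range f) ∧
      (∀ l, ∑ i, A i l • f i = 0) ∧ ∀ a : Fin n → R k, (∀ l, ∑ i, a i * A i l = 0) →
        ∃ φ : (coker A d c hA).carrier →ₗ[R k] R k, ∀ i, φ (f i) = a i :=
  ⟨cokerGen A d c hA, cokerGen_mem A d c hA, span_cokerGen A d c hA, coker_relation A d c hA,
    exists_coker_functional A d c hA⟩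

theorem exists_normalForm_cokerDelta (j : ℕ) :
    Nonempty (GrMod.NormalForm (cokerDelta k (j + 1)) 1 j 1 (-1)) := by
  obtain ⟨f, hmem, hspan, hrel, hfun⟩ : ∃ f : Fin 6 → (cokerDelta k (j + 1)).carrier,
      (∀ i, f i ∈ (cokerDelta k (j + 1)).deg (rowDeg (j + 1) i)) ∧
      ⊤ ≤ Submodule.span (R k) (Set.range f) ∧ (∀ l, ∑ i, delta k (j + 1) i l • f i = 0) ∧
      ∀ a : Fin 6 → R k, (∀ l, ∑ i, a i * delta k (j + 1) i l = 0) →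
        ∃ φ : (cokerDelta k (j + 1)).carrier →ₗ[R k] R k, ∀ i, φ (f i) = a i :=
    exists_coker_generators _ _ _ _
  have hr : 2 ≤ (cokerDelta k (j + 1)).rank := by
    -- The diagonal blocks have determinant f. The entries of φ are, up to sign, the last row of the
    -- adjugate of a block, which annihilates the block over R. For ψ this row is multiplied by y₁
    -- and completed so as to annihilate the last three columns as well.
    obtain ⟨φ, hφ⟩ := hfun ![0, 0, 0, y k 1 * y k 2, -(y k 0 * y k 2), y k 0 ^ 2] (by
      intro l
      fin_cases l <;> simp [delta, Fin.sum_univ_six] <;>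
        first | ring1 | linear_combination -relation k)
    obtain ⟨ψ, hψ⟩ := hfun ![y k 0 * y k 1 * y k 2, -(y k 0 ^ 2 * y k 2), y k 0 ^ 3,
        y k 2 ^ (j + 2) * (y k 0 - y k 1), 0, 0] (by
      intro l
      fin_cases l <;> simp [delta, Fin.sum_univ_six] <;>
        first | ring1 | linear_combination (-y k 0) * relation k | linear_combination (y k 2 ^ (j + 1)) * relation k)
    refine two_le_rank_of_functionals (coker_finite _ _ _ _) φ ψ (v := f 4) (w := f 1) ?_ ?_ ?_
    · rw [hφ]; simp [y_ne_zero_two, y_ne_zero_zero]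
    · rw [hφ]; simp
    · rw [hψ]; simp [y_ne_zero_two, y_ne_zero_zero]
  have h1 := hrel 0
  have h2 := hrel 1
  have h3 := hrel 2
  have h4 := hrel 3
  have h5 := hrel 4
  have h6 := hrel 5
  simp [delta, Fin.sum_univ_six] at h1 h2 h3 h4 h5 h6
  -- In these generators each column of δ_m is, up to sign, one relation of the normal form.
  refine (GrMod.exists_normalForm (lam := 1) (mu := -1) (d := 1) (j := j) hr
    ![-f 1, f 0, f 2, -f 4, f 3, f 5] ?_ ?_ ⟨?_, ?_, ?_⟩ ?_ ?_ ?_).nonempty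
  · refine hspan.trans (Submodule.span_le.2 ?_)
    have hv := fun i => Submodule.subset_span (R := R k) (Set.mem_range_self
      (f := ![-f 1, f 0, f 2, -f 4, f 3, f 5]) i)
    rintro _ ⟨i, rfl⟩
    fin_cases i
    · exact hv 1
    · exact neg_mem_iff.1 (hv 0)
    · exact hv 2
    · exact hv 4
    · exact neg_mem_iff.1 (hv 3)
    · exact hv 5
  · have e : (1 : ℤ) + j = j + 1 := add_comm _ _
    have m0 := hmem 0
    have m1 := hmem 1
    have m2 := hmem 2
    have m3 := hmem 3
    have m4 := hmem 4
    have m5 := hmem 5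
    simp [rowDeg] at m0 m1 m2 m3 m4 m5
    intro i
    fin_cases i <;> simp [GrMod.nfDeg, *]
  · simp
    linear_combination (norm := module) -h1
  · simp
    linear_combination (norm := module) h2
  · simp
    linear_combination (norm := module) -h3
  · simp
    linear_combination (norm := module) -h4
  · simp
    linear_combination (norm := module) h5
  · simp
    linear_combination (norm := module) -h6

theorem exists_normalForm_cokerDeltaT (j : ℕ) :
    Nonempty (GrMod.NormalForm (cokerDeltaT k (j + 1)) 1 j (-1) (-1)) := by
  obtain ⟨f, hmem, hspan, hrel, hfun⟩ : ∃ f : Fin 6 → (cokerDeltaT k (j + 1)).carrier,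
      (∀ i, f i ∈ (cokerDeltaT k (j + 1)).deg ((j + 1 : ℕ) + 2 - colDeg (j + 1) i)) ∧
      ⊤ ≤ Submodule.span (R k) (Set.range f) ∧ (∀ l, ∑ i, delta k (j + 1) l i • f i = 0) ∧
      ∀ a : Fin 6 → R k, (∀ l, ∑ i, a i * delta k (j + 1) l i = 0) →
        ∃ φ : (cokerDeltaT k (j + 1)).carrier →ₗ[R k] R k, ∀ i, φ (f i) = a i :=
    exists_coker_generators _ _ _ _
  have hr : 2 ≤ (cokerDeltaT k (j + 1)).rank := by
    -- Here the second column of the adjugate of a diagonal block is used, and y₁ times it for ψ,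
    -- again with a completion.
    obtain ⟨φ, hφ⟩ := hfun ![y k 0 ^ 2 + y k 0 * y k 2, -(y k 1 * y k 2), y k 0 * y k 2, 0, 0, 0] (by
      intro l
      fin_cases l <;> simp [delta, Fin.sum_univ_six] <;>
        first | ring1 | linear_combination relation k)
    obtain ⟨ψ, hψ⟩ := hfun ![-(y k 2 ^ (j + 1) * y k 0 ^ 2), y k 2 ^ (j + 2) * (y k 0 + y k 1), 0,
        y k 0 ^ 3 + y k 0 ^ 2 * y k 2, -(y k 0 * y k 1 * y k 2), y k 0 ^ 2 * y k 2] (by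
      intro l
      fin_cases l <;> simp [delta, Fin.sum_univ_six] <;>
        first | ring1 | linear_combination (y k 0) * relation k | linear_combination (-y k 2 ^ (j + 1)) * relation k)
    refine two_le_rank_of_functionals (coker_finite _ _ _ _) φ ψ (v := f 2) (w := f 5) ?_ ?_ ?_
    · rw [hφ]; simp [y_ne_zero_two, y_ne_zero_zero]
    · rw [hφ]; simp
    · rw [hψ]; simp [y_ne_zero_two, y_ne_zero_zero]
  have h1 := hrel 0
  have h2 := hrel 1
  have h3 := hrel 2
  have h4 := hrel 3
  have h5 := hrel 4
  have h6 := hrel 5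
  simp [delta, Fin.sum_univ_six] at h1 h2 h3 h4 h5 h6
  -- After transposition the generators f 3, f 4, f 5 of degree 1 span the first copy of L. The term
  -- y₃^j f 5 absorbs the entry y₃^m in the third row of δ_m, so that y₁ f 2 becomes a multiple of
  -- y₃ as required.
  refine (GrMod.exists_normalForm (lam := -1) (mu := -1) (d := 1) (j := j) hr
    ![f 5, -f 4, f 3 - f 5, f 2, -f 1, f 0 - f 2 + y k 2 ^ j • f 5] ?_ ?_ ⟨?_, ?_, ?_⟩ ?_ ?_ ?_).nonempty
  · refine hspan.trans (Submodule.span_le.2 ?_)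
    have hv := fun i => Submodule.subset_span (R := R k) (Set.mem_range_self
      (f := ![f 5, -f 4, f 3 - f 5, f 2, -f 1, f 0 - f 2 + y k 2 ^ j • f 5]) i)
    rintro _ ⟨i, rfl⟩
    fin_cases i
    · have := sub_mem (add_mem (hv 5) (hv 3)) (Submodule.smul_mem _ (y k 2 ^ j) (hv 0))
      have e : f 0 - f 2 + y k 2 ^ j • f 5 + f 2 - y k 2 ^ j • f 5 = f 0 := by abel
      exact (congrArg (· ∈ _) e).mp this
    · exact neg_mem_iff.1 (hv 4)
    · exact hv 3
    · have := add_mem (hv 2) (hv 0)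
      exact (congrArg (· ∈ _) (sub_add_cancel (f 3) (f 5))).mp this
    · exact neg_mem_iff.1 (hv 1)
    · exact hv 0
  · have e : (j : ℤ) + 1 + 2 - 2 = 1 + j := by ring
    have e' : (j : ℤ) + 1 + 2 - (j + 1 + 1) = 1 := by ring
    have m0 := hmem 0
    have m1 := hmem 1
    have m2 := hmem 2
    have m3 := hmem 3
    have m4 := hmem 4
    have m5 := hmem 5
    simp [colDeg, e, e'] at m0 m1 m2 m3 m4 m5
    intro i
    fin_cases i
    · simpa [GrMod.nfDeg]
    · simpa [GrMod.nfDeg]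
    · simpa [GrMod.nfDeg] using sub_mem m3 m5
    · simpa [GrMod.nfDeg]
    · simpa [GrMod.nfDeg]
    · simpa [GrMod.nfDeg] using add_mem (sub_mem m0 m2) (GrMod.y_pow_smul_mem 2 j m5)
  · simp
    linear_combination (norm := module) -h6
  · simp
    linear_combination (norm := module) -h4
  · simp
    linear_combination (norm := module) h5 + h6
  · simp
    linear_combination (norm := module) -h3
  · simp
    linear_combination (norm := module) -h1
  · simp
    linear_combination (norm := module) h2 + h3 - y k 2 ^ j • h6

end Cokernels

end NodalCone

/-! ### Minimal bases and their fibres at the points (0, 1) and (1, 0). -/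

namespace NodalCone

open MvPolynomial

namespace GrMod

variable {k : Type u} [Field k] {M : GrMod k}

/-- A homogeneous basis of `M` over `P` that is also a minimal system of generators over `R`. -/
structure MinimalBasis (M : GrMod k) where
  /-- The basis. -/
  b : Module.Basis (Fin 6) (P k) M.carrier
  /-- The degrees. -/
  d : Fin 6 → ℤ
  mem : ∀ i, b i ∈ M.deg (d i)
  const : ∀ i, constCoord b (y k 0 • b i) = 0

/-- Minimal homogeneous generators over P form a basis, which has 3 · 2 elements. A nonzero constant
coefficient in some y₁bᵢ would make one of them redundant over R and leave five generators. -/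
theorem exists_minimalBasis (hM : M.IsMCM) (hr : M.rank = 2) (hg : M.minGens = 6) :
    Nonempty (MinimalBasis M) := by
  have := hM.1
  obtain ⟨n, b, d, hb, hs, hmin⟩ := exists_minimal_generators (M := M)
  have hli := linearIndependent_of_regular (isRegularPair_of_isMCM hM) hmin
  have hn : n = 6 := by
    have h1 := Module.finrank_eq_card_basis (Module.Basis.mk hli hs.ge)
    rw [finrank_P_eq, Fintype.card_fin] at h1
    change 3 * M.rank = n at h1
    omega
  subst hn
  let B := Module.Basis.mk hli hs.ge
  have hB : ∀ i, B i = b i := Module.Basis.mk_apply hli hs.ge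
  refine ⟨⟨B, d, fun i => hB i ▸ hb i, fun i => ?_⟩⟩
  by_contra hne
  obtain ⟨l, hl⟩ := Function.ne_iff.1 hne
  choose q r hqr using fun l => P_decomp (B.repr (y k 0 • B i) l)
  have h1 : ∑ l, constCoord B (y k 0 • B i) l • b l
      = y k 0 • b i + y k 1 • (-∑ l, q l • b l) + y k 2 • (-∑ l, r l • b l) := by
    have h2 : y k 0 • b i = ∑ l, (C (constCoord B (y k 0 • B i) l) + X 0 * q l + X 1 * r l : P k) • b l := by
      rw [← hB i]
      conv_lhs => rw [← B.sum_repr (y k 0 • B i)]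
      refine Finset.sum_congr rfl fun l _ => ?_
      rw [hB l]
      exact congrArg (· • b l) (hqr l)
    rw [h2, smul_neg, smul_neg, Finset.smul_sum, Finset.smul_sum]
    simp only [add_smul, Finset.sum_add_distrib, mul_smul, X_zero_smul, X_one_smul]
    have h3 : ∀ (c : k) (w : M.carrier), (C c : P k) • w = c • w := fun c w =>
      algebraMap_smul (P k) c w
    simp only [h3]
    abel
  have h4 := mem_span_compl_R hb hs hl h1
  have h5 : (⊤ : Submodule (R k) M.carrier) = Submodule.span (R k) (b '' {l}ᶜ) := by
    refine (top_le_iff.1 ?_).symm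
    have h6 : (⊤ : Submodule (P k) M.carrier)
        ≤ (Submodule.span (R k) (b '' {l}ᶜ)).restrictScalars (P k) := by
      rw [← hs, Submodule.span_le]
      rintro _ ⟨l', rfl⟩
      by_cases h : l' = l
      · rw [h]; exact h4
      · exact Submodule.subset_span ⟨l', h, rfl⟩
    exact fun v _ => h6 (Submodule.mem_top (x := v))
  have h7 := Submodule.spanFinrank_span_le_ncard_of_finite (R := R k) (s := b '' {l}ᶜ)
    (Set.toFinite _)
  rw [← h5] at h7
  have h8 : (b '' {l}ᶜ).ncard ≤ ({l}ᶜ : Set (Fin 6)).ncard := Set.ncard_image_le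
  rw [Set.ncard_compl, Set.ncard_singleton, Nat.card_eq_fintype_card, Fintype.card_fin] at h8
  change M.minGens ≤ _ at h7
  omega

namespace MinimalBasis

variable (B : MinimalBasis M)

/-- The values of the coordinates at a point. -/
noncomputable def eval (pt : Fin 2 → k) : M.carrier →ₗ[k] (Fin 6 → k) where
  toFun v i := MvPolynomial.eval pt (B.b.repr v i)
  map_add' v w := by ext; simp
  map_smul' c v := by ext; simp [repr_k_smul]

theorem eval_apply (pt : Fin 2 → k) (v : M.carrier) (i : Fin 6) :
    B.eval pt v i = MvPolynomial.eval pt (B.b.repr v i) := rfl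

theorem eval_P_smul (pt : Fin 2 → k) (p : P k) (v : M.carrier) :
    B.eval pt (p • v) = MvPolynomial.eval pt p • B.eval pt v := by
  ext; simp [eval_apply]

theorem eval_y_one_smul (pt : Fin 2 → k) (v : M.carrier) :
    B.eval pt (y k 1 • v) = pt 0 • B.eval pt v := by
  rw [← X_zero_smul, eval_P_smul, eval_X]

theorem eval_y_two_smul (pt : Fin 2 → k) (v : M.carrier) :
    B.eval pt (y k 2 • v) = pt 1 • B.eval pt v := by
  rw [← X_one_smul, eval_P_smul, eval_X]

theorem eval_b (pt : Fin 2 → k) (i : Fin 6) : B.eval pt (B.b i) = Pi.single i 1 := by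
  ext l
  rw [eval_apply, B.b.repr_self, Finsupp.single_apply, Pi.single_apply]
  simp only [eq_comm (a := i)]
  split_ifs <;> simp

/-- Multiplication by `y₁` on the fibre at a point. -/
noncomputable def op (pt : Fin 2 → k) : (Fin 6 → k) →ₗ[k] (Fin 6 → k) :=
  Fintype.linearCombination k fun i => B.eval pt (y k 0 • B.b i)

theorem eval_smul (pt : Fin 2 → k) (v : M.carrier) :
    B.eval pt (y k 0 • v) = B.op pt (B.eval pt v) := by
  conv_lhs => rw [← B.b.sum_repr v, Finset.smul_sum, map_sum]
  rw [op, Fintype.linearCombination_apply]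
  refine Finset.sum_congr rfl fun i _ => ?_
  rw [smul_comm, eval_P_smul]
  rfl

theorem mem_gspan {D : ℤ} {v : M.carrier} (hv : v ∈ M.deg D) : v ∈ gspan B.b B.d D :=
  GrMod.mem_gspan B.mem B.b.span_eq hv

/-- The coordinate vectors that are supported on the generators of degree at most `D`. -/
def filt (D : ℤ) : Submodule k (Fin 6 → k) where
  carrier := {c | ∀ i, D < B.d i → c i = 0}
  add_mem' hv hw i hi := by simp [hv i hi, hw i hi]
  zero_mem' := by simp
  smul_mem' c v hv i hi := by simp [hv i hi]

theorem eval_mem_filt (pt : Fin 2 → k) {D : ℤ} {v : M.carrier} (hv : v ∈ M.deg D) :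
    B.eval pt v ∈ B.filt D := fun i hi => by
  rw [eval_apply, repr_eq_zero B.b B.mem hv hi, map_zero]

theorem exists_of_const_eq_zero {D : ℤ} {v : M.carrier} (hv : v ∈ M.deg (D + 1))
    (h0 : constCoord B.b v = 0) :
    ∃ v' ∈ M.deg D, ∃ v'' ∈ M.deg D, v = y k 1 • v' + y k 2 • v'' := by
  obtain ⟨c, -, w, hw, w', hw', h⟩ := exists_of_mem_gspan (B.mem_gspan hv)
  have hc : c = 0 := by
    have := congrArg (constCoord B.b) h
    rw [h0, map_add, map_add, ← X_zero_smul, ← X_one_smul, constCoord_P_smul,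
      constCoord_P_smul, constantCoeff_X, constantCoeff_X, zero_smul, zero_smul, add_zero,
      add_zero, map_sum] at this
    rw [this]
    ext l
    rw [Finset.sum_apply, Finset.sum_eq_single l]
    · simp [constCoord, repr_k_smul]
    · intro l' _ hl
      simp [constCoord, repr_k_smul, Finsupp.single_eq_of_ne hl.symm]
    · simp
  rw [add_sub_cancel_right] at hw hw'
  refine ⟨w, gspan_le_degSub B.mem _ hw, w', gspan_le_degSub B.mem _ hw', ?_⟩
  rw [h, hc]
  simp

/-- The matrix of y₁ has no constant entries, so the degree gained by multiplying with y₁ is carried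
by a factor y₂ or y₃. -/
theorem exists_smul_eq (B : MinimalBasis M) {D : ℤ} {v : M.carrier} (hv : v ∈ M.deg D) :
    ∃ v' ∈ M.deg D, ∃ v'' ∈ M.deg D, y k 0 • v = y k 1 • v' + y k 2 • v'' := by
  have hb := fun i => B.exists_of_const_eq_zero (y_smul_mem 0 (B.mem i)) (B.const i)
  have hv' := B.mem_gspan hv
  clear hv
  induction hv' using Submodule.span_induction with
  | mem v hv =>
    obtain ⟨l, m, n, h, rfl⟩ := hv
    obtain ⟨v', hv', v'', hv'', h'⟩ := hb l
    have hdeg : ∀ w ∈ M.deg (B.d l), y k 1 ^ m • y k 2 ^ n • w ∈ M.deg D := fun w hw => by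
      have := y_pow_smul_mem 1 m (y_pow_smul_mem 2 n hw)
      rwa [show B.d l + n + m = D by omega] at this
    refine ⟨_, hdeg _ hv', _, hdeg _ hv'', ?_⟩
    rw [smul_comm (y k 0), smul_comm (y k 0), h', smul_add, smul_add]
    simp only [smul_comm (y k 1) (y k 1 ^ m), smul_comm (y k 1) (y k 2 ^ n),
      smul_comm (y k 2) (y k 1 ^ m), smul_comm (y k 2) (y k 2 ^ n)]
  | zero => exact ⟨0, zero_mem _, 0, zero_mem _, by simp⟩
  | add v w _ _ hv hw =>
    obtain ⟨a, ha, a', ha', e⟩ := hv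
    obtain ⟨c, hc, c', hc', e'⟩ := hw
    refine ⟨a + c, add_mem ha hc, a' + c', add_mem ha' hc', ?_⟩
    rw [smul_add, e, e']
    module
  | smul t v _ hv =>
    obtain ⟨a, ha, a', ha', e⟩ := hv
    refine ⟨t • a, k_smul_mem t ha, t • a', k_smul_mem t ha', ?_⟩
    rw [smul_comm, e, smul_add, smul_comm (y k 1), smul_comm (y k 2)]

/-- Modulo y₂ a coordinate of a homogeneous element is a monomial in y₃, and its coefficient is the
value at (0, 1). -/
theorem exists_eq_y_one {D : ℤ} {v : M.carrier} (hv : v ∈ M.deg D) :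
    ∃ v' ∈ M.deg (D - 1), v = y k 1 • v'
      + ∑ i, B.eval ![0, 1] v i • y k 2 ^ (D - B.d i).toNat • B.b i := by
  have hv' := B.mem_gspan hv
  clear hv
  induction hv' using Submodule.span_induction with
  | mem v hv =>
    obtain ⟨l, m, n, h, rfl⟩ := hv
    rcases m with _ | m
    · refine ⟨0, zero_mem _, ?_⟩
      have hz : y k 2 ^ n • B.b l = (X 1 ^ n : P k) • B.b l := by
        rw [← algebraMap_smul (R k) (X 1 ^ n : P k), map_pow, algebraMap_X_one]
      rw [pow_zero, one_smul, Finset.sum_eq_single l]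
      · rw [show (D - B.d l).toNat = n by omega, hz, eval_P_smul, eval_b]
        simp
      · intro i _ hi
        rw [hz, eval_P_smul, eval_b]
        simp [hi]
      · simp
    · refine ⟨y k 1 ^ m • y k 2 ^ n • B.b l, ?_, ?_⟩
      · have := y_pow_smul_mem 1 m (y_pow_smul_mem 2 n (B.mem l))
        rwa [show B.d l + n + m = D - 1 by omega] at this
      · rw [pow_succ', mul_smul, eval_y_one_smul]
        simp
  | zero => exact ⟨0, zero_mem _, by simp⟩
  | add v w _ _ hv hw =>
    obtain ⟨a, ha, e⟩ := hv
    obtain ⟨c, hc, e'⟩ := hw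
    refine ⟨a + c, add_mem ha hc, ?_⟩
    simp only [map_add, Pi.add_apply, add_smul, Finset.sum_add_distrib, smul_add]
    linear_combination (norm := module) e + e'
  | smul t v _ hv =>
    obtain ⟨a, ha, e⟩ := hv
    refine ⟨t • a, k_smul_mem t ha, ?_⟩
    simp only [map_smul, Pi.smul_apply, smul_assoc, ← Finset.smul_sum]
    conv_lhs => rw [e]
    rw [smul_add, smul_comm (y k 1)]

theorem exists_eq_y_two {D : ℤ} {v : M.carrier} (hv : v ∈ M.deg D) :
    ∃ v' ∈ M.deg (D - 1), v = y k 2 • v'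
      + ∑ i, B.eval ![1, 0] v i • y k 1 ^ (D - B.d i).toNat • B.b i := by
  have hv' := B.mem_gspan hv
  clear hv
  induction hv' using Submodule.span_induction with
  | mem v hv =>
    obtain ⟨l, m, n, h, rfl⟩ := hv
    rw [smul_comm]
    rcases n with _ | n
    · refine ⟨0, zero_mem _, ?_⟩
      have hz : y k 1 ^ m • B.b l = (X 0 ^ m : P k) • B.b l := by
        rw [← algebraMap_smul (R k) (X 0 ^ m : P k), map_pow, algebraMap_X_zero]
      rw [pow_zero, one_smul, Finset.sum_eq_single l]
      · rw [show (D - B.d l).toNat = m by omega, hz, eval_P_smul, eval_b]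
        simp
      · intro i _ hi
        rw [hz, eval_P_smul, eval_b]
        simp [hi]
      · simp
    · refine ⟨y k 2 ^ n • y k 1 ^ m • B.b l, ?_, ?_⟩
      · have := y_pow_smul_mem 2 n (y_pow_smul_mem 1 m (B.mem l))
        rwa [show B.d l + m + n = D - 1 by omega] at this
      · rw [pow_succ', mul_smul, eval_y_two_smul]
        simp
  | zero => exact ⟨0, zero_mem _, by simp⟩
  | add v w _ _ hv hw =>
    obtain ⟨a, ha, e⟩ := hv
    obtain ⟨c, hc, e'⟩ := hw
    refine ⟨a + c, add_mem ha hc, ?_⟩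
    simp only [map_add, Pi.add_apply, add_smul, Finset.sum_add_distrib, smul_add]
    linear_combination (norm := module) e + e'
  | smul t v _ hv =>
    obtain ⟨a, ha, e⟩ := hv
    refine ⟨t • a, k_smul_mem t ha, ?_⟩
    simp only [map_smul, Pi.smul_apply, smul_assoc, ← Finset.smul_sum]
    conv_lhs => rw [e]
    rw [smul_add, smul_comm (y k 2)]

end MinimalBasis

end GrMod

end NodalCone

/-! ### The operators on the fibres: Jordan blocks, triples and local freeness. -/

namespace NodalCone

open MvPolynomial

section LinearAlgebra

variable {K V : Type*} [Field K] [AddCommGroup V] [Module K V] [FiniteDimensional K V]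

theorem finrank_map_add_finrank_inf_ker (U : Submodule K V) (T : V →ₗ[K] V) :
    Module.finrank K (U.map T) + Module.finrank K (U ⊓ LinearMap.ker T : Submodule K V)
      = Module.finrank K U := by
  rw [← LinearMap.finrank_range_add_finrank_ker (T.domRestrict U), LinearMap.range_domRestrict]
  congr 1
  rw [LinearMap.ker_domRestrict, ← Submodule.map_comap_subtype]
  exact (Submodule.equivMapOfInjective _ U.injective_subtype _).finrank_eq.symm

/-- The hypotheses say that all Jordan blocks of T on U have size three. -/
theorem finrank_of_nilpotent {U : Submodule K V} {T : V →ₗ[K] V} (hU : ∀ c ∈ U, T c ∈ U)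
    (h3 : ∀ c, T (T (T c)) = 0) (hker : ∀ c ∈ U, T c = 0 → ∃ c' ∈ U, T (T c') = c) :
    Module.finrank K U = 3 * Module.finrank K (U ⊓ LinearMap.ker T : Submodule K V) ∧
      Module.finrank K (U ⊓ LinearMap.ker (T ∘ₗ T) : Submodule K V)
        = 2 * Module.finrank K (U ⊓ LinearMap.ker T : Submodule K V) := by
  have h1 := finrank_map_add_finrank_inf_ker U T
  have h2 := finrank_map_add_finrank_inf_ker (U.map T) T
  have h4 := finrank_map_add_finrank_inf_ker (U ⊓ LinearMap.ker (T ∘ₗ T)) T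
  have e1 : U.map T ⊓ LinearMap.ker T = U ⊓ LinearMap.ker T := by
    ext c
    constructor
    · rintro ⟨⟨c', hc', rfl⟩, hc⟩
      exact ⟨hU _ hc', hc⟩
    · rintro ⟨hc, hc0⟩
      obtain ⟨c', hc', rfl⟩ := hker c hc hc0
      exact ⟨⟨T c', hU _ hc', rfl⟩, hc0⟩
  have e2 : (U.map T).map T = U ⊓ LinearMap.ker T := by
    ext c
    constructor
    · rintro ⟨_, ⟨c', hc', rfl⟩, rfl⟩
      exact ⟨hU _ (hU _ hc'), h3 c'⟩
    · rintro ⟨hc, hc0⟩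
      obtain ⟨c', hc', rfl⟩ := hker c hc hc0
      exact ⟨T c', ⟨c', hc', rfl⟩, rfl⟩
  have e3 : (U ⊓ LinearMap.ker (T ∘ₗ T)).map T = U ⊓ LinearMap.ker T := by
    ext c
    constructor
    · rintro ⟨c', ⟨hc', h⟩, rfl⟩
      exact ⟨hU _ hc', h⟩
    · rintro ⟨hc, hc0⟩
      obtain ⟨c', hc', rfl⟩ := hker c hc hc0
      exact ⟨T c', ⟨hU _ hc', h3 c'⟩, rfl⟩
  have e4 : U ⊓ LinearMap.ker (T ∘ₗ T) ⊓ LinearMap.ker T = U ⊓ LinearMap.ker T := by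
    ext c
    constructor
    · rintro ⟨⟨hc, -⟩, h⟩
      exact ⟨hc, h⟩
    · rintro ⟨hc, h⟩
      refine ⟨⟨hc, ?_⟩, h⟩
      change T (T c) = 0
      rw [show T c = 0 from h, map_zero]
  rw [e1, e2] at h2
  rw [e3, e4] at h4
  omega

theorem exists_pair_of_finrank_ker_le {T : V →ₗ[K] V} (h : Module.finrank K (LinearMap.ker T) ≤ 2) :
    ∃ c : Fin 2 → V, ∀ v, ∃ (a : Fin 2 → K) (w : V), v = T w + ∑ i, a i • c i := by
  obtain ⟨n, hn⟩ : ∃ n, n = Module.finrank K (V ⧸ LinearMap.range T) := ⟨_, rfl⟩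
  have h1 := LinearMap.finrank_range_add_finrank_ker T
  have h2 := Submodule.finrank_quotient_add_finrank (LinearMap.range T)
  have hn2 : n ≤ 2 := by omega
  let b := Module.finBasisOfFinrankEq K (V ⧸ LinearMap.range T) hn.symm
  choose c hc using fun i => Submodule.Quotient.mk_surjective _ (b i)
  refine ⟨fun i => if h : i.1 < n then c ⟨i.1, h⟩ else 0, fun v => ?_⟩
  refine ⟨fun i => if h : i.1 < n then b.repr (Submodule.Quotient.mk v) ⟨i.1, h⟩ else 0, ?_⟩
  have h3 : ∑ i : Fin 2, (if h : i.1 < n then b.repr (Submodule.Quotient.mk v) ⟨i.1, h⟩ else 0) •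
      (if h : i.1 < n then c ⟨i.1, h⟩ else 0) = ∑ i, b.repr (Submodule.Quotient.mk v) i • c i := by
    obtain rfl | rfl | rfl : n = 0 ∨ n = 1 ∨ n = 2 := by omega
    · simp
    · simp
    · simp [Fin.sum_univ_two]
  rw [h3]
  have h4 : v - ∑ i, b.repr (Submodule.Quotient.mk v) i • c i ∈ LinearMap.range T := by
    rw [← Submodule.Quotient.mk_eq_zero, Submodule.Quotient.mk_sub, sub_eq_zero]
    conv_lhs => rw [← b.sum_repr (Submodule.Quotient.mk v)]
    refine Eq.trans ?_ (map_sum (LinearMap.range T).mkQ _ _).symm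
    exact Finset.sum_congr rfl fun i _ => by rw [← hc]; rfl
  obtain ⟨w, hw⟩ := h4
  exact ⟨w, by rw [hw]; abel⟩

end LinearAlgebra

namespace GrMod.MinimalBasis

variable {k : Type u} [Field k] {M : GrMod k} (B : MinimalBasis M)

theorem exists_y_one_smul_eq {D : ℤ} {v : M.carrier} (hv : v ∈ M.deg (D + 1))
    (h : B.eval ![0, 1] v = 0) : ∃ v' ∈ M.deg D, v = y k 1 • v' := by
  obtain ⟨v', hv', e⟩ := B.exists_eq_y_one hv
  rw [h] at e
  rw [add_sub_cancel_right] at hv'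
  exact ⟨v', hv', by simpa using e⟩

theorem exists_y_two_smul_eq {D : ℤ} {v : M.carrier} (hv : v ∈ M.deg (D + 1))
    (h : B.eval ![1, 0] v = 0) : ∃ v' ∈ M.deg D, v = y k 2 • v' := by
  obtain ⟨v', hv', e⟩ := B.exists_eq_y_two hv
  rw [h] at e
  rw [add_sub_cancel_right] at hv'
  exact ⟨v', hv', by simpa using e⟩

/-- Homogeneous elements with prescribed values at `(0, 1)` and `(1, 0)`. -/
theorem exists_eval_eq {D : ℤ} {a c : Fin 6 → k} (ha : a ∈ B.filt D) (hc : c ∈ B.filt D)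
    (hac : ∀ i, B.d i = D → a i = c i) :
    ∃ v ∈ M.deg D, B.eval ![0, 1] v = a ∧ B.eval ![1, 0] v = c := by
  -- In degree D the coordinate at a generator of degree D is constant, so its two values agree. At
  -- a generator of smaller degree the powers of y₃ and y₂ carry the two values independently.
  let p : Fin 6 → P k := fun i => if B.d i = D then C (a i) else
    C (a i) * X 1 ^ (D - B.d i).toNat + C (c i) * X 0 ^ (D - B.d i).toNat
  have hp : ∀ pt i, B.eval pt (∑ l, p l • B.b l) i = MvPolynomial.eval pt (p i) := fun pt i => by
    rw [eval_apply, B.b.repr_sum_self]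
  have hpos : ∀ i, B.d i ≠ D → ¬ D < B.d i → (D - B.d i).toNat ≠ 0 := fun i h h' => by omega
  refine ⟨∑ i, p i • B.b i, sum_mem fun i _ => ?_, ?_, ?_⟩
  · by_cases h : B.d i = D
    · simp only [p, h, if_true]
      rw [← h, show (C (a i) : P k) • B.b i = a i • B.b i from algebraMap_smul (P k) _ _]
      exact k_smul_mem _ (B.mem i)
    · simp only [p, h, if_false]
      by_cases h' : D < B.d i
      · rw [ha i h', hc i h']
        simp
      · have hd : B.d i + ((D - B.d i).toNat : ℤ) = D := by omega
        rw [add_smul, mul_smul, mul_smul]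
        refine add_mem ?_ ?_
        · rw [show ∀ w : M.carrier, (C (a i) : P k) • w = a i • w from
            fun w => algebraMap_smul (P k) _ _, ← algebraMap_smul (R k) (X 1 ^ _ : P k), map_pow,
            algebraMap_X_one]
          have := y_pow_smul_mem 2 (D - B.d i).toNat (B.mem i)
          rw [hd] at this
          exact k_smul_mem _ this
        · rw [show ∀ w : M.carrier, (C (c i) : P k) • w = c i • w from
            fun w => algebraMap_smul (P k) _ _, ← algebraMap_smul (R k) (X 0 ^ _ : P k), map_pow,
            algebraMap_X_zero]
          have := y_pow_smul_mem 1 (D - B.d i).toNat (B.mem i)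
          rw [hd] at this
          exact k_smul_mem _ this
  · ext i
    rw [hp]
    by_cases h : B.d i = D
    · simp [p, h]
    · by_cases h' : D < B.d i
      · simp [p, h, ha i h', hc i h']
      · simp [p, h, hpos i h h']
  · ext i
    rw [hp]
    by_cases h : B.d i = D
    · simp [p, h, hac i h]
    · by_cases h' : D < B.d i
      · simp [p, h, ha i h', hc i h']
      · simp [p, h, hpos i h h']

/-- The entries of the matrix of y₁ have positive degree, so y₁bᵢ involves only generators of degree
at most that of bᵢ. -/
theorem op_mem_filt (pt : Fin 2 → k) {D : ℤ} {c : Fin 6 → k} (hc : c ∈ B.filt D) :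
    B.op pt c ∈ B.filt D := by
  rw [op, Fintype.linearCombination_apply]
  refine sum_mem fun i _ => ?_
  by_cases h : D < B.d i
  · rw [hc i h, zero_smul]
    exact zero_mem _
  · obtain ⟨v, hv, w, hw, e⟩ := B.exists_smul_eq (B.mem i)
    rw [e, map_add, eval_y_one_smul, eval_y_two_smul]
    have h1 := fun l (hl : D < B.d l) => B.eval_mem_filt pt hv l (by omega)
    have h2 := fun l (hl : D < B.d l) => B.eval_mem_filt pt hw l (by omega)
    exact (B.filt D).smul_mem _ (add_mem ((B.filt D).smul_mem _ h1) ((B.filt D).smul_mem _ h2))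

theorem op_op_op (c : Fin 6 → k) : B.op ![1, 0] (B.op ![1, 0] (B.op ![1, 0] c)) = 0 := by
  have hc : B.eval ![1, 0] (∑ i, (C (c i) : P k) • B.b i) = c := by
    ext i
    rw [eval_apply, B.b.repr_sum_self, eval_C]
  have h := congrArg (B.eval ![1, 0]) (relation_smul (k := k) (∑ i, (C (c i) : P k) • B.b i))
  rw [map_add, eval_y_two_smul, eval_smul, eval_smul, eval_smul, hc, mul_comm, mul_smul,
    eval_y_two_smul] at h
  simpa using h

/-- Lift c to a homogeneous v. Then y₁v = y₃w, and the equation of R applied to v, after cancelling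
y₃, reads y₁²w + y₃y₁w = y₂²v. At (1, 0) this says that c is the square of the operator applied to
the value of w. -/
theorem exists_op_op_eq {D : ℤ} {c : Fin 6 → k} (hc : c ∈ B.filt D) (h : B.op ![1, 0] c = 0) :
    ∃ c' ∈ B.filt D, B.op ![1, 0] (B.op ![1, 0] c') = c := by
  obtain ⟨v, hv, -, e⟩ := B.exists_eval_eq hc hc fun _ _ => rfl
  obtain ⟨w, hw, e'⟩ := B.exists_y_two_smul_eq (y_smul_mem 0 hv) (by rw [eval_smul, e, h])
  refine ⟨_, B.eval_mem_filt ![1, 0] hw, ?_⟩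
  have h1 := relation_smul (k := k) v
  rw [e', smul_comm (y k 0) (y k 2), smul_comm (y k 0) (y k 2), ← smul_add, mul_comm, mul_smul] at h1
  have h2 := congrArg (B.eval ![1, 0]) (y_two_smul_cancel B.b h1)
  rw [map_add, eval_y_two_smul, eval_smul, eval_smul, mul_smul, eval_y_one_smul,
    eval_y_one_smul, e] at h2
  simpa using h2

theorem finrank_filt (D : ℤ) :
    Module.finrank k (B.filt D)
      = 3 * Module.finrank k (B.filt D ⊓ LinearMap.ker (B.op ![1, 0]) : Submodule k (Fin 6 → k)) ∧
    Module.finrank k (B.filt D ⊓ LinearMap.ker (B.op ![1, 0] ∘ₗ B.op ![1, 0]) :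
      Submodule k (Fin 6 → k))
      = 2 * Module.finrank k (B.filt D ⊓ LinearMap.ker (B.op ![1, 0]) : Submodule k (Fin 6 → k)) :=
  finrank_of_nilpotent (fun _ => B.op_mem_filt _) B.op_op_op fun _ => B.exists_op_op_eq

/-- Generators of a copy of the module over the normalization. -/
theorem exists_isTriple {D : ℤ} {g : M.carrier} (hg : g ∈ M.deg D)
    (h1 : B.op ![0, 1] (B.eval ![0, 1] g) = 0)
    (h2 : B.op ![1, 0] (B.op ![1, 0] (B.eval ![1, 0] g)) = 0) :
    ∃ e ∈ M.deg D, ∃ h ∈ M.deg D, IsTriple k e g h := by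
  obtain ⟨e, he, hge⟩ := B.exists_y_one_smul_eq (y_smul_mem 0 hg) (by rw [eval_smul, h1])
  have h3 : B.eval ![1, 0] (y k 0 • e) = 0 := by
    have : B.eval ![1, 0] (y k 0 • y k 0 • g) = 0 := by rw [eval_smul, eval_smul, h2]
    rw [hge, smul_comm, eval_y_one_smul] at this
    simpa using this
  obtain ⟨h, hh, heh⟩ := B.exists_y_two_smul_eq (y_smul_mem 0 he) h3
  refine ⟨e, he, h, hh, heh, hge, ?_⟩
  -- The third relation of a triple is the equation of R on g after cancelling y₂y₃.
  have h4 := relation_smul (k := k) g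
  rw [hge, smul_comm (y k 0) (y k 1), heh, smul_comm (y k 0) (y k 1), smul_comm (y k 0) (y k 2)] at h4
  refine y_one_smul_cancel B.b (y_two_smul_cancel B.b ?_)
  linear_combination (norm := module) h4

/-- Only the node needs an argument. The cokernel of the operator at (0, 1) has dimension at most 2,
so lifts of two vectors generate y₃^N M modulo y₁M + y₂M, and `free_at_node` applies. -/
theorem isLocallyFree_of_finrank_ker_le (hk : (2 : k) ≠ 0)
    (h : Module.finrank k (LinearMap.ker (B.op ![0, 1])) ≤ 2) : M.IsLocallyFree := by
  intro p hp _ hirr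
  have hfin : Module.Finite (R k) M.carrier := finite_of_basis B.b
  by_cases h01 : y k 0 ∈ p ∧ y k 1 ∈ p
  swap
  · exact free_away_from_node hk B.b p h01
  have h2 : y k 2 ∉ p := fun h2 => hirr (Ideal.span_le.2 (by
    rintro _ ⟨i, rfl⟩
    fin_cases i
    exacts [h01.1, h01.2, h2]))
  have htf : Module.IsTorsionFree (R k) M.carrier := isTorsionFree_of_basis B.b
  obtain ⟨c, hc⟩ := exists_pair_of_finrank_ker_le h
  obtain ⟨D, hD⟩ := (Set.finite_range B.d).bddAbove
  replace hD : ∀ i, B.d i ≤ D := fun i => hD ⟨i, rfl⟩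
  have hfilt : ∀ c, c ∈ B.filt D := fun c i hi => absurd (hD i) (by omega)
  choose v hv hvc _ using fun c => B.exists_eval_eq (hfilt c) (hfilt c) fun _ _ => rfl
  set T := Submodule.span (R k) (Set.range fun i => v (c i)) ⊔
      Ideal.span {y k 0, y k 1} • (⊤ : Submodule (R k) M.carrier) with hT
  have hT0 : ∀ w : M.carrier, y k 0 • w ∈ T := fun w =>
    Submodule.mem_sup_right (Submodule.smul_mem_smul (Ideal.subset_span (by simp)) trivial)
  have hT1 : ∀ w : M.carrier, y k 1 • w ∈ T := fun w =>
    Submodule.mem_sup_right (Submodule.smul_mem_smul (Ideal.subset_span (by simp)) trivial)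
  have hTv : ∀ i, v (c i) ∈ T := fun i =>
    Submodule.mem_sup_left (Submodule.subset_span ⟨i, rfl⟩)
  have hTk : ∀ (a : k) (w : M.carrier), w ∈ T → a • w ∈ T := fun a w hw => by
    rw [← algebraMap_smul (R k) a w]
    exact T.smul_mem _ hw
  have hbT : ∀ i, y k 2 ^ (D + 1 - B.d i).toNat • B.b i ∈ T := fun i => by
    obtain ⟨a, w, haw⟩ := hc (Pi.single i 1)
    have hdeg : y k 2 ^ (D + 1 - B.d i).toNat • B.b i - y k 0 • v w
        - ∑ l, a l • y k 2 • v (c l) ∈ M.deg (D + 1) := by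
      refine sub_mem (sub_mem ?_ (y_smul_mem 0 (hv w))) (sum_mem fun l _ =>
        k_smul_mem _ (y_smul_mem 2 (hv _)))
      have := y_pow_smul_mem 2 (D + 1 - B.d i).toNat (B.mem i)
      have hDi := hD i
      rwa [show B.d i + ((D + 1 - B.d i).toNat : ℤ) = D + 1 by omega] at this
    obtain ⟨w', -, hw'⟩ := B.exists_y_one_smul_eq hdeg (by
      have hz : y k 2 ^ (D + 1 - B.d i).toNat • B.b i
          = (X 1 ^ (D + 1 - B.d i).toNat : P k) • B.b i := by
        rw [← algebraMap_smul (R k) (X 1 ^ _ : P k), map_pow, algebraMap_X_one]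
      rw [map_sub, map_sub, hz, eval_P_smul, eval_b, eval_smul, hvc, map_sum]
      simp only [map_smul, eval_y_two_smul, hvc]
      rw [haw]
      simp)
    rw [sub_sub, sub_eq_iff_eq_add] at hw'
    rw [hw']
    exact add_mem (hT1 _) (add_mem (hT0 _) (sum_mem fun l _ => hTk _ _ (T.smul_mem _ (hTv l))))
  refine free_at_node (finrank_R_of_basis B.b) (fun i => v (c i))
    (∑ i, (D + 1 - B.d i).toNat) (fun w => ?_) p h01.1 h01.2 h2
  rw [← B.b.sum_repr w, Finset.smul_sum]
  refine sum_mem fun i _ => ?_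
  rw [smul_comm, ← algebraMap_smul (R k) (B.b.repr w i)]
  refine T.smul_mem _ ?_
  obtain ⟨m, hm⟩ := Nat.exists_eq_add_of_le' (Finset.single_le_sum
    (f := fun i => (D + 1 - B.d i).toNat) (fun _ _ => Nat.zero_le _) (Finset.mem_univ i))
  rw [hm, pow_add, mul_smul]
  exact T.smul_mem _ (hbT i)

end GrMod.MinimalBasis

end NodalCone

/-! ### Functionals with prescribed values at the two points. -/

namespace NodalCone

open MvPolynomial

namespace GrMod

variable {k : Type u} [Field k] {M : GrMod k}

theorem X_pow_smul_mem {D : ℤ} {v : M.carrier} (hv : v ∈ M.deg D) (m n : ℕ) :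
    (X 0 ^ m * X 1 ^ n : P k) • v ∈ M.deg (D + m + n) := by
  rw [← algebraMap_smul (R k) (X 0 ^ m * X 1 ^ n : P k), map_mul, map_pow, map_pow,
    algebraMap_X_zero, algebraMap_X_one, mul_smul, smul_comm]
  exact y_pow_smul_mem 2 n (y_pow_smul_mem 1 m hv)

theorem functional_smul_mem {ι : Type*} {b : Module.Basis ι (P k) M.carrier} {d : ι → ℤ}
    (hb : ∀ i, b i ∈ M.deg (d i)) {γ : M.carrier →ₗ[P k] P k} {g : M.carrier}
    (h : ∀ i, γ (b i) • g ∈ M.deg (d i)) {D : ℤ} {v : M.carrier} (hv : v ∈ M.deg D) :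
    γ v • g ∈ M.deg D := by
  replace hv := mem_gspan hb b.span_eq hv
  induction hv using Submodule.span_induction with
  | mem v hv =>
    obtain ⟨l, m, n, hD, rfl⟩ := hv
    have : y k 1 ^ m • y k 2 ^ n • b l = (X 0 ^ m * X 1 ^ n : P k) • b l := by
      rw [← algebraMap_smul (R k) (X 0 ^ m * X 1 ^ n : P k), map_mul, map_pow, map_pow,
        algebraMap_X_zero, algebraMap_X_one, mul_smul]
    rw [this, map_smul, smul_eq_mul, mul_smul]
    have := X_pow_smul_mem (h l) m n
    rwa [show d l + m + n = D by omega] at this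
  | zero => rw [map_zero, zero_smul]; exact zero_mem _
  | add v w _ _ hv hw => rw [map_add, add_smul]; exact add_mem hv hw
  | smul c v _ hv =>
    rw [← algebraMap_smul (P k) c v, map_smul, smul_assoc, algebraMap_smul]
    exact k_smul_mem c hv

namespace MinimalBasis

variable (B : MinimalBasis M)

/-- On a generator of degree D + n with n > 0 the functional is α y₃ⁿ + κ y₂ⁿ, so γ specializes to α
at (0, 1) and to κ at (1, 0). For n = 0 only a constant is available, for n < 0 only zero, which
explains the hypotheses. Vanishing of α and κ on the images of the operators becomes divisibility by
y₂ and by y₃. -/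
theorem exists_functional {D : ℤ} (α κ : (Fin 6 → k) →ₗ[k] k)
    (hα : ∀ c, α (B.op ![0, 1] c) = 0) (hκ : ∀ c, κ (B.op ![1, 0] (B.op ![1, 0] c)) = 0)
    (hlow : ∀ i, B.d i < D → α (Pi.single i 1) = 0 ∧ κ (Pi.single i 1) = 0)
    (heq : ∀ i, B.d i = D → α (Pi.single i 1) = κ (Pi.single i 1)) :
    ∃ γ : M.carrier →ₗ[P k] P k, (∀ v, (X 0 : P k) ∣ γ (y k 0 • v)) ∧
      (∀ v, (X 1 : P k) ∣ γ (y k 0 • y k 0 • v)) ∧ (∀ i, B.d i < D → γ (B.b i) = 0) ∧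
      (∀ i, B.d i = D → γ (B.b i) = C (α (Pi.single i 1))) ∧
      ∀ g ∈ M.deg D, ∀ D', ∀ v ∈ M.deg D', γ v • g ∈ M.deg D' := by
  let a : Fin 6 → k := fun i => α (Pi.single i 1)
  let c : Fin 6 → k := fun i => κ (Pi.single i 1)
  let n : Fin 6 → ℕ := fun i => (B.d i - D).toNat
  let p : Fin 6 → P k := fun i => if B.d i = D then C (a i) else C (a i) * X 1 ^ n i + C (c i) * X 0 ^ n i
  have ha : ∀ i, B.d i < D → a i = 0 := fun i hi => (hlow i hi).1
  have hc : ∀ i, B.d i < D → c i = 0 := fun i hi => (hlow i hi).2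
  have hp1 : ∀ i, (X 0 : P k) ∣ p i - C (a i) * X 1 ^ n i := fun i => by
    rcases lt_trichotomy (B.d i) D with h | h | h
    · simp [p, h.ne, ha i h, hc i h]
    · simp [p, h, n]
    · simp only [p, h.ne', if_false, add_sub_cancel_left]
      exact Dvd.dvd.mul_left (dvd_pow_self _ (by simp only [n]; omega)) _
  have hp2 : ∀ i, (X 1 : P k) ∣ p i - C (c i) * X 0 ^ n i := fun i => by
    rcases lt_trichotomy (B.d i) D with h | h | h
    · simp [p, h.ne, ha i h, hc i h]
    · simp [p, h, n, show a i = c i from heq i h]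
    · simp only [p, h.ne', if_false, add_sub_cancel_right]
      exact Dvd.dvd.mul_left (dvd_pow_self _ (by simp only [n]; omega)) _
  let γ : M.carrier →ₗ[P k] P k := B.b.constr (P k) p
  have hγ : ∀ i, γ (B.b i) = p i := fun i => B.b.constr_basis _ _ _
  have hsum : ∀ (α : (Fin 6 → k) →ₗ[k] k) v, α v = ∑ i, v i * α (Pi.single i 1) := fun α v => by
    conv_lhs => rw [pi_eq_sum_univ' v, map_sum]
    exact Finset.sum_congr rfl fun i _ => by rw [map_smul, smul_eq_mul]
  have key1 : ∀ D' : ℤ, ∀ v ∈ M.deg D', B.eval ![0, 1] v ∈ LinearMap.ker α → (X 0 : P k) ∣ γ v := by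
    intro D' v hv hv0
    obtain ⟨v', -, e⟩ := B.exists_eq_y_one hv
    have hf := B.eval_mem_filt ![0, 1] hv
    generalize B.eval ![0, 1] v = t at e hf hv0
    have h1 : γ v = X 0 * γ v' + ∑ i, C (t i) * X 1 ^ (D' - B.d i).toNat * (p i - C (a i) * X 1 ^ n i)
        + C (α t) * X 1 ^ (D' - D).toNat := by
      rw [hsum, map_sum, Finset.sum_mul, add_assoc, ← Finset.sum_add_distrib, e, map_add,
        ← X_zero_smul, map_smul, smul_eq_mul, map_sum]
      congr 1
      refine Finset.sum_congr rfl fun i _ => ?_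
      rw [← algebraMap_X_one, ← map_pow, algebraMap_smul, ← algebraMap_smul (P k) (t i), map_smul,
        map_smul, hγ, smul_eq_mul, smul_eq_mul, C_mul]
      change C (t i) * _ = _ + C (t i) * C (a i) * _
      by_cases h : t i = 0
      · simp [h]
      by_cases h' : a i = 0
      · simp [h']; ring
      have h2 : ¬ D' < B.d i := fun hi => h (hf i hi)
      have h3 : ¬ B.d i < D := fun hi => h' (ha i hi)
      rw [show (D' - D).toNat = (D' - B.d i).toNat + n i by simp only [n]; omega, pow_add]
      ring
    rw [h1, LinearMap.mem_ker.1 hv0, map_zero, zero_mul, add_zero]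
    exact dvd_add (dvd_mul_right _ _) (Finset.dvd_sum fun i _ => (hp1 i).mul_left _)
  have key2 : ∀ D' : ℤ, ∀ v ∈ M.deg D', B.eval ![1, 0] v ∈ LinearMap.ker κ → (X 1 : P k) ∣ γ v := by
    intro D' v hv hv0
    obtain ⟨v', -, e⟩ := B.exists_eq_y_two hv
    have hf := B.eval_mem_filt ![1, 0] hv
    generalize B.eval ![1, 0] v = t at e hf hv0
    have h1 : γ v = X 1 * γ v' + ∑ i, C (t i) * X 0 ^ (D' - B.d i).toNat * (p i - C (c i) * X 0 ^ n i)
        + C (κ t) * X 0 ^ (D' - D).toNat := by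
      rw [hsum, map_sum, Finset.sum_mul, add_assoc, ← Finset.sum_add_distrib, e, map_add,
        ← X_one_smul, map_smul, smul_eq_mul, map_sum]
      congr 1
      refine Finset.sum_congr rfl fun i _ => ?_
      rw [← algebraMap_X_zero, ← map_pow, algebraMap_smul, ← algebraMap_smul (P k) (t i), map_smul,
        map_smul, hγ, smul_eq_mul, smul_eq_mul, C_mul]
      change C (t i) * _ = _ + C (t i) * C (c i) * _
      by_cases h : t i = 0
      · simp [h]
      by_cases h' : c i = 0
      · simp [h']; ring
      have h2 : ¬ D' < B.d i := fun hi => h (hf i hi)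
      have h3 : ¬ B.d i < D := fun hi => h' (hc i hi)
      rw [show (D' - D).toNat = (D' - B.d i).toNat + n i by simp only [n]; omega, pow_add]
      ring
    rw [h1, LinearMap.mem_ker.1 hv0, map_zero, zero_mul, add_zero]
    exact dvd_add (dvd_mul_right _ _) (Finset.dvd_sum fun i _ => (hp2 i).mul_left _)
  refine ⟨γ, fun v => ?_, fun v => ?_, fun i hi => ?_, fun i hi => ?_, fun g hg D' v hv => ?_⟩
  · rw [← B.b.sum_repr v, Finset.smul_sum, map_sum]
    refine Finset.dvd_sum fun i _ => ?_
    rw [smul_comm, map_smul, smul_eq_mul]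
    exact (key1 _ _ (y_smul_mem 0 (B.mem i)) (by rw [eval_smul]; exact hα _)).mul_left _
  · rw [← B.b.sum_repr v, Finset.smul_sum, Finset.smul_sum, map_sum]
    refine Finset.dvd_sum fun i _ => ?_
    rw [smul_comm (y k 0) (B.b.repr v i), smul_comm (y k 0) (B.b.repr v i), map_smul, smul_eq_mul]
    exact (key2 _ _ (y_smul_mem 0 (y_smul_mem 0 (B.mem i)))
      (by rw [eval_smul, eval_smul]; exact hκ _)).mul_left _
  · rw [hγ]
    simp [p, hi.ne, ha i hi, hc i hi]
  · rw [hγ]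
    simp [p, hi, a]
  · refine functional_smul_mem B.mem (fun i => ?_) hv
    rw [hγ]
    have hC : ∀ (c : k) (w : M.carrier), (C c : P k) • w = c • w := fun c w =>
      algebraMap_smul (P k) c w
    rcases lt_trichotomy (B.d i) D with h | h | h
    · simp only [p, h.ne, ha i h, hc i h]
      simp
    · simp only [p, h, if_true, hC]
      exact k_smul_mem _ hg
    · simp only [p, h.ne', if_false]
      rw [add_smul, mul_smul, mul_smul, hC, hC]
      have h1 := X_pow_smul_mem hg 0 (n i)
      have h2 := X_pow_smul_mem hg (n i) 0
      rw [show D + (0 : ℕ) + (n i : ℤ) = B.d i by simp only [n]; omega, pow_zero, one_mul] at h1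
      rw [show D + (n i : ℤ) + (0 : ℕ) = B.d i by simp only [n]; omega, pow_zero, mul_one] at h2
      exact add_mem (k_smul_mem _ h1) (k_smul_mem _ h2)

end MinimalBasis

end GrMod

end NodalCone

/-! ### Independence of constant coordinates, and bases adapted to an extension. -/

namespace NodalCone

open MvPolynomial

theorem X_combination_eq {k : Type u} [Field k] {a b c d : k}
    (h : (X 0 * C a + X 1 * C b : P k) = X 0 * C c + X 1 * C d) : a = c ∧ b = d := by
  constructor
  · simpa using congrArg (eval ![1, 0]) h
  · simpa using congrArg (eval ![0, 1]) h

namespace GrMod.MinimalBasis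

variable {k : Type u} [Field k] {M : GrMod k} (B : MinimalBasis M)

theorem const_apply (v : M.carrier) (i : Fin 6) :
    constCoord B.b v i = constantCoeff (B.b.repr v i) := rfl

theorem const_k_smul (c : k) (v : M.carrier) : constCoord B.b (c • v) = c • constCoord B.b v := by
  rw [← algebraMap_smul (P k) c v, constCoord_P_smul]
  congr 1
  exact constantCoeff_C _ c

theorem const_apply_eq_zero {D : ℤ} {v : M.carrier} (hv : v ∈ M.deg D) {i : Fin 6}
    (hi : B.d i ≠ D) : constCoord B.b v i = 0 := by
  replace hv := B.mem_gspan hv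
  induction hv using Submodule.span_induction with
  | mem v hv =>
    obtain ⟨l, m, n, h, rfl⟩ := hv
    rw [const_apply, repr_monomial, B.b.repr_self, Finsupp.single_apply]
    split_ifs with hl
    · subst hl
      rcases m with _ | m
      · rcases n with _ | n
        · exact absurd (by simpa using h) hi
        · simp
      · simp
    · simp
  | zero => simp
  | add v w _ _ hv hw => rw [map_add, Pi.add_apply, hv, hw, add_zero]
  | smul c v _ hv => rw [const_k_smul, Pi.smul_apply, hv, smul_zero]

theorem repr_eq_C_const {D : ℤ} {v : M.carrier} (hv : v ∈ M.deg D) {i : Fin 6} (hi : D = B.d i) :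
    B.b.repr v i = C (constCoord B.b v i) := by
  obtain ⟨c, hc⟩ := repr_eq_C B.b B.mem hv hi
  rw [const_apply, hc, constantCoeff_C]

/-- At a generator of degree D the coordinate of y₁u vanishes: generators of degree D do not occur
in u, and y₁ times a generator of smaller degree could contribute only a constant there, which is
zero. Hence y₂ times a constant of v plus y₃ times one of w is zero. -/
theorem const_of_smul {D : ℤ} {u v w : M.carrier} (hu : u ∈ M.deg D) (hv : v ∈ M.deg D)
    (hw : w ∈ M.deg D) (h0 : constCoord B.b u = 0) (h : y k 0 • u = y k 1 • v + y k 2 • w) :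
    constCoord B.b v = 0 ∧ constCoord B.b w = 0 := by
  have key : ∀ l, B.d l = D → B.b.repr (y k 0 • u) l = 0 := fun l hl => by
    conv_lhs => rw [← B.b.sum_repr u, Finset.smul_sum, map_sum, Finsupp.finsetSum_apply]
    refine Finset.sum_eq_zero fun i _ => ?_
    rw [smul_comm, map_smul, Finsupp.smul_apply, smul_eq_mul]
    rcases lt_trichotomy (B.d i) D with hi | hi | hi
    · have hx := y_smul_mem (k := k) 0 (B.mem i)
      rcases eq_or_ne (B.d i + 1) D with h1 | h1
      · rw [B.repr_eq_C_const hx (h1.trans hl.symm), B.const]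
        simp
      · rw [repr_eq_zero B.b B.mem hx (by omega), mul_zero]
    · rw [B.repr_eq_C_const hu hi.symm, h0]
      simp
    · rw [repr_eq_zero B.b B.mem hu hi, zero_mul]
  have key2 : ∀ l, constCoord B.b v l = 0 ∧ constCoord B.b w l = 0 := fun l => by
    by_cases hl : B.d l = D
    · have h1 := key l hl
      rw [h, map_add, Finsupp.add_apply, repr_y_one_smul, repr_y_two_smul,
        B.repr_eq_C_const hv hl.symm, B.repr_eq_C_const hw hl.symm] at h1
      refine X_combination_eq (h1.trans ?_)
      simp
    · exact ⟨B.const_apply_eq_zero hv hl, B.const_apply_eq_zero hw hl⟩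
  exact ⟨funext fun l => (key2 l).1, funext fun l => (key2 l).2⟩

/-- Multiplication by y₁ turns ae + bg + ch into y₂(be + cg) + y₃(a - c)h, and be + cg into y₂(ce) +
y₃(bh). By `const_of_smul` the vanishing of constants is inherited at each stage, down to single
members of the triple, whose constants are nonzero because those of g are. -/
theorem eq_zero_of_const_triple {D : ℤ} {e g h : M.carrier} (he : e ∈ M.deg D) (hg : g ∈ M.deg D)
    (hh : h ∈ M.deg D) (ht : IsTriple k e g h) (hg0 : constCoord B.b g ≠ 0) {a b c : k}
    (habc : constCoord B.b (a • e + b • g + c • h) = 0) : a = 0 ∧ b = 0 ∧ c = 0 := by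
  have hxk : ∀ (i : Fin 3) (t : k) (v : M.carrier), y k i • t • v = t • y k i • v :=
    fun i t v => smul_comm _ _ _
  have hh0 : constCoord B.b h ≠ 0 := fun h0 => hg0
    (B.const_of_smul hh hg (neg_mem hh) h0 (by rw [ht.rel_h, smul_neg, sub_eq_add_neg])).1
  have he0 : constCoord B.b e ≠ 0 := fun h0 => hh0
    (B.const_of_smul he (zero_mem _) hh h0 (by rw [ht.rel_e, smul_zero, zero_add])).2
  have h1 := (B.const_of_smul
    (add_mem (add_mem (k_smul_mem a he) (k_smul_mem b hg)) (k_smul_mem c hh))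
    (add_mem (k_smul_mem b he) (k_smul_mem c hg)) (k_smul_mem (a - c) hh) habc (by
      simp only [smul_add, hxk, ht.rel_e, ht.rel_g, ht.rel_h, smul_sub, sub_smul]
      abel)).1
  have h2 := B.const_of_smul (add_mem (k_smul_mem b he) (k_smul_mem c hg)) (k_smul_mem c he)
    (k_smul_mem b hh) h1 (by
      simp only [smul_add, hxk, ht.rel_e, ht.rel_g]
      abel)
  rw [const_k_smul, const_k_smul] at h2
  have hc : c = 0 := (smul_eq_zero.1 h2.1).resolve_right he0
  have hb : b = 0 := (smul_eq_zero.1 h2.2).resolve_right hh0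
  subst hc hb
  rw [zero_smul, zero_smul, add_zero, add_zero, const_k_smul] at habc
  exact ⟨(smul_eq_zero.1 habc).resolve_right he0, rfl, rfl⟩

/-- Homogeneous elements whose constant coordinates are independent form a basis. -/
theorem span_eq_top_of_const {v : Fin 6 → M.carrier} {d : Fin 6 → ℤ} (hv : ∀ i, v i ∈ M.deg (d i))
    (hli : LinearIndependent k fun i => constCoord B.b (v i)) :
    ⊤ ≤ Submodule.span (P k) (Set.range v) := by
  have : Module.Finite (R k) M.carrier := finite_of_basis B.b
  obtain ⟨D₀, hD₀⟩ := exists_bound (M := M)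
  set N := Submodule.span (P k) (Set.range v)
  have hk : ∀ (c : k) (w : M.carrier), w ∈ N → c • w ∈ N := fun c w hw => by
    rw [← algebraMap_smul (P k) c w]
    exact N.smul_mem _ hw
  have hspan : ⊤ ≤ Submodule.span k (Set.range fun i => constCoord B.b (v i)) :=
    (hli.span_eq_top_of_card_eq_finrank (by simp)).ge
  have key : ∀ n : ℕ, ∀ D < D₀ + n, ∀ w ∈ M.deg D, w ∈ N := by
    intro n
    induction n with
    | zero =>
      intro D hD w hw
      rw [hD₀ D (by simpa using hD) w hw]
      exact zero_mem _
    | succ n ih =>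
      intro D hD w hw
      obtain ⟨a, ha⟩ := (Submodule.mem_span_range_iff_exists_fun k).1
        (hspan (Submodule.mem_top (x := constCoord B.b w)))
      let u := ∑ i, (if d i = D then a i else 0) • v i
      have huN : u ∈ N := sum_mem fun i _ => hk _ _ (Submodule.subset_span ⟨i, rfl⟩)
      have huD : u ∈ M.deg D := sum_mem fun i _ => by
        split_ifs with h
        · rw [← h]; exact k_smul_mem _ (hv i)
        · rw [zero_smul]; exact zero_mem _
      have h0 : constCoord B.b (w - u) = 0 := by
        ext l
        by_cases hl : B.d l = D
        · rw [map_sub, ← ha, map_sum, ← Finset.sum_sub_distrib, Finset.sum_apply]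
          refine Finset.sum_eq_zero fun i _ => ?_
          rw [const_k_smul, ← sub_smul, Pi.smul_apply]
          split_ifs with h
          · simp
          · rw [B.const_apply_eq_zero (hv i) (by rw [hl]; exact Ne.symm h), smul_zero]
        · exact B.const_apply_eq_zero (sub_mem hw huD) hl
      obtain ⟨w', hw', w'', hw'', e⟩ := B.exists_of_const_eq_zero (D := D - 1)
        (by rw [sub_add_cancel]; exact sub_mem hw huD) h0
      rw [← sub_add_cancel w u, e, ← X_zero_smul, ← X_one_smul]
      exact add_mem (add_mem (N.smul_mem _ (ih (D - 1) (by push_cast at hD; omega) w' hw'))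
        (N.smul_mem _ (ih (D - 1) (by push_cast at hD; omega) w'' hw''))) huN
  intro w _
  obtain ⟨s, -, hs⟩ := proj_sum w
  rw [← hs]
  exact sum_mem fun i _ => key (i + 1 - D₀).toNat i (by omega) _ (M.proj_mem i w)

/-- The minimal basis formed by homogeneous elements with independent constant coordinates. -/
theorem exists_of_const {v : Fin 6 → M.carrier} {d : Fin 6 → ℤ} (hv : ∀ i, v i ∈ M.deg (d i))
    (hli : LinearIndependent k fun i => constCoord B.b (v i)) :
    ∃ B' : MinimalBasis M, (∀ i, B'.b i = v i) ∧ B'.d = d := by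
  have htop := B.span_eq_top_of_const hv hli
  have hind : LinearIndependent (P k) v := linearIndependent_of_top_le_span_of_card_le_finrank htop
    (by rw [Module.finrank_eq_card_basis B.b])
  let b := Module.Basis.mk hind htop
  have hb : ∀ i, b i = v i := Module.Basis.mk_apply hind htop
  refine ⟨⟨b, d, fun i => hb i ▸ hv i, fun i => ?_⟩, hb, rfl⟩
  obtain ⟨w, -, w', -, e⟩ := B.exists_smul_eq (hv i)
  rw [hb, e, map_add, ← X_zero_smul, ← X_one_smul, constCoord_P_smul, constCoord_P_smul,
    constantCoeff_X, constantCoeff_X, zero_smul, zero_smul, add_zero]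

end GrMod.MinimalBasis

end NodalCone

namespace NodalCone

open MvPolynomial

namespace GrMod.MinimalBasis

variable {k : Type u} [Field k] {M : GrMod k} (B : MinimalBasis M)

/-- The values of a functional and of its companions in the degree in which it is constant. -/
theorem companions_of_smul (B : MinimalBasis M) {D : ℤ} {γ η θ : M.carrier →ₗ[P k] P k}
    (hη : ∀ v, γ (y k 0 • v) = X 0 * η v) (hθ : ∀ v, η (y k 0 • v) = X 1 * θ v)
    (hγ : ∀ v, θ (y k 0 • v) + X 1 * θ v = X 0 * γ v)
    (hconst : ∀ v ∈ M.deg D, ∃ c, γ v = C c) {v v' v'' : M.carrier} (hv : v ∈ M.deg D)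
    (hv' : v' ∈ M.deg D) (hv'' : v'' ∈ M.deg D) (h : y k 0 • v = y k 1 • v' + y k 2 • v'') :
    (γ v' = η v ∧ η v' = 0 ∧ θ v' = γ v) ∧ γ v'' = 0 ∧ η v'' = θ v ∧ θ v'' = -θ v := by
  have cη : ∀ v ∈ M.deg D, ∀ v' ∈ M.deg D, ∀ v'' ∈ M.deg D,
      y k 0 • v = y k 1 • v' + y k 2 • v'' → γ v' = η v ∧ γ v'' = 0 := by
    intro v hv v' hv' v'' hv'' h
    obtain ⟨a, ha⟩ := hconst v' hv'
    obtain ⟨c, hc⟩ := hconst v'' hv''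
    have h1 := hη v
    rw [h, map_add, ← X_zero_smul, ← X_one_smul, map_smul, map_smul, smul_eq_mul, smul_eq_mul,
      ha, hc] at h1
    have hc0 : c = 0 := by simpa using congrArg (MvPolynomial.eval ![0, 1]) h1
    rw [hc0, C_0, mul_zero, add_zero] at h1
    exact ⟨by rw [ha, mul_left_cancel₀ (P_X_ne_zero 0) h1], by rw [hc, hc0, C_0]⟩
  have hconstη : ∀ v ∈ M.deg D, ∃ c, η v = C c := fun v hv => by
    obtain ⟨v', hv', v'', hv'', h⟩ := B.exists_smul_eq hv
    rw [← (cη v hv v' hv' v'' hv'' h).1]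
    exact hconst v' hv'
  have cθ : ∀ v ∈ M.deg D, ∀ v' ∈ M.deg D, ∀ v'' ∈ M.deg D,
      y k 0 • v = y k 1 • v' + y k 2 • v'' → η v' = 0 ∧ η v'' = θ v := by
    intro v hv v' hv' v'' hv'' h
    obtain ⟨a, ha⟩ := hconstη v' hv'
    obtain ⟨c, hc⟩ := hconstη v'' hv''
    have h1 := hθ v
    rw [h, map_add, ← X_zero_smul, ← X_one_smul, map_smul, map_smul, smul_eq_mul, smul_eq_mul,
      ha, hc] at h1
    have hc0 : a = 0 := by simpa using congrArg (MvPolynomial.eval ![1, 0]) h1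
    rw [hc0, C_0, mul_zero, zero_add] at h1
    exact ⟨by rw [ha, hc0, C_0], by rw [hc, mul_left_cancel₀ (P_X_ne_zero 1) h1]⟩
  have hconstθ : ∀ v ∈ M.deg D, ∃ c, θ v = C c := fun v hv => by
    obtain ⟨v', hv', v'', hv'', h⟩ := B.exists_smul_eq hv
    rw [← (cθ v hv v' hv' v'' hv'' h).2]
    exact hconstη v'' hv''
  have h1 := cη v hv v' hv' v'' hv'' h
  have h2 := cθ v hv v' hv' v'' hv'' h
  have h3 := hγ v
  rw [h, map_add, ← X_zero_smul, ← X_one_smul, map_smul, map_smul, smul_eq_mul, smul_eq_mul] at h3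
  obtain ⟨a, ha⟩ := hconstθ v' hv'
  obtain ⟨b, hb⟩ := hconstθ v'' hv''
  obtain ⟨c, hc⟩ := hconstθ v hv
  obtain ⟨e, he⟩ := hconst v hv
  rw [ha, hb, hc, he] at h3
  have h4 : a = e ∧ b = -c := X_combination_eq (by rw [C_neg]; linear_combination h3)
  refine ⟨⟨h1.1, h2.1, by rw [ha, he, h4.1]⟩, h1.2, h2.2, by rw [hb, hc, h4.2, C_neg]⟩

/-- The quotient of `M` by the kernel of the homomorphism determined by a functional. -/
theorem exists_lifts (B : MinimalBasis M) {D : ℤ} {γ η θ : M.carrier →ₗ[P k] P k}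
    (hη : ∀ v, γ (y k 0 • v) = X 0 * η v) (hθ : ∀ v, η (y k 0 • v) = X 1 * θ v)
    (hγ : ∀ v, θ (y k 0 • v) + X 1 * θ v = X 0 * γ v)
    (hconst : ∀ v ∈ M.deg D, ∃ c, γ v = C c) {v : M.carrier} (hv : v ∈ M.deg D) (h1 : γ v = 1) :
    ∃ e ∈ M.deg D, ∃ g ∈ M.deg D, ∃ h ∈ M.deg D, (γ e = 0 ∧ η e = 0 ∧ θ e = 1) ∧
      (γ g = 1 ∧ η g = 0 ∧ θ g = 0) ∧ (γ h = 0 ∧ η h = 1 ∧ θ h = -1) := by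
  have key := fun {v v' v''} => B.companions_of_smul hη hθ hγ hconst (v := v) (v' := v') (v'' := v'')
  -- Only γ v = 1 is known. Repeated splitting of y₁v discards the unknown values η v and θ v: v₁
  -- has η = 0, θ = 1, then v₂ has (γ, η, θ) = (0, 1, -1), and g, e, h come out with the values of
  -- the basis of L.
  obtain ⟨v₁, hv₁, w₁, hw₁, e₁⟩ := B.exists_smul_eq hv
  obtain ⟨w₂, hw₂, v₂, hv₂, e₂⟩ := B.exists_smul_eq hv₁
  obtain ⟨g, hg, w₃, hw₃, e₃⟩ := B.exists_smul_eq hv₂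
  obtain ⟨e, he, w₄, hw₄, e₄⟩ := B.exists_smul_eq hg
  obtain ⟨w₅, hw₅, h, hh, e₅⟩ := B.exists_smul_eq he
  obtain ⟨⟨a1, a2, a3⟩, -⟩ := key hv hv₁ hw₁ e₁
  obtain ⟨-, b1, b2, b3⟩ := key hv₁ hw₂ hv₂ e₂
  obtain ⟨⟨c1, c2, c3⟩, -⟩ := key hv₂ hg hw₃ e₃
  obtain ⟨⟨d1, d2, d3⟩, -⟩ := key hg he hw₄ e₄
  obtain ⟨-, f1, f2, f3⟩ := key he hw₅ hh e₅
  have g1 : γ g = 1 := by rw [c1, b2, a3, h1]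
  have g3 : θ g = 0 := by rw [c3, b1]
  have e3 : θ e = 1 := by rw [d3, g1]
  refine ⟨e, he, g, hg, h, hh, ⟨by rw [d1, c2], d2, e3⟩, ⟨g1, c2, g3⟩, ⟨f1, by rw [f2, e3], by rw [f3, e3]⟩⟩

/-- The triple in M together with lifts of the basis of L along the map given by γ. In a relation
between constants the functionals γ, η, θ, which kill the triple, isolate the lifts, and
`eq_zero_of_const_triple` handles the triple. -/
theorem exists_adapted_basis {D D' : ℤ} {e g h : M.carrier} (he : e ∈ M.deg D) (hg : g ∈ M.deg D)
    (hh : h ∈ M.deg D) (ht : IsTriple k e g h) (hg0 : constCoord B.b g ≠ 0)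
    {γ η θ : M.carrier →ₗ[P k] P k}
    (hη : ∀ v, γ (y k 0 • v) = X 0 * η v) (hθ : ∀ v, η (y k 0 • v) = X 1 * θ v)
    (hγ : ∀ v, θ (y k 0 • v) + X 1 * θ v = X 0 * γ v)
    (hconst : ∀ v ∈ M.deg D', ∃ c, γ v = C c) {v : M.carrier} (hv : v ∈ M.deg D') (h1 : γ v = 1)
    (γe : γ e = 0) (γg : γ g = 0) (γh : γ h = 0) :
    ∃ B' : MinimalBasis M, B'.b 0 = e ∧ B'.b 1 = g ∧ B'.b 2 = h ∧ B'.d = ![D, D, D, D', D', D'] ∧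
      ∀ v, γ v = B'.b.repr v 4 ∧ η v = B'.b.repr v 5 ∧ θ v = B'.b.repr v 3 - B'.b.repr v 5 := by
  obtain ⟨e₂, he₂, g₂, hg₂, h₂, hh₂, ⟨p1, p2, p3⟩, ⟨q1, q2, q3⟩, ⟨r1, r2, r3⟩⟩ :=
    B.exists_lifts hη hθ hγ hconst hv h1
  have c0 : ∀ {p : P k}, X 0 * p = 0 → p = 0 := fun h =>
    (mul_eq_zero.1 h).resolve_left (P_X_ne_zero 0)
  have c1 : ∀ {p : P k}, X 1 * p = 0 → p = 0 := fun h =>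
    (mul_eq_zero.1 h).resolve_left (P_X_ne_zero 1)
  have kill : ∀ φ ψ : M.carrier →ₗ[P k] P k, (∀ v, φ (y k 0 • v) = 0 → ψ v = 0) →
      φ e = 0 → φ g = 0 → φ h = 0 → ψ e = 0 ∧ ψ g = 0 ∧ ψ h = 0 := by
    intro φ ψ hφ fe fg fh
    refine ⟨hφ _ ?_, hφ _ ?_, hφ _ ?_⟩
    · rw [ht.rel_e, ← X_one_smul, map_smul, fh, smul_zero]
    · rw [ht.rel_g, ← X_zero_smul, map_smul, fe, smul_zero]
    · rw [ht.rel_h, ← X_one_smul, ← X_zero_smul, map_sub, map_smul, map_smul, fg, fh, smul_zero,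
        smul_zero, sub_zero]
  obtain ⟨ηe, ηg, ηh⟩ := kill γ η (fun v hv => c0 (by rw [← hη, hv])) γe γg γh
  obtain ⟨θe, θg, θh⟩ := kill η θ (fun v hv => c1 (by rw [← hθ, hv])) ηe ηg ηh
  have hli : LinearIndependent k fun i => constCoord B.b ((![e, g, h, e₂, g₂, h₂] : Fin 6 → _) i) := by
    rw [Fintype.linearIndependent_iff]
    intro a ha
    have hu : constCoord B.b (a 0 • e + a 1 • g + a 2 • h + a 3 • e₂ + a 4 • g₂ + a 5 • h₂) = 0 := by
      rw [← ha, Fin.sum_univ_six]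
      simp only [map_add, const_k_smul, Matrix.cons_val]
    have hφ : ∀ (φ : M.carrier →ₗ[P k] P k) w, constCoord B.b w = 0 → constantCoeff (φ w) = 0 := by
      intro φ w hw
      rw [← B.b.sum_repr w, map_sum, map_sum]
      refine Finset.sum_eq_zero fun i _ => ?_
      rw [map_smul, smul_eq_mul, map_mul, ← const_apply, hw, Pi.zero_apply, zero_mul]
    have hk : ∀ (φ : M.carrier →ₗ[P k] P k) (c : k) w, φ (c • w) = C c * φ w := fun φ c w => by
      rw [← algebraMap_smul (P k) c w, map_smul, smul_eq_mul]
      rfl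
    have h4 := hφ γ _ hu
    have h5 := hφ η _ hu
    have h3 := hφ θ _ hu
    simp only [map_add, hk, γe, γg, γh, ηe, ηg, ηh, θe, θg, θh, p1, p2, p3, q1, q2, q3, r1, r2, r3,
      map_neg, constantCoeff_C, mul_zero, zero_add, add_zero, mul_one,
      mul_neg] at h3 h4 h5
    have h3' : a 3 = 0 := by rw [h5] at h3; simpa using h3
    rw [h3', h4, h5, zero_smul, zero_smul, zero_smul, add_zero, add_zero, add_zero] at hu
    obtain ⟨h0, h1, h2⟩ := B.eq_zero_of_const_triple he hg hh ht hg0 hu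
    intro i
    fin_cases i
    exacts [h0, h1, h2, h3', h4, h5]
  obtain ⟨B', hB', hd⟩ := B.exists_of_const (d := ![D, D, D, D', D', D'])
    (v := ![e, g, h, e₂, g₂, h₂]) (fun i => by fin_cases i <;> assumption) hli
  refine ⟨B', hB' 0, hB' 1, hB' 2, hd, fun v => ?_⟩
  have hsum : ∀ φ : M.carrier →ₗ[P k] P k, φ v = ∑ i, B'.b.repr v i * φ (B'.b i) := fun φ => by
    conv_lhs => rw [← B'.b.sum_repr v, map_sum]
    simp only [map_smul, smul_eq_mul]
  rw [hsum γ, hsum η, hsum θ]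
  simp only [Fin.sum_univ_six, hB', Matrix.cons_val, γe, γg, γh, ηe, ηg, ηh, θe, θg, θh, p1, p2, p3,
    q1, q2, q3, r1, r2, r3]
  refine ⟨?_, ?_, ?_⟩ <;> ring

end GrMod.MinimalBasis

end NodalCone

/-! ### Reduction of an extension of two copies of L to normal form. -/

namespace NodalCone

open MvPolynomial

namespace GrMod.MinimalBasis

variable {k : Type u} [Field k] {M : GrMod k} (B : MinimalBasis M)

theorem exists_eq_y_one_of_repr {D : ℤ} {j : ℕ} (hd : B.d = ![D, D, D, D + j, D + j, D + j])
    {w : M.carrier} (hw : w ∈ M.deg (D + j + 1)) (h3 : B.b.repr w 3 = 0) (h4 : B.b.repr w 4 = 0)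
    (h5 : B.b.repr w 5 = 0) : ∃ w' ∈ M.deg (D + j), (B.b.repr w' 3 = 0 ∧ B.b.repr w' 4 = 0 ∧
      B.b.repr w' 5 = 0) ∧ ∃ l m n : k,
      w = y k 1 • w' + y k 2 ^ (j + 1) • (l • B.b 0 + m • B.b 1 + n • B.b 2) := by
  obtain ⟨w', hw', e⟩ := B.exists_eq_y_one hw
  have hn : (D + j + 1 - D).toNat = j + 1 := by omega
  simp only [Fin.sum_univ_six, hd, Matrix.cons_val, eval_apply, h3, h4, h5, map_zero, zero_smul,
    add_zero, hn] at e
  have hz : ∀ v : M.carrier, y k 2 ^ (j + 1) • v = (X 1 ^ (j + 1) : P k) • v := fun v => by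
    rw [← algebraMap_smul (R k) (X 1 ^ (j + 1) : P k), map_pow, algebraMap_X_one]
  have h0 : ∀ i, B.b.repr w i = 0 → i ≠ 0 → i ≠ 1 → i ≠ 2 → B.b.repr w' i = 0 := by
    intro i hi h0 h1 h2
    rw [e] at hi
    simpa [repr_y_one_smul, repr_k_smul, hz, P_X_ne_zero, h0, h1, h2, Finsupp.single_apply,
      Ne.symm h0, Ne.symm h1, Ne.symm h2] using hi
  rw [add_sub_cancel_right] at hw'
  refine ⟨w', hw', ⟨h0 3 h3 (by decide) (by decide) (by decide),
    h0 4 h4 (by decide) (by decide) (by decide), h0 5 h5 (by decide) (by decide) (by decide)⟩,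
    MvPolynomial.eval ![0, 1] (B.b.repr w 0), MvPolynomial.eval ![0, 1] (B.b.repr w 1),
    MvPolynomial.eval ![0, 1] (B.b.repr w 2), e.trans ?_⟩
  module

theorem exists_eq_y_two_of_repr {D : ℤ} {j : ℕ} (hd : B.d = ![D, D, D, D + j, D + j, D + j])
    {w : M.carrier} (hw : w ∈ M.deg (D + j + 1)) (h3 : B.b.repr w 3 = 0) (h4 : B.b.repr w 4 = 0)
    (h5 : B.b.repr w 5 = 0) : ∃ w' ∈ M.deg (D + j), (B.b.repr w' 3 = 0 ∧ B.b.repr w' 4 = 0 ∧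
      B.b.repr w' 5 = 0) ∧ ∃ l m n : k,
      w = y k 2 • w' + y k 1 ^ (j + 1) • (l • B.b 0 + m • B.b 1 + n • B.b 2) := by
  obtain ⟨w', hw', e⟩ := B.exists_eq_y_two hw
  have hn : (D + j + 1 - D).toNat = j + 1 := by omega
  simp only [Fin.sum_univ_six, hd, Matrix.cons_val, eval_apply, h3, h4, h5, map_zero, zero_smul,
    add_zero, hn] at e
  have hz : ∀ v : M.carrier, y k 1 ^ (j + 1) • v = (X 0 ^ (j + 1) : P k) • v := fun v => by
    rw [← algebraMap_smul (R k) (X 0 ^ (j + 1) : P k), map_pow, algebraMap_X_zero]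
  have h0 : ∀ i, B.b.repr w i = 0 → i ≠ 0 → i ≠ 1 → i ≠ 2 → B.b.repr w' i = 0 := by
    intro i hi h0 h1 h2
    rw [e] at hi
    simpa [repr_y_two_smul, repr_k_smul, hz, P_X_ne_zero, h0, h1, h2, Finsupp.single_apply,
      Ne.symm h0, Ne.symm h1, Ne.symm h2] using hi
  rw [add_sub_cancel_right] at hw'
  refine ⟨w', hw', ⟨h0 3 h3 (by decide) (by decide) (by decide),
    h0 4 h4 (by decide) (by decide) (by decide), h0 5 h5 (by decide) (by decide) (by decide)⟩,
    MvPolynomial.eval ![1, 0] (B.b.repr w 0), MvPolynomial.eval ![1, 0] (B.b.repr w 1),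
    MvPolynomial.eval ![1, 0] (B.b.repr w 2), e.trans ?_⟩
  module

/-- An extension of two copies of the module over the normalization has a normal form. -/
theorem exists_normalForm_of_adapted {D : ℤ} {j : ℕ} (hd : B.d = ![D, D, D, D + j, D + j, D + j])
    (ht : IsTriple k (B.b 0) (B.b 1) (B.b 2))
    (h3 : ∀ v, B.b.repr (y k 0 • v) 3 = X 0 * B.b.repr v 4)
    (h4 : ∀ v, B.b.repr (y k 0 • v) 4 = X 0 * B.b.repr v 5)
    (h5 : ∀ v, B.b.repr (y k 0 • v) 5 = X 1 * (B.b.repr v 3 - B.b.repr v 5)) :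
    ∃ lam mu : k, Nonempty (NormalForm M D j lam mu) := by
  have hmem := B.mem
  simp only [hd] at hmem
  obtain ⟨β, hβ, ⟨β3, β4, β5⟩, lam, mu, nu, eβ⟩ := B.exists_eq_y_one_of_repr hd
    (w := y k 0 • B.b 4 - y k 1 • B.b 3) (sub_mem (y_smul_mem 0 (hmem 4)) (y_smul_mem 1 (hmem 3)))
    (by simp [h3, repr_y_one_smul]) (by simp [h4, repr_y_one_smul]) (by simp [h5, repr_y_one_smul])
  obtain ⟨α, hα, ⟨α3, α4, α5⟩, a, b, c, eα⟩ := B.exists_eq_y_two_of_repr hd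
    (w := y k 0 • (B.b 3 + β) - y k 2 • B.b 5)
    (sub_mem (y_smul_mem 0 (add_mem (hmem 3) hβ)) (y_smul_mem 2 (hmem 5)))
    (by simp [h3, repr_y_two_smul, β4]) (by simp [h4, repr_y_two_smul, β5])
    (by simp [h5, repr_y_two_smul, β3, β5])
  obtain ⟨te, tg, th⟩ := ht
  have hmem' : ∀ n (w : M.carrier), w ∈ M.deg D → y k n ^ j • w ∈ M.deg (D + j) :=
    fun n w hw => y_pow_smul_mem n j hw
  have m0 : B.b 0 ∈ M.deg D := hmem 0
  have m1 : B.b 1 ∈ M.deg D := hmem 1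
  have m2 : B.b 2 ∈ M.deg D := hmem 2
  have m3 : B.b 3 ∈ M.deg (D + j) := hmem 3
  have m4 : B.b 4 ∈ M.deg (D + j) := hmem 4
  have m5 : B.b 5 ∈ M.deg (D + j) := hmem 5
  have hK : ∀ w : M.carrier, B.b.repr w 3 = 0 → B.b.repr w 4 = 0 → B.b.repr w 5 = 0 →
      w ∈ Submodule.span (R k) {B.b 0, B.b 1, B.b 2} := fun w w3 w4 w5 => by
    rw [← B.b.sum_repr w, Fin.sum_univ_six, w3, w4, w5, zero_smul, zero_smul, zero_smul, add_zero,
      add_zero, add_zero, ← algebraMap_smul (R k) (B.b.repr w 0),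
      ← algebraMap_smul (R k) (B.b.repr w 1), ← algebraMap_smul (R k) (B.b.repr w 2)]
    refine add_mem (add_mem ?_ ?_) ?_ <;>
      exact Submodule.smul_mem _ _ (Submodule.subset_span (by simp))
  generalize he : B.b 0 = e at *
  generalize hgg : B.b 1 = g at *
  generalize hh : B.b 2 = h at *
  generalize he2 : B.b 3 = e2 at *
  generalize hg2 : B.b 4 = g2 at *
  generalize hh2 : B.b 5 = h2 at *
  have hβK := hK β β3 β4 β5
  have hαK := hK α α3 α4 α5
  -- β absorbs the part divisible by y₂ of the error in y₁g2, the summand -nu y₃^j e absorbs its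
  -- h-component because y₁e = y₃h, and α absorbs the part divisible by y₃ of the error in y₁e3.
  set e3 := e2 + β with he3
  set g3 := g2 - nu • y k 2 ^ j • e with hg3
  set h6 := h2 + α with hh6
  have rg : y k 0 • g3 = y k 1 • e3 + y k 2 ^ (j + 1) • (lam • e + mu • g) := by
    rw [hg3, he3]
    linear_combination (norm := module) eβ - nu • y k 2 ^ j • te
  have re : y k 0 • e3 = y k 2 • h6 + y k 1 ^ (j + 1) • (a • e + b • g + c • h) := by
    rw [hh6]
    linear_combination (norm := module) eα
  have eg : y k 0 • y k 0 • g3 = y k 1 • (y k 2 • h6 + y k 1 ^ (j + 1) • (a • e + b • g + c • h))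
      + y k 2 ^ (j + 1) • (lam • y k 2 • h + mu • y k 1 • e) := by
    rw [rg]
    linear_combination (norm := module) y k 1 • re + y k 2 ^ (j + 1) • lam • te
      + y k 2 ^ (j + 1) • mu • tg
  have hrel := relation_smul (k := k) g3
  rw [eg] at hrel
  have key : y k 1 • y k 2 • (y k 0 • h6 - y k 1 • g3 + y k 2 • h6 + y k 1 ^ (j + 1) • a • (h + e)
      + y k 2 ^ (j + 1) • (lam • g + mu • (h + e)))
      + y k 1 ^ (j + 2) • (b • (y k 1 • e + y k 2 • g) + c • y k 1 • g) = 0 := by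
    linear_combination (norm := module) hrel - y k 1 ^ (j + 2) • a • te - y k 1 ^ (j + 2) • b • tg
      - y k 1 ^ (j + 2) • c • th - y k 2 ^ (j + 2) • lam • th - (y k 1 * y k 2 ^ (j + 1)) • mu • te
  -- At (1, 0) the equation of R on g3 reduces to be + cg = 0.
  have hbc : b = 0 ∧ c = 0 := by
    generalize y k 0 • h6 - y k 1 • g3 + y k 2 • h6 + y k 1 ^ (j + 1) • a • (h + e)
      + y k 2 ^ (j + 1) • (lam • g + mu • (h + e)) = u at key
    have h1 := congrArg (B.eval ![1, 0]) key
    have hy : ∀ w : M.carrier, y k 1 ^ (j + 2) • w = (X 0 ^ (j + 2) : P k) • w := fun w => by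
      rw [← algebraMap_smul (R k) (X 0 ^ (j + 2) : P k), map_pow, algebraMap_X_zero]
    rw [hy, map_add, eval_y_one_smul, eval_y_two_smul, eval_P_smul, map_add, map_smul _ b,
      map_smul _ c, map_add, eval_y_one_smul, eval_y_one_smul, eval_y_two_smul, ← he, ← hgg, eval_b, eval_b] at h1
    exact ⟨by simpa using congrFun h1 0, by simpa using congrFun h1 1⟩
  obtain ⟨rfl, rfl⟩ := hbc
  have rh : y k 0 • h6 = y k 1 • g3 - y k 2 • h6 - y k 1 ^ (j + 1) • a • (h + e)
      - y k 2 ^ (j + 1) • (lam • g + mu • (h + e)) := by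
    have h1 := y_two_smul_cancel B.b (y_one_smul_cancel B.b
      (v := y k 2 • (y k 0 • h6 - y k 1 • g3 + y k 2 • h6 + y k 1 ^ (j + 1) • a • (h + e)
      + y k 2 ^ (j + 1) • (lam • g + mu • (h + e)))) (w := y k 2 • 0)
      (by linear_combination (norm := module) key))
    linear_combination (norm := module) h1
  -- The coefficient a is removed by a coboundary, since y₁(h + e) = y₂g and y₁g = y₂e.
  set g4 := g3 - a • y k 1 ^ j • (h + e) with hg4
  set e4 := e3 - a • y k 1 ^ j • g with he4
  refine ⟨lam, mu, (GrMod.exists_normalForm (finrank_R_of_basis B.b).ge ![e, g, h, e4, g4, h6]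
    ?_ ?_ ⟨te, tg, th⟩ ?_ ?_ ?_).nonempty⟩
  · intro w _
    set S := Submodule.span (R k) (Set.range ![e, g, h, e4, g4, h6]) with hS
    have hvS : ∀ i, (![e, g, h, e4, g4, h6] : Fin 6 → M.carrier) i ∈ S :=
      fun i => Submodule.subset_span ⟨i, rfl⟩
    have hkS : ∀ (t : k) (v : M.carrier), v ∈ S → t • v ∈ S := fun t v hv => by
      rw [← algebraMap_smul (R k) t v]
      exact S.smul_mem _ hv
    have hKS : Submodule.span (R k) {e, g, h} ≤ S := by
      rw [Submodule.span_le]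
      rintro _ (rfl | rfl | rfl)
      exacts [hvS 0, hvS 1, hvS 2]
    have s3 : e2 ∈ S := by
      have h1 : e2 = e4 + a • y k 1 ^ j • g - β := by rw [he4, he3]; abel
      rw [h1]
      exact sub_mem (add_mem (hvS 3) (hkS _ _ (S.smul_mem _ (hvS 1)))) (hKS hβK)
    have s4 : g2 ∈ S := by
      have h1 : g2 = g4 + a • y k 1 ^ j • (h + e) + nu • y k 2 ^ j • e := by rw [hg4, hg3]; abel
      rw [h1]
      exact add_mem (add_mem (hvS 4) (hkS _ _ (S.smul_mem _ (add_mem (hvS 2) (hvS 0)))))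
        (hkS _ _ (S.smul_mem _ (hvS 0)))
    have s5 : h2 ∈ S := by
      have h1 : h2 = h6 - α := by rw [hh6]; abel
      rw [h1]
      exact sub_mem (hvS 5) (hKS hαK)
    rw [← B.b.sum_repr w]
    refine sum_mem fun i _ => ?_
    rw [← algebraMap_smul (R k) (B.b.repr w i)]
    refine S.smul_mem _ ?_
    fin_cases i
    · exact he ▸ hvS 0
    · exact hgg ▸ hvS 1
    · exact hh ▸ hvS 2
    · exact he2 ▸ s3
    · exact hg2 ▸ s4
    · exact hh2 ▸ s5
  · have n3 : e4 ∈ M.deg (D + j) := sub_mem (add_mem m3 hβ) (k_smul_mem a (hmem' 1 _ m1))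
    have n4 : g4 ∈ M.deg (D + j) := sub_mem (sub_mem m4 (k_smul_mem nu (hmem' 2 _ m0)))
      (k_smul_mem a (hmem' 1 _ (add_mem m2 m0)))
    have n5 : h6 ∈ M.deg (D + j) := add_mem m5 hα
    intro i
    fin_cases i
    exacts [m0, m1, m2, n3, n4, n5]
  · change y k 0 • e4 = y k 2 • h6
    rw [he4]
    linear_combination (norm := module) re - a • y k 1 ^ j • tg
  · change y k 0 • g4 = y k 1 • e4 + y k 2 ^ (j + 1) • (lam • e + mu • g)
    rw [he4, hg4]
    linear_combination (norm := module) rg - a • y k 1 ^ j • te - a • y k 1 ^ j • th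
  · change y k 0 • h6 = y k 1 • g4 - y k 2 • h6
      - y k 2 ^ (j + 1) • (lam • g + mu • (h + e))
    rw [hg4]
    linear_combination (norm := module) rh

end GrMod.MinimalBasis

end NodalCone

namespace NodalCone

open MvPolynomial

namespace GrMod.MinimalBasis

variable {k : Type u} [Field k] {M : GrMod k} (B : MinimalBasis M)

/-- The composite of the triple with γ vanishes by degree if D < D'. If D = D', then γ e = γ h = 0
by divisibility, and a nonzero constant γ g would split off a copy of L. So γ kills the triple, and
an adapted basis puts M into normal form. -/
theorem exists_normalForm_of_functional (hM : M.IsIndecomposable) {D D' : ℤ} (hD : D ≤ D')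
    {e g h : M.carrier} (he : e ∈ M.deg D) (hg : g ∈ M.deg D) (hh : h ∈ M.deg D)
    (ht : IsTriple k e g h) (hg0 : constCoord B.b g ≠ 0) (γ : M.carrier →ₗ[P k] P k)
    (h1 : ∀ v, (X 0 : P k) ∣ γ (y k 0 • v)) (h2 : ∀ v, (X 1 : P k) ∣ γ (y k 0 • y k 0 • v))
    (hlow : ∀ i, B.d i < D' → γ (B.b i) = 0)
    (hC : ∀ i, B.d i = D' → ∃ c, γ (B.b i) = C c)
    (hdeg : ∀ g ∈ M.deg D', ∀ i, ∀ v ∈ M.deg i, γ v • g ∈ M.deg i)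
    (hne : ∃ i, B.d i = D' ∧ γ (B.b i) ≠ 0) :
    ∃ (j : ℕ) (lam mu : k), Nonempty (NormalForm M D j lam mu) := by
  have hsum : ∀ v, γ v = ∑ i, B.b.repr v i * γ (B.b i) := fun v => by
    conv_lhs => rw [← B.b.sum_repr v, map_sum]
    simp only [map_smul, smul_eq_mul]
  have hconst : ∀ v ∈ M.deg D', ∃ c, γ v = C c := fun v hv => by
    have hi : ∀ i, ∃ c, B.b.repr v i * γ (B.b i) = C c := fun i => by
      rcases lt_trichotomy (B.d i) D' with hi | hi | hi
      · exact ⟨0, by rw [hlow i hi, mul_zero, C_0]⟩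
      · obtain ⟨a, ha⟩ := repr_eq_C B.b B.mem hv hi.symm
        obtain ⟨c, hc⟩ := hC i hi
        exact ⟨a * c, by rw [ha, hc, C_mul]⟩
      · exact ⟨0, by rw [repr_eq_zero B.b B.mem hv hi, zero_mul, C_0]⟩
    choose c hc using hi
    exact ⟨∑ i, c i, by rw [hsum, map_sum]; exact Finset.sum_congr rfl fun i _ => hc i⟩
  have hkill : γ e = 0 ∧ γ g = 0 ∧ γ h = 0 := by
    rcases hD.lt_or_eq with hD | rfl
    · have h0 : ∀ v ∈ M.deg D, γ v = 0 := fun v hv => by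
        rw [hsum]
        refine Finset.sum_eq_zero fun i _ => ?_
        by_cases hi : B.d i < D'
        · rw [hlow i hi, mul_zero]
        · rw [repr_eq_zero B.b B.mem hv (by omega), zero_mul]
      exact ⟨h0 e he, h0 g hg, h0 h hh⟩
    · obtain ⟨a, ha⟩ := hconst e he
      obtain ⟨b, hb⟩ := hconst g hg
      obtain ⟨c, hc⟩ := hconst h hh
      have hc0 : c = 0 := by
        obtain ⟨q, hq⟩ := h1 e
        rw [ht.rel_e, ← X_one_smul, map_smul, hc] at hq
        simpa using congrArg (MvPolynomial.eval ![0, 1]) hq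
      have ha0 : a = 0 := by
        obtain ⟨q, hq⟩ := h2 h
        rw [ht.rel_h, smul_sub, smul_comm, ht.rel_g, smul_comm (y k 0) (y k 2), ← X_zero_smul,
          ← X_zero_smul, ← X_one_smul, map_sub, map_smul, map_smul, map_smul, ha] at hq
        simpa using congrArg (MvPolynomial.eval ![1, 0]) hq
      have hb0 : b = 0 := by
        by_contra hb0
        refine not_isIndecomposable_of_functional B.b ht ((C b⁻¹ : P k) • γ)
          (fun v => (h1 v).mul_left _) (fun v => (h2 v).mul_left _) (fun i v hv => ?_) ?_ ?_ ?_ hM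
        · rw [LinearMap.smul_apply, smul_assoc]
          rw [show ∀ w : M.carrier, (C b⁻¹ : P k) • w = b⁻¹ • w from
            fun w => algebraMap_smul (P k) _ _]
          exact k_smul_mem _ (hdeg g hg i v hv)
        · rw [LinearMap.smul_apply, hb, smul_eq_mul, ← C_mul, inv_mul_cancel₀ hb0, C_1]
        · rw [LinearMap.smul_apply, ha, ha0, C_0, smul_zero]
        · rw [LinearMap.smul_apply, hc, hc0, C_0, smul_zero]
      exact ⟨by rw [ha, ha0, C_0], by rw [hb, hb0, C_0], by rw [hc, hc0, C_0]⟩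
  obtain ⟨i, hi, hi0⟩ := hne
  obtain ⟨c, hc⟩ := hC i hi
  have hc0 : c ≠ 0 := fun h => hi0 (by rw [hc, h, C_0])
  obtain ⟨η, θ, hη, hθ, hγ⟩ := exists_companions γ h1 h2
  have hv : γ (c⁻¹ • B.b i) = 1 := by
    rw [← algebraMap_smul (P k), map_smul, hc]
    change C c⁻¹ * C c = 1
    rw [← C_mul, inv_mul_cancel₀ hc0, C_1]
  obtain ⟨B', b0, b1, b2, hd, hB'⟩ := B.exists_adapted_basis he hg hh ht hg0 hη hθ hγ hconst
    (k_smul_mem _ (hi ▸ B.mem i)) hv hkill.1 hkill.2.1 hkill.2.2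
  obtain ⟨j, rfl⟩ := Int.le.dest hD
  refine ⟨j, B'.exists_normalForm_of_adapted hd (by rwa [b0, b1, b2]) (fun v => ?_) (fun v => ?_)
    fun v => ?_⟩
  · obtain ⟨-, a5, a3⟩ := hB' (y k 0 • v)
    obtain ⟨a1, -, a2⟩ := hB' v
    have := hγ v
    rw [hθ] at a5
    linear_combination this - a3 - a5 + X 0 * a1
  · rw [← (hB' _).1, hη, (hB' v).2.1]
  · rw [← (hB' _).2.1, hθ, (hB' v).2.2]

end GrMod.MinimalBasis

end NodalCone

/-! ### Existence of triples and functionals by dimension counts. -/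

namespace NodalCone

open MvPolynomial

section LinearAlgebra

variable {K V : Type*} [Field K] [AddCommGroup V] [Module K V]

/-- The restriction of f to W factors through W/(W ∩ Q), a subspace of V/Q, and extends from there.
-/
theorem exists_functional_eq_of_inf_le_ker {f : V →ₗ[K] K} {W Q : Submodule K V}
    (h : W ⊓ Q ≤ LinearMap.ker f) :
    ∃ α : V →ₗ[K] K, (∀ w ∈ W, α w = f w) ∧ ∀ q ∈ Q, α q = 0 := by
  have hf : f.domRestrict W ∈ LinearMap.range (Q.mkQ.domRestrict W).dualMap := by
    rw [LinearMap.range_dualMap_eq_dualAnnihilator_ker, Submodule.mem_dualAnnihilator]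
    intro w hw
    exact h ⟨w.2, (Submodule.Quotient.mk_eq_zero Q).1 hw⟩
  obtain ⟨φ, hφ⟩ := hf
  refine ⟨φ ∘ₗ Q.mkQ, fun w hw => LinearMap.congr_fun hφ ⟨w, hw⟩, fun q hq => ?_⟩
  rw [LinearMap.comp_apply, Submodule.mkQ_apply, (Submodule.Quotient.mk_eq_zero Q).2 hq, map_zero]

variable [FiniteDimensional K V]

/-- In the application T is the square of the operator at (1, 0). If dim(W ∩ ker Z) ≤ 1, then ker Z
and ker T each have image of dimension at least 2 in the 3-dimensional V/W, so these images meet;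
and ZW ⊆ W has dimension at least 2, so W + im Z has dimension at most 4 and adding im T gives at
most 5. If dim(W ∩ ker Z) ≥ 2, it meets the 2-dimensional W ∩ ker T inside W. Then either dim(W + im
Z) ≤ 4 as before, or dim(W ∩ im Z) ≤ 1, and W is not spanned by its intersections with im Z and im
T. -/
theorem sup_ker_inf_not_le_or {W : Submodule K V} {Z T : V →ₗ[K] V}
    (h6 : Module.finrank K V = 6) (hW : Module.finrank K W = 3)
    (hZ : 3 ≤ Module.finrank K (LinearMap.ker Z)) (hT : Module.finrank K (LinearMap.ker T) = 4)
    (hWT : Module.finrank K (W ⊓ LinearMap.ker T : Submodule K V) = 2)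
    (hWr : Module.finrank K (W ⊓ LinearMap.range T : Submodule K V) ≤ 1)
    (hZW : W.map Z ≤ W) (hTW : W.map T ≤ W) :
    (¬ ((LinearMap.ker Z ⊔ W) ⊓ (LinearMap.ker T ⊔ W) ≤ W) ∧
        W ⊔ LinearMap.range Z ⊔ LinearMap.range T ≠ ⊤) ∨
      (W ⊓ LinearMap.ker Z ⊓ (W ⊓ LinearMap.ker T) ≠ ⊥ ∧
        (W ⊔ LinearMap.range Z ⊔ LinearMap.range T ≠ ⊤ ∨
          ¬ W ≤ (W ⊓ LinearMap.range Z) ⊔ (W ⊓ LinearMap.range T))) := by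
  have rZ := LinearMap.finrank_range_add_finrank_ker Z
  have rT := LinearMap.finrank_range_add_finrank_ker T
  have wZ := finrank_map_add_finrank_inf_ker W Z
  have wT := finrank_map_add_finrank_inf_ker W T
  have s1 := Submodule.finrank_sup_add_finrank_inf_eq W (LinearMap.range Z)
  have s2 := Submodule.finrank_sup_add_finrank_inf_eq (W ⊔ LinearMap.range Z) (LinearMap.range T)
  have i1 : Module.finrank K (W.map Z) ≤ Module.finrank K (W ⊓ LinearMap.range Z : Submodule K V) :=
    Submodule.finrank_mono (le_inf hZW LinearMap.map_le_range)
  have i2 : Module.finrank K (W.map T)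
      ≤ Module.finrank K ((W ⊔ LinearMap.range Z) ⊓ LinearMap.range T : Submodule K V) :=
    Submodule.finrank_mono (le_inf (hTW.trans le_sup_left) LinearMap.map_le_range)
  have htop : Module.finrank K (W ⊔ LinearMap.range Z : Submodule K V) ≤ 4 →
      W ⊔ LinearMap.range Z ⊔ LinearMap.range T ≠ ⊤ := fun h htop => by
    rw [htop, finrank_top] at s2
    omega
  by_cases hk : Module.finrank K (W ⊓ LinearMap.ker Z : Submodule K V) ≤ 1
  · refine Or.inl ⟨fun hle => ?_, htop (by omega)⟩
    have s3 := Submodule.finrank_sup_add_finrank_inf_eq (LinearMap.ker Z) W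
    have s4 := Submodule.finrank_sup_add_finrank_inf_eq (LinearMap.ker T) W
    have s5 := Submodule.finrank_sup_add_finrank_inf_eq (LinearMap.ker Z ⊔ W) (LinearMap.ker T ⊔ W)
    have i3 := Submodule.finrank_mono hle
    have i4 := Submodule.finrank_le (LinearMap.ker Z ⊔ W ⊔ (LinearMap.ker T ⊔ W))
    rw [inf_comm] at s3 s4
    omega
  · refine Or.inr ⟨fun hbot => ?_, ?_⟩
    · have s3 := Submodule.finrank_sup_add_finrank_inf_eq (W ⊓ LinearMap.ker Z) (W ⊓ LinearMap.ker T)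
      have i3 := Submodule.finrank_mono (R := K)
        (sup_le inf_le_left inf_le_left : W ⊓ LinearMap.ker Z ⊔ W ⊓ LinearMap.ker T ≤ W)
      rw [hbot, finrank_bot] at s3
      omega
    · by_cases h4 : Module.finrank K (W ⊔ LinearMap.range Z : Submodule K V) ≤ 4
      · exact Or.inl (htop h4)
      · refine Or.inr fun hle => ?_
        have s3 := Submodule.finrank_sup_add_finrank_inf_eq (W ⊓ LinearMap.range Z)
          (W ⊓ LinearMap.range T)
        have i3 := Submodule.finrank_mono hle
        omega

end LinearAlgebra

namespace GrMod.MinimalBasis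

variable {k : Type u} [Field k] {M : GrMod k} (B : MinimalBasis M)

/-- The existence of a homogeneous element that spans a copy of the module over the normalization. -/
def HasTriple (D : ℤ) : Prop :=
  ∃ a ∈ B.filt D, ∃ c ∈ B.filt D, B.op ![0, 1] a = 0 ∧ B.op ![1, 0] (B.op ![1, 0] c) = 0 ∧
    (∀ i, B.d i = D → a i = c i) ∧ ∃ i, B.d i = D ∧ a i ≠ 0

/-- The existence of a functional that determines a homomorphism to the module over the
normalization. -/
def HasFunctional (D : ℤ) : Prop :=
  ∃ α κ : (Fin 6 → k) →ₗ[k] k, (∀ c, α (B.op ![0, 1] c) = 0) ∧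
    (∀ c, κ (B.op ![1, 0] (B.op ![1, 0] c)) = 0) ∧
    (∀ i, B.d i < D → α (Pi.single i 1) = 0 ∧ κ (Pi.single i 1) = 0) ∧
    (∀ i, B.d i = D → α (Pi.single i 1) = κ (Pi.single i 1)) ∧
    ∃ i, B.d i = D ∧ α (Pi.single i 1) ≠ 0

theorem exists_single_ne_zero {f : (Fin 6 → k) →ₗ[k] k} {w : Fin 6 → k} (hw : f w ≠ 0) :
    ∃ i, w i ≠ 0 ∧ f (Pi.single i 1) ≠ 0 := by
  by_contra! h
  refine hw ?_
  rw [pi_eq_sum_univ' w, map_sum]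
  refine Finset.sum_eq_zero fun i _ => ?_
  rw [map_smul]
  by_cases hi : w i = 0
  · rw [hi, zero_smul]
  · rw [h i hi, smul_zero]

variable {B} {D : ℤ} {W : Submodule k (Fin 6 → k)}

/-- In the highest degree the values at the two points need only agree modulo W, the span of the
lower generators, where they are independent of each other. -/
theorem hasTriple_of_not_le (hD : ∀ i, B.d i ≤ D)
    (hW : ∀ c, c ∈ W ↔ ∀ i, B.d i = D → c i = 0)
    (h : ¬ ((LinearMap.ker (B.op ![0, 1]) ⊔ W)
      ⊓ (LinearMap.ker (B.op ![1, 0] ∘ₗ B.op ![1, 0]) ⊔ W) ≤ W)) : B.HasTriple D := by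
  obtain ⟨v, ⟨h1, h2⟩, hv⟩ := SetLike.not_le_iff_exists.1 h
  obtain ⟨a, ha, w, hw, e1⟩ := Submodule.mem_sup.1 h1
  obtain ⟨c, hc, w', hw', e2⟩ := Submodule.mem_sup.1 h2
  have hac : ∀ i, B.d i = D → a i = v i ∧ c i = v i := fun i hi => by
    constructor
    · rw [← e1, Pi.add_apply, (hW w).1 hw i hi, add_zero]
    · rw [← e2, Pi.add_apply, (hW w').1 hw' i hi, add_zero]
  have hf : ∀ c, c ∈ B.filt D := fun c i hi => absurd (hD i) (by omega)
  rw [hW] at hv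
  push Not at hv
  obtain ⟨i, hi, hvi⟩ := hv
  exact ⟨a, hf a, c, hf c, ha, hc, fun i hi => (hac i hi).1.trans (hac i hi).2.symm, i, hi,
    by rwa [(hac i hi).1]⟩

theorem hasFunctional_of_ne_top (hD : ∀ i, B.d i ≤ D)
    (hW : ∀ c, c ∈ W ↔ ∀ i, B.d i = D → c i = 0)
    (h : W ⊔ LinearMap.range (B.op ![0, 1]) ⊔ LinearMap.range (B.op ![1, 0] ∘ₗ B.op ![1, 0]) ≠ ⊤) :
    B.HasFunctional D := by
  obtain ⟨f, hf0, hf⟩ := Submodule.exists_le_ker_of_lt_top _ (lt_top_iff_ne_top.2 h)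
  obtain ⟨w, hw⟩ : ∃ w, f w ≠ 0 := by
    by_contra! h
    exact hf0 (LinearMap.ext h)
  obtain ⟨i, -, hi⟩ := exists_single_ne_zero hw
  have hlow : ∀ i, B.d i < D → f (Pi.single i 1) = 0 := fun i hi =>
    hf (Submodule.mem_sup_left (Submodule.mem_sup_left ((hW _).2 fun l hl => by
      rw [Pi.single_apply, if_neg]
      rintro rfl
      omega)))
  refine ⟨f, f, fun c => hf (Submodule.mem_sup_left (Submodule.mem_sup_right ⟨c, rfl⟩)),
    fun c => hf (Submodule.mem_sup_right ⟨c, rfl⟩), fun i hi => ⟨hlow i hi, hlow i hi⟩,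
    fun _ _ => rfl, i, (hD i).eq_of_not_lt fun h => hi (hlow i h), hi⟩

theorem hasTriple_of_ne_bot (hD : ∀ i, D ≤ B.d i)
    (h : B.filt D ⊓ LinearMap.ker (B.op ![0, 1])
      ⊓ (B.filt D ⊓ LinearMap.ker (B.op ![1, 0] ∘ₗ B.op ![1, 0])) ≠ ⊥) : B.HasTriple D := by
  obtain ⟨a, ⟨⟨ha, h1⟩, -, h2⟩, ha0⟩ := Submodule.exists_mem_ne_zero_of_ne_bot h
  obtain ⟨i, hi⟩ := Function.ne_iff.1 ha0
  refine ⟨a, ha, a, ha, h1, h2, fun _ _ => rfl, i, ?_, hi⟩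
  by_contra hne
  exact hi (ha i (lt_of_le_of_ne (hD i) (Ne.symm hne)))

/-- In the lowest degree α and κ need only agree on `B.filt D`. A functional that kills both
intersections there extends in two ways, one killing each image. -/
theorem hasFunctional_of_not_le (hD : ∀ i, D ≤ B.d i)
    (h : ¬ B.filt D ≤ (B.filt D ⊓ LinearMap.range (B.op ![0, 1]))
      ⊔ (B.filt D ⊓ LinearMap.range (B.op ![1, 0] ∘ₗ B.op ![1, 0]))) : B.HasFunctional D := by
  obtain ⟨w, hw, hw'⟩ := SetLike.not_le_iff_exists.1 h
  obtain ⟨f, hfw, hf⟩ := Submodule.exists_le_ker_of_notMem hw'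
  obtain ⟨α, hα, hα0⟩ := exists_functional_eq_of_inf_le_ker (le_sup_left.trans hf)
  obtain ⟨κ, hκ, hκ0⟩ := exists_functional_eq_of_inf_le_ker (le_sup_right.trans hf)
  obtain ⟨i, hi, hfi⟩ := exists_single_ne_zero hfw
  have hmem : ∀ i, B.d i = D → Pi.single i 1 ∈ B.filt D := fun i hi l hl => by
    rw [Pi.single_apply, if_neg]
    rintro rfl
    omega
  have hid : B.d i = D := by
    by_contra hne
    exact hi (hw i (lt_of_le_of_ne (hD i) (Ne.symm hne)))
  exact ⟨α, κ, fun c => hα0 _ ⟨c, rfl⟩, fun c => hκ0 _ ⟨c, rfl⟩,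
    fun i hi => absurd (hD i) (by omega),
    fun i hi => (hα _ (hmem i hi)).trans (hκ _ (hmem i hi)).symm, i, hid,
    by rwa [hα _ (hmem i hid)]⟩

variable (B) in
-- By `finrank_filt` every step of the degree filtration has dimension divisible by 3, so the six
-- degrees are equal or fall into two groups of three. If they are equal, kernels of dimensions at
-- least 3 and 4 meet in k⁶, and images of dimensions at most 3 and 2 do not span it. Otherwise
-- `sup_ker_inf_not_le_or` applies with W the span of the lower generators.
theorem exists_hasTriple_hasFunctional (hZ : 3 ≤ Module.finrank k (LinearMap.ker (B.op ![0, 1]))) :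
    ∃ D D', D ≤ D' ∧ B.HasTriple D ∧ B.HasFunctional D' := by
  have h6 : Module.finrank k (Fin 6 → k) = 6 := by simp
  have htop : ∀ D, (∀ i, B.d i ≤ D) → B.filt D = ⊤ := fun D hD =>
    eq_top_iff.2 fun c _ i hi => absurd (hD i) (by omega)
  have hpos : ∀ i, Pi.single i 1 ∈ B.filt (B.d i) := fun i l hl => by
    rw [Pi.single_apply, if_neg]
    rintro rfl
    omega
  have hkerT : Module.finrank k (LinearMap.ker (B.op ![1, 0] ∘ₗ B.op ![1, 0])) = 4 := by
    obtain ⟨D, hD⟩ := (Set.finite_range B.d).bddAbove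
    have h1 := B.finrank_filt D
    rw [htop D fun i => hD ⟨i, rfl⟩, top_inf_eq, top_inf_eq, finrank_top, h6] at h1
    omega
  obtain ⟨i₁, -, hi₁⟩ := Finset.exists_min_image Finset.univ B.d ⟨0, Finset.mem_univ _⟩
  replace hi₁ := fun i => hi₁ i (Finset.mem_univ i)
  by_cases hA : ∀ i, B.d i = B.d i₁
  · have hW : ∀ c, c ∈ (⊥ : Submodule k (Fin 6 → k)) ↔ ∀ i, B.d i = B.d i₁ → c i = 0 := fun c => by
      rw [Submodule.mem_bot]
      exact ⟨fun h i _ => by rw [h]; rfl, fun h => funext fun i => h i (hA i)⟩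
    refine ⟨_, _, le_rfl, hasTriple_of_not_le (fun i => (hA i).le) hW fun hle => ?_,
      hasFunctional_of_ne_top (fun i => (hA i).le) hW fun h => ?_⟩
    · have s1 := Submodule.finrank_sup_add_finrank_inf_eq (LinearMap.ker (B.op ![0, 1]))
        (LinearMap.ker (B.op ![1, 0] ∘ₗ B.op ![1, 0]))
      have i1 := Submodule.finrank_le (LinearMap.ker (B.op ![0, 1])
        ⊔ LinearMap.ker (B.op ![1, 0] ∘ₗ B.op ![1, 0]))
      rw [sup_bot_eq, sup_bot_eq, le_bot_iff] at hle
      rw [hle, finrank_bot] at s1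
      omega
    · rw [bot_sup_eq] at h
      have s1 := Submodule.finrank_sup_add_finrank_inf_eq (LinearMap.range (B.op ![0, 1]))
        (LinearMap.range (B.op ![1, 0] ∘ₗ B.op ![1, 0]))
      have r1 := LinearMap.finrank_range_add_finrank_ker (B.op ![0, 1])
      have r2 := LinearMap.finrank_range_add_finrank_ker (B.op ![1, 0] ∘ₗ B.op ![1, 0])
      rw [h, finrank_top] at s1
      omega
  push Not at hA
  obtain ⟨i₂, hi₂, hmin⟩ := Finset.exists_min_image (Finset.univ.filter fun i => B.d i ≠ B.d i₁) B.d
    (by obtain ⟨i, hi⟩ := hA; exact ⟨i, by simpa using hi⟩)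
  replace hi₂ : B.d i₂ ≠ B.d i₁ := (Finset.mem_filter.1 hi₂).2
  replace hmin : ∀ i, B.d i ≠ B.d i₁ → B.d i₂ ≤ B.d i := fun i hi =>
    hmin i (Finset.mem_filter.2 ⟨Finset.mem_univ i, hi⟩)
  have hlt : B.d i₁ < B.d i₂ := lt_of_le_of_ne (hi₁ i₂) (Ne.symm hi₂)
  have f1 := B.finrank_filt (B.d i₁)
  have f2 := B.finrank_filt (B.d i₂)
  have p1 : 0 < Module.finrank k (B.filt (B.d i₁)) := by
    rw [Module.finrank_pos_iff_exists_ne_zero]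
    refine ⟨⟨_, hpos i₁⟩, fun h => ?_⟩
    simpa using congrFun (congrArg Subtype.val h) i₁
  have hlt' : B.filt (B.d i₁) < B.filt (B.d i₂) := by
    refine lt_of_le_of_ne (fun c hc i hi => hc i (hlt.trans hi)) fun h => ?_
    have := h ▸ hpos i₂
    simpa using this i₂ hlt
  have p2 := Submodule.finrank_lt_finrank_of_lt hlt'
  have p3 := Submodule.finrank_le (B.filt (B.d i₂))
  have htop2 : B.filt (B.d i₂) = ⊤ := Submodule.eq_top_of_finrank_eq (by omega)
  have hD2 : ∀ i, B.d i ≤ B.d i₂ := fun i => by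
    by_contra! hi
    have h1 : Pi.single i 1 ∈ B.filt (B.d i₂) := htop2 ▸ Submodule.mem_top
    simpa using h1 i hi
  have hW : ∀ c, c ∈ B.filt (B.d i₁) ↔ ∀ i, B.d i = B.d i₂ → c i = 0 := fun c =>
    ⟨fun h i hi => h i (hi ▸ hlt), fun h i hi => h i ((hD2 i).antisymm (hmin i hi.ne'))⟩
  have hWr : Module.finrank k (B.filt (B.d i₁) ⊓ LinearMap.range (B.op ![1, 0] ∘ₗ B.op ![1, 0]) :
      Submodule k (Fin 6 → k)) ≤ 1 := by
    have h1 : B.filt (B.d i₁) ⊓ LinearMap.range (B.op ![1, 0] ∘ₗ B.op ![1, 0])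
        ≤ B.filt (B.d i₁) ⊓ LinearMap.ker (B.op ![1, 0]) := by
      rintro _ ⟨h, c, rfl⟩
      exact ⟨h, B.op_op_op c⟩
    have := Submodule.finrank_mono h1
    omega
  have hmap : ∀ pt, (B.filt (B.d i₁)).map (B.op pt) ≤ B.filt (B.d i₁) := fun pt => by
    rintro _ ⟨c, hc, rfl⟩
    exact B.op_mem_filt pt hc
  rcases sup_ker_inf_not_le_or h6 (by omega) hZ hkerT (by omega) hWr (hmap _) (by
    rw [Submodule.map_comp]
    exact (Submodule.map_mono (hmap _)).trans (hmap _)) with ⟨h1, h2⟩ | ⟨h1, h2 | h2⟩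
  · exact ⟨_, _, le_rfl, hasTriple_of_not_le hD2 hW h1, hasFunctional_of_ne_top hD2 hW h2⟩
  · exact ⟨_, _, hlt.le, hasTriple_of_ne_bot hi₁ h1, hasFunctional_of_ne_top hD2 hW h2⟩
  · exact ⟨_, _, le_rfl, hasTriple_of_ne_bot hi₁ h1, hasFunctional_of_not_le hi₁ h2⟩

end GrMod.MinimalBasis

end NodalCone

/-! ### The classification. -/

namespace NodalCone

open MvPolynomial

namespace GrMod

variable {k : Type u} [Field k] {M : GrMod k}

namespace NormalForm

variable {d : ℤ} {j : ℕ} {lam mu : k} (N : NormalForm M d j lam mu)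

include N

/-- At (0, 1) the operator has coordinates lam c₄ - mu c₅ and mu c₄ - lam c₅, a system of
determinant mu² - lam². If it is invertible, a vector of the kernel is determined by its coordinates
0 and 1, so the kernel has dimension at most 2. -/
theorem isLocallyFree_of_ne (hk : (2 : k) ≠ 0) (h : lam ^ 2 ≠ mu ^ 2) : M.IsLocallyFree := by
  let B : MinimalBasis M := ⟨N.b, nfDeg d j, N.mem, N.constCoord_smul_eq_zero⟩
  refine B.isLocallyFree_of_finrank_ker_le hk ?_
  have hop : ∀ c i, B.op ![0, 1] c i = (![lam * c 4 - mu * c 5, mu * c 4 - lam * c 5,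
      c 0 - c 2 - mu * c 5, 0, 0, c 3 - c 5] : Fin 6 → k) i := fun c i => by
    obtain ⟨v, hv⟩ : ∃ v, v = ∑ i, (C (c i) : P k) • N.b i := ⟨_, rfl⟩
    have hr : ∀ i, N.b.repr v i = C (c i) := fun i => by rw [hv, N.b.repr_sum_self]
    have hc : B.eval ![0, 1] v = c := by
      ext i
      rw [MinimalBasis.eval_apply, show B.b.repr v i = C (c i) from hr i, eval_C]
    conv_lhs => rw [← hc, ← MinimalBasis.eval_smul, MinimalBasis.eval_apply]
    change MvPolynomial.eval ![0, 1] (N.b.repr (y k 0 • v) i) = _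
    rw [N.repr_smul]
    fin_cases i <;> simp [hr]
  let π : LinearMap.ker (B.op ![0, 1]) →ₗ[k] (Fin 2 → k) :=
    (LinearMap.funLeft k k ![(0 : Fin 6), 1]).domRestrict _
  have hπ : Function.Injective π := by
    rw [← LinearMap.ker_eq_bot, LinearMap.ker_eq_bot']
    rintro ⟨c, hc⟩ h0
    have e0 : c 0 = 0 := congrFun h0 0
    have e1 : c 1 = 0 := congrFun h0 1
    have hz := fun i => (hop c i).symm.trans (congrFun hc i)
    have z0 : lam * c 4 - mu * c 5 = 0 := hz 0
    have z1 : mu * c 4 - lam * c 5 = 0 := hz 1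
    have z2 : c 0 - c 2 - mu * c 5 = 0 := hz 2
    have z5 : c 3 - c 5 = 0 := hz 5
    have hne := sub_ne_zero.2 h
    have e4 : c 4 = 0 := (mul_eq_zero.1 (show (lam ^ 2 - mu ^ 2) * c 4 = 0 by
      linear_combination lam * z0 - mu * z1)).resolve_left hne
    have e5 : c 5 = 0 := (mul_eq_zero.1 (show (lam ^ 2 - mu ^ 2) * c 5 = 0 by
      linear_combination mu * z0 - lam * z1)).resolve_left hne
    rw [e5, sub_zero] at z5
    rw [e0, e5, mul_zero, sub_zero, zero_sub, neg_eq_zero] at z2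
    refine Subtype.ext (funext fun i => ?_)
    fin_cases i
    exacts [e0, e1, z2, z5, e4, e5]
  simpa using LinearMap.finrank_le_finrank_of_injective hπ

/-- Without correction terms the coordinate at b 1 satisfies the divisibilities that define a map to
L, and this map splits off the first copy. -/
theorem not_isIndecomposable_of_eq_zero (hl : lam = 0) (hm : mu = 0) : ¬ M.IsIndecomposable := by
  subst hl hm
  have h1 : ∀ v, N.b.coord 1 (y k 0 • v) = X 0 * N.b.repr v 2 := fun v => by
    rw [Module.Basis.coord_apply, N.repr_smul]
    simp
  have h2 : ∀ v, N.b.repr (y k 0 • v) 2 = X 1 * (N.b.repr v 0 - N.b.repr v 2) := fun v => by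
    rw [N.repr_smul]
    simp
  refine not_isIndecomposable_of_functional N.b N.triple (N.b.coord 1) (fun v => ⟨_, h1 v⟩)
    (fun v => by rw [h1, h2]; exact ⟨_, mul_left_comm _ _ _⟩)
    (fun i v hv => functional_smul_mem N.mem (fun i => ?_) hv) (by simp) (by simp) (by simp)
  by_cases h : i = 1
  · rw [h, Module.Basis.coord_apply, N.b.repr_self, Finsupp.single_eq_same, one_smul]
    exact N.mem 1
  · rw [Module.Basis.coord_apply, N.b.repr_self, Finsupp.single_eq_of_ne (Ne.symm h), zero_smul]
    exact zero_mem _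

end NormalForm

/-- A functional and a copy of the module over the normalization give a normal form. -/
theorem MinimalBasis.exists_normalForm_of_hasTriple (B : MinimalBasis M) (hM : M.IsIndecomposable)
    {D D' : ℤ} (hD : D ≤ D') (hT : B.HasTriple D) (hF : B.HasFunctional D') :
    ∃ (j : ℕ) (lam mu : k), Nonempty (NormalForm M D j lam mu) := by
  obtain ⟨a, ha, c, hc, h1, h2, hac, i, hi, hai⟩ := hT
  obtain ⟨α, κ, hα, hκ, hlow, heq, l, hl, hαl⟩ := hF
  obtain ⟨g, hg, e1, e2⟩ := B.exists_eval_eq ha hc hac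
  obtain ⟨e, he, h, hh, ht⟩ := B.exists_isTriple hg (by rw [e1, h1]) (by rw [e2, h2])
  have hg0 : constCoord B.b g ≠ 0 := fun h0 => hai (by
    rw [← e1, eval_apply, B.repr_eq_C_const hg hi.symm, h0]
    simp)
  obtain ⟨γ, g1, g2, g3, g4, g5⟩ := B.exists_functional α κ hα hκ hlow heq
  exact B.exists_normalForm_of_functional hM hD he hg hh ht hg0 γ g1 g2 g3
    (fun i hi => ⟨_, g4 i hi⟩) g5 ⟨l, hl, by rw [g4 l hl]; simpa using hαl⟩

/-- Failure of local freeness enters twice: it makes the kernel at (0, 1) large enough for a normal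
form to exist, and then forces lam² = mu². Indecomposability excludes lam = mu = 0, so lam can be
scaled to 1. -/
theorem IsSixGenerated.exists_normalForm (hk : (2 : k) ≠ 0) (hM : M.IsSixGenerated) :
    ∃ (d : ℤ) (j : ℕ) (mu : k), (mu = 1 ∨ mu = -1) ∧ Nonempty (NormalForm M d j 1 mu) := by
  obtain ⟨hmcm, hind, hr, hlf, hgen⟩ := hM
  obtain ⟨B⟩ := exists_minimalBasis hmcm hr hgen
  obtain ⟨D, D', hD, hT, hF⟩ := B.exists_hasTriple_hasFunctional <| by
    by_contra! h
    exact hlf (B.isLocallyFree_of_finrank_ker_le hk (by omega))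
  obtain ⟨j, lam, mu, ⟨N⟩⟩ := B.exists_normalForm_of_hasTriple hind hD hT hF
  have hsq : lam ^ 2 = mu ^ 2 := by
    by_contra h
    exact hlf (N.isLocallyFree_of_ne hk h)
  have hl : lam ≠ 0 := fun hl => by
    refine N.not_isIndecomposable_of_eq_zero hl ?_ hind
    rw [hl] at hsq
    simpa using hsq.symm
  have N' := N.scale (inv_ne_zero hl)
  rw [inv_mul_cancel₀ hl] at N'
  refine ⟨D, j, _, ?_, N'⟩
  rcases sq_eq_sq_iff_eq_or_eq_neg.1 hsq with rfl | rfl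
  · exact Or.inl (inv_mul_cancel₀ hl)
  · refine Or.inr ?_
    have : mu ≠ 0 := by simpa using hl
    field_simp

end GrMod

end NodalCone

theorem mainTheorem1 (k : Type u) [Field k] (hk : (2 : k) ≠ 0) :
    (∀ m : ℕ, 1 ≤ m →
      (NodalCone.cokerDelta k m).IsSixGenerated ∧ (NodalCone.cokerDeltaT k m).IsSixGenerated) ∧
    (∀ M : NodalCone.GrMod k, M.IsSixGenerated → ∃ m : ℕ, 1 ≤ m ∧ ∃ j : ℤ,
      M.IsoShift (NodalCone.cokerDelta k m) j ∨ M.IsoShift (NodalCone.cokerDeltaT k m) j) ∧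
    (∀ m m' : ℕ, 1 ≤ m → 1 ≤ m' → ∀ j : ℤ,
      ((NodalCone.cokerDelta k m).IsoShift (NodalCone.cokerDelta k m') j → m = m' ∧ j = 0) ∧
      ((NodalCone.cokerDeltaT k m).IsoShift (NodalCone.cokerDeltaT k m') j → m = m' ∧ j = 0) ∧
      ¬ (NodalCone.cokerDelta k m).IsoShift (NodalCone.cokerDeltaT k m') j) ∧
    {c : Quotient (NodalCone.GrMod.isoUpToShift (k := k)) |
      ∃ M : NodalCone.GrMod k, M.IsSixGenerated ∧ Quotient.mk _ M = c}.Countable ∧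
    {c : Quotient (NodalCone.GrMod.isoUpToShift (k := k)) |
      ∃ M : NodalCone.GrMod k, M.IsSixGenerated ∧ Quotient.mk _ M = c}.Infinite := by
  have six : ∀ m : ℕ, 1 ≤ m →
      (NodalCone.cokerDelta k m).IsSixGenerated ∧ (NodalCone.cokerDeltaT k m).IsSixGenerated := by
    rintro (_ | j) hm
    · omega
    obtain ⟨B⟩ := NodalCone.exists_normalForm_cokerDelta k j
    obtain ⟨B'⟩ := NodalCone.exists_normalForm_cokerDeltaT k j
    constructor
    -- The parameters are brought to the shape (lam, s lam) with s² = 1: here s = -1, and s = 1 for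
    -- the transpose.
    · rw [← mul_one (-1 : k)] at B
      exact B.isSixGenerated (by simp) one_ne_zero
    · rw [← one_mul (-1 : k)] at B'
      nth_rewrite 1 [one_mul] at B'
      exact B'.isSixGenerated (by simp) (by simp)
  have classify : ∀ M : NodalCone.GrMod k, M.IsSixGenerated → ∃ m : ℕ, 1 ≤ m ∧ ∃ j : ℤ,
      M.IsoShift (NodalCone.cokerDelta k m) j ∨ M.IsoShift (NodalCone.cokerDeltaT k m) j := by
    intro M hM
    obtain ⟨d, j, mu, hmu, ⟨B⟩⟩ := hM.exists_normalForm hk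
    -- The parameter j of the normal form corresponds to m = j + 1, and the generators of lowest
    -- degree of the cokernels have degree 1.
    refine ⟨j + 1, by omega, 1 - d, ?_⟩
    rcases hmu with rfl | rfl
    · obtain ⟨B1⟩ := B.scale (neg_ne_zero.2 (one_ne_zero (α := k)))
      obtain ⟨B'⟩ := NodalCone.exists_normalForm_cokerDeltaT k j
      rw [mul_one] at B1
      exact Or.inr (B1.isoShift B')
    · obtain ⟨B'⟩ := NodalCone.exists_normalForm_cokerDelta k j
      exact Or.inl (B.isoShift B')
  have distinct : ∀ m m' : ℕ, 1 ≤ m → 1 ≤ m' → ∀ j : ℤ,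
      ((NodalCone.cokerDelta k m).IsoShift (NodalCone.cokerDelta k m') j → m = m' ∧ j = 0) ∧
      ((NodalCone.cokerDeltaT k m).IsoShift (NodalCone.cokerDeltaT k m') j → m = m' ∧ j = 0) ∧
      ¬ (NodalCone.cokerDelta k m).IsoShift (NodalCone.cokerDeltaT k m') j := by
    rintro (_ | l) (_ | l') hm hm' j
    · omega
    · omega
    · omega
    obtain ⟨B⟩ := NodalCone.exists_normalForm_cokerDelta k l
    obtain ⟨B'⟩ := NodalCone.exists_normalForm_cokerDelta k l'
    obtain ⟨C⟩ := NodalCone.exists_normalForm_cokerDeltaT k l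
    obtain ⟨C'⟩ := NodalCone.exists_normalForm_cokerDeltaT k l'
    refine ⟨fun h => ?_, fun h => ?_, fun h => ?_⟩
    · obtain ⟨h1, h2, -⟩ := B.eq_of_isoShift (by simp) B' h
      omega
    · obtain ⟨h1, h2, -⟩ := C.eq_of_isoShift (by simp) C' h
      omega
    · obtain ⟨-, -, h3⟩ := B.eq_of_isoShift (by simp) C' h
      -- The pairs (1, -1) and (-1, -1) are proportional only if 2 = 0.
      exact hk (by linear_combination h3)
  refine ⟨six, classify, distinct, ?_, ?_⟩
  · refine ((Set.countable_range fun m => Quotient.mk _ (NodalCone.cokerDelta k m)).union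
      (Set.countable_range fun m => Quotient.mk _ (NodalCone.cokerDeltaT k m))).mono ?_
    rintro _ ⟨M, hM, rfl⟩
    obtain ⟨m, -, j, h | h⟩ := classify M hM
    · exact Or.inl ⟨m, Quotient.sound (Setoid.symm ⟨j, h⟩)⟩
    · exact Or.inr ⟨m, Quotient.sound (Setoid.symm ⟨j, h⟩)⟩
  · refine Set.infinite_of_injective_forall_mem
      (f := fun m : ℕ => Quotient.mk _ (NodalCone.cokerDelta k (m + 1))) (fun m m' h => ?_)
      fun m => ⟨_, (six (m + 1) (by omega)).1, rfl⟩
    obtain ⟨j, h⟩ := Quotient.exact h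
    have := ((distinct (m + 1) (m' + 1) (by omega) (by omega) j).1 h).1
    omega
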